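/- **Theorem 2.1.** Let $t_0<T$, $\nu\in\mathbb N$, and let $m_1\le m_2\le\dots\le m_{\nu+1}$ be dimensions; put $n=m_1+\dots+m_\nu$, $m=m_{\nu+1}$, and write $x=(x_1,\dots,x_\nu)\in\mathbb R^n=\mathbb R^{m_1}\times\dots\times\mathbb R^{m_\nu}$. Consider the control system $$\dot x(t)=f(t,x(t),u(t)),\quad t\in[t_0,T],$$ with state $x\in\mathbb R^n$, control $u\in\mathbb R^m$, and right-hand side of the triangular form $$f(t,x,u)=\bigl(f_1(t,x_1,x_2),\,f_2(t,x_1,x_2,x_3),\dots,f_{\nu-1}(t,x_1,\dots,x_\nu),\,f_\nu(t,x_1,\dots,x_\nu,u)\bigr),\qquad f_i(t,x_1,\dots,x_{i+1})\in\mathbb R^{m_i}.$$ Assume: (I) $f$, $\partial f/\partial x$ and $\partial f/\partial u$ exist and are continuous on $[t_0,T]\times\mathbb R^n\times\mathbb R^m$; (II) for each $i=1,\dots,\nu$ and each $(t,x_1,\dots,x_i)\in[t_0,T]\times\mathbb R^{m_1}\times\dots\times\mathbb R^{m_i}$, the map $f_i(t,x_1,\dots,x_i,\cdot)$ is of class $C^{m_{i+1}-m_i+1}(\mathbb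 R^{m_{i+1}};\mathbb R^{m_i})$ and $f_i(t,x_1,\dots,x_i,\mathbb R^{m_{i+1}})=\mathbb R^{m_i}$. Let $t_1\in(t_0,T)$, $x^*=(x_1^*,\dots,x_\nu^*)\in\mathbb R^n$ and $u^*=x_{\nu+1}^*\in\mathbb R^m$ be such that $$\operatorname{rank}\frac{\partial f_i}{\partial x_{i+1}}(t_1,x_1^*,\dots,x_{i+1}^*)=m_i,\qquad i=1,\dots,\nu.$$ For a continuous control $u(\cdot)$ on an interval $J\ni t_1$, let $x(\cdot,t_1,x^*,u(\cdot))$ denote the (unique) trajectory of the system with control $u(\cdot)$ and $x(t_1)=x^*$. Then there exist families of controls $\{\bar u_{x^T}(\cdot)\}_{x^T\in\mathbb R^n}$ on $[t_1,T]$ and $\{\tilde u_{x^0}(\cdot)\}_{x^0\in\mathbb R^n}$ on $[t_0,t_1]$ such that: 1. the maps $x^T\mapsto\bar u_{x^T}(\cdot)$ and $x^0\mapsto\tilde u_{x^0}(\cdot)$ are of classes $C(\mathbb R^n;C([t_1,T];\mathbb R^m))$ and $C(\mathbb R^n;C([t_0,t_1];\mathbb R^m))$ respectively (the spaces $C([a,b];\mathbb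 R^m)$ carry the topology of uniform convergence); 2. $\tilde u_{x^0}(t_1)=\bar u_{x^T}(t_1)=u^*$ for all $x^0,x^T\in\mathbb R^n$; 3. for all $x^0,x^T\in\mathbb R^n$, the trajectories $t\mapsto x(t,t_1,x^*,\bar u_{x^T}(\cdot))$ and $t\mapsto x(t,t_1,x^*,\tilde u_{x^0}(\cdot))$ are defined on all of $[t_1,T]$ and $[t_0,t_1]$ respectively, and $$x(T,t_1,x^*,\bar u_{x^T}(\cdot))=x^T,\qquad x(t_0,t_1,x^*,\tilde u_{x^0}(\cdot))=x^0.$$ -/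

import Mathlib

namespace TriangularControl

/-- The Euclidean space of dimension `d`. -/
abbrev Vec (d : ℕ) : Type := EuclideanSpace ℝ (Fin d)

/-- The state space `ℝⁿ = ℝ^{m_1} × ⋯ × ℝ^{m_ν}`, where `n = m_1 + ⋯ + m_ν`. The block sizes
`m_1, …, m_ν, m_{ν+1}` are given by `m : Fin (ν + 1) → ℕ`, numbered from `0`. -/
abbrev State {ν : ℕ} (m : Fin (ν + 1) → ℕ) : Type := (i : Fin ν) → Vec (m i.castSucc)

/-- The control space, of dimension `m_{ν+1}`. -/
abbrev Control {ν : ℕ} (m : Fin (ν + 1) → ℕ) : Type := Vec (m (Fin.last ν))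

/-- The space of the first `i` blocks `(x_1, …, x_i)` of a state. -/
abbrev Head {ν : ℕ} (m : Fin (ν + 1) → ℕ) (i : Fin ν) : Type :=
  (j : Set.Iic i) → Vec (m j.1.castSucc)

/-- The components `f_i(t, (x_1, …, x_i), x_{i+1}) ∈ ℝ^{m_i}`, `i = 1, …, ν`, of a right-hand side
of triangular form. -/
abbrev Components {ν : ℕ} (m : Fin (ν + 1) → ℕ) : Type :=
  (i : Fin ν) → ℝ → Head m i → Vec (m i.succ) → Vec (m i.castSucc)

/-- The first `i` blocks of a state. -/
def head {ν : ℕ} {m : Fin (ν + 1) → ℕ} (x : State m) (i : Fin ν) : Head m i := fun j => x j.1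

/-- The block `x_{i+1}` that follows the `i`-th block of the state `x`, with `x_{ν+1} = u`. -/
def next {ν : ℕ} {m : Fin (ν + 1) → ℕ} (x : State m) (u : Control m) (i : Fin ν) :
    Vec (m i.succ) :=
  Fin.snoc (α := fun j : Fin (ν + 1) => Vec (m j)) x u i.succ

/-- The right-hand side of triangular form
`f(t,x,u) = (f_1(t,x_1,x_2), …, f_{ν-1}(t,x_1,…,x_ν), f_ν(t,x_1,…,x_ν,u))`. -/
def field {ν : ℕ} {m : Fin (ν + 1) → ℕ} (F : Components m) (t : ℝ) (x : State m)
    (u : Control m) : State m :=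
  fun i => F i t (head x i) (next x u i)

/-- Condition (I): `f`, `∂f/∂x` and `∂f/∂u` exist and are continuous on `[t₀,T] × ℝⁿ × ℝᵐ`. -/
structure ConditionI {ν : ℕ} {m : Fin (ν + 1) → ℕ} (t₀ T : ℝ)
    (f : ℝ → State m → Control m → State m) : Prop where
  continuousOn :
    ContinuousOn (fun p : ℝ × State m × Control m => f p.1 p.2.1 p.2.2)
      (Set.Icc t₀ T ×ˢ Set.univ)
  differentiable_state :
    ∀ t ∈ Set.Icc t₀ T, ∀ u : Control m, Differentiable ℝ (fun x : State m => f t x u)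
  differentiable_control :
    ∀ t ∈ Set.Icc t₀ T, ∀ x : State m, Differentiable ℝ (fun u : Control m => f t x u)
  continuousOn_deriv_state :
    ContinuousOn (fun p : ℝ × State m × Control m =>
        fderiv ℝ (fun x : State m => f p.1 x p.2.2) p.2.1)
      (Set.Icc t₀ T ×ˢ Set.univ)
  continuousOn_deriv_control :
    ContinuousOn (fun p : ℝ × State m × Control m =>
        fderiv ℝ (fun u : Control m => f p.1 p.2.1 u) p.2.2)
      (Set.Icc t₀ T ×ˢ Set.univ)

/-- Condition (II): each map `f_i(t,x_1,…,x_i,·)` is of class `C^{m_{i+1}-m_i+1}` and maps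
`ℝ^{m_{i+1}}` onto `ℝ^{m_i}`. -/
structure ConditionII {ν : ℕ} {m : Fin (ν + 1) → ℕ} (t₀ T : ℝ) (F : Components m) : Prop where
  contDiff :
    ∀ i : Fin ν, ∀ t ∈ Set.Icc t₀ T, ∀ y : Head m i,
      ContDiff ℝ ((m i.succ - m i.castSucc + 1 : ℕ) : WithTop ℕ∞) (F i t y)
  surjective :
    ∀ i : Fin ν, ∀ t ∈ Set.Icc t₀ T, ∀ y : Head m i, Function.Surjective (F i t y)

/-- Every `∂f_i/∂x_{i+1}`, `i = 1, …, ν`, has rank `m_i` at `(t₁, x*, u*)`. -/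
def HasFullRanks {ν : ℕ} {m : Fin (ν + 1) → ℕ} (F : Components m) (t₁ : ℝ) (x : State m)
    (u : Control m) : Prop :=
  ∀ i : Fin ν,
    Module.finrank ℝ (LinearMap.range
      (fderiv ℝ (F i t₁ (head x i)) (next x u i)).toLinearMap) = m i.castSucc

/-- On the interval `J`, the function `x` solves `ẋ(t) = f(t, x(t), u(t))`, `x(τ) = ξ`
(with one-sided derivatives at the end points of `J`). -/
structure IsSolution {ν : ℕ} {m : Fin (ν + 1) → ℕ} (f : ℝ → State m → Control m → State m)
    (J : Set ℝ) (u : J → Control m) (τ : ℝ) (ξ : State m) (x : ℝ → State m) : Prop where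
  initial : x τ = ξ
  hasDerivWithinAt : ∀ t : J, HasDerivWithinAt x (f t (x t) (u t)) J t

/-- The trajectory `t ↦ x(t, τ, ξ, u(·))` is defined on the whole interval `J`, and its value
at `t = s` is `η`: the initial value problem has exactly one solution on `J`, and this solution
passes through `η` at time `s`. -/
def TrajectoryReaches {ν : ℕ} {m : Fin (ν + 1) → ℕ} (f : ℝ → State m → Control m → State m)
    (J : Set ℝ) (u : J → Control m) (τ : ℝ) (ξ : State m) (s : ℝ) (η : State m) : Prop :=
  ∃ x : ℝ → State m, IsSolution f J u τ ξ x ∧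
    (∀ y : ℝ → State m, IsSolution f J u τ ξ y → Set.EqOn y x J) ∧ x s = η

end TriangularControl

/-!
Steering is combined from an exact step near `t₁` and an approximate one on the rest of the
interval. Near `t₁`, the system linearized along the short reference trajectory with control `us`
is controllable: an adjoint solution that annihilates the control vanishes block by block, from the
last one to the first, because the `∂f_i/∂x_{i+1}` are onto. By the inverse function theorem every
state near the end of the reference trajectory is then reached exactly, by controls that depend
continuously on it.

On the rest of the interval, the system is solved backward in time from the target `x^T` and brought
close to the end of the reference trajectory, continuously in `x^T`, by backstepping. Suppose that
the blocks `x_1, …, x_k` obey their equations, with `x_k` having a prescribed velocity. As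
`f_k(t, x_1, …, x_k, ·)` is onto, this velocity is a convex combination, with weights continuous in
all parameters, of values of `f_k` at finitely many points; a curve `x_{k+1}` that visits these
points in rapid alternation for times proportional to the weights produces the same `x_k` up to a
small error. In the last step that curve is the control. The two directions of time are reduced to
the interval `[0, 1]` by an affine change of time.
-/

open Set Filter Topology MeasureTheory
open scoped NNReal

namespace TriangularControl

/-! ### Volterra equations -/

section Volterra

variable {E E' : Type*} [NormedAddCommGroup E] [NormedAddCommGroup E'] {S : ℝ}

/-- `H(t, ·)` is Lipschitz on balls, uniformly in `t ∈ [0, S]`. -/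
def LipschitzOnBalls (H : ℝ → E → E') (S : ℝ) : Prop :=
  ∀ R : ℝ, ∃ L : ℝ≥0, ∀ t ∈ Icc 0 S, LipschitzOnWith L (H t) (Metric.closedBall 0 R)

variable [NormedSpace ℝ E]

/-- `y` solves the Volterra equation `y(t) = c(t) + ∫₀ᵗ H(τ, y(τ)) dτ` on `[0, S]`. -/
def SolvesVolterra (H : ℝ → E → E) (S : ℝ) (c y : ℝ → E) : Prop :=
  ∀ t ∈ Icc 0 S, y t = c t + ∫ τ in (0 : ℝ)..t, H τ (y τ)

variable {H : ℝ → E → E} {c y z : ℝ → E}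

lemma SolvesVolterra.congr (hys : SolvesVolterra H S c y) (hzy : EqOn z y (Icc 0 S)) :
    SolvesVolterra H S c z := fun t ht => by
  rw [hzy ht, hys t ht]
  congr 1
  refine intervalIntegral.integral_congr fun τ hτ => ?_
  rw [uIcc_of_le ht.1] at hτ
  exact congrArg (H τ) (hzy ⟨hτ.1, hτ.2.trans ht.2⟩).symm

lemma SolvesVolterra.mono {S' : ℝ} (h : SolvesVolterra H S c y) (hS : S' ≤ S) :
    SolvesVolterra H S' c y :=
  fun t ht => h t ⟨ht.1, ht.2.trans hS⟩

lemma continuous_comp_graph {X Y Z : Type*} [TopologicalSpace X] [TopologicalSpace Y]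
    [TopologicalSpace Z] {H : X → Y → Z} (hH : Continuous (Function.uncurry H)) {y : X → Y}
    (hy : Continuous y) : Continuous fun x => H x (y x) :=
  hH.comp (continuous_id.prodMk hy)

lemma integral_mul_exp_two_mul (L t : ℝ) :
    ∫ τ in (0 : ℝ)..t, L * Real.exp (2 * L * τ) = (Real.exp (2 * L * t) - 1) / 2 := by
  have h : ∀ x ∈ uIcc 0 t, HasDerivAt (fun τ => Real.exp (2 * L * τ) / 2)
      (L * Real.exp (2 * L * x)) x := fun x _ =>
    (((hasDerivAt_const_mul (2 * L)).exp).div_const 2).congr_deriv (by ring)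
  rw [intervalIntegral.integral_eq_sub_of_hasDerivAt h
    (Continuous.intervalIntegrable (by fun_prop) _ _), mul_zero, Real.exp_zero]
  ring

lemma norm_integral_le_exp_mul {f : ℝ → E} {L M t : ℝ} (hM : 0 ≤ M) (ht : 0 ≤ t)
    (hf : ∀ τ ∈ Icc 0 t, ‖f τ‖ ≤ L * (Real.exp (2 * L * τ) * M)) :
    ‖∫ τ in (0 : ℝ)..t, f τ‖ ≤ Real.exp (2 * L * t) * (M / 2) :=
  calc ‖∫ τ in (0 : ℝ)..t, f τ‖ ≤ ∫ τ in (0 : ℝ)..t, (L * Real.exp (2 * L * τ)) * M :=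
        intervalIntegral.norm_integral_le_of_norm_le ht
          (Eventually.of_forall fun τ hτ => by
            rw [mul_assoc]; exact hf τ (Ioc_subset_Icc_self hτ))
          (Continuous.intervalIntegrable (by fun_prop) _ _)
    _ = (Real.exp (2 * L * t) - 1) / 2 * M := by
        rw [intervalIntegral.integral_mul_const, integral_mul_exp_two_mul]
    _ ≤ Real.exp (2 * L * t) * (M / 2) := by linarith

/-- The curve `t ↦ exp (2Lt) d(t)` on `[0, S]`, extended constantly in `d`. In terms of `d` the
sup norm becomes Bielecki's weighted norm, for which the Volterra operator of an `L`-Lipschitz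
right-hand side contracts by `1/2` however large `S` is. -/
noncomputable def weightedCurve (L : ℝ) (hS : 0 ≤ S) (d : C(Icc 0 S, E)) (t : ℝ) : E :=
  Real.exp (2 * L * t) • d (projIcc 0 S hS t)

lemma continuous_weightedCurve (L : ℝ) (hS : 0 ≤ S) (d : C(Icc 0 S, E)) :
    Continuous (weightedCurve L hS d) := by
  have : Continuous (projIcc 0 S hS) := continuous_projIcc
  unfold weightedCurve
  fun_prop

lemma weightedCurve_sub (L : ℝ) (hS : 0 ≤ S) (d d' : C(Icc 0 S, E)) (t : ℝ) :
    weightedCurve L hS d t - weightedCurve L hS d' t = weightedCurve L hS (d - d') t :=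
  (smul_sub _ _ _).symm

lemma norm_weightedCurve_le (L : ℝ) (hS : 0 ≤ S) (d : C(Icc 0 S, E)) (t : ℝ) :
    ‖weightedCurve L hS d t‖ ≤ Real.exp (2 * L * t) * ‖d‖ := by
  rw [weightedCurve, norm_smul, Real.norm_of_nonneg (Real.exp_pos _).le]
  gcongr
  exact d.norm_coe_le_norm _

/-- The Volterra operator `y ↦ c + ∫₀ H(τ, y(τ)) dτ`, conjugated by `weightedCurve`. -/
noncomputable def weightedVolterra (L : ℝ) (hS : 0 ≤ S) (hH : Continuous (Function.uncurry H))
    (hc : Continuous c) (d : C(Icc 0 S, E)) : C(Icc 0 S, E) where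
  toFun t := Real.exp (-(2 * L * t)) • (c t + ∫ τ in (0 : ℝ)..t, H τ (weightedCurve L hS d τ))
  continuous_toFun := by
    have : Continuous fun t => ∫ τ in (0 : ℝ)..t, H τ (weightedCurve L hS d τ) :=
      intervalIntegral.continuous_primitive (fun _ _ =>
        (continuous_comp_graph hH (continuous_weightedCurve L hS d)).intervalIntegrable _ _) _
    fun_prop

lemma norm_weightedVolterra_sub_le {L : ℝ≥0} (hS : 0 ≤ S) (hH : Continuous (Function.uncurry H))
    (hc : Continuous c) {R : ℝ} (hlip : ∀ t ∈ Icc 0 S, LipschitzOnWith L (H t) {x | ‖x‖ ≤ R})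
    {d d' : C(Icc 0 S, E)} (hd : ∀ t ∈ Icc 0 S, ‖weightedCurve L hS d t‖ ≤ R)
    (hd' : ∀ t ∈ Icc 0 S, ‖weightedCurve L hS d' t‖ ≤ R) :
    ‖weightedVolterra L hS hH hc d - weightedVolterra L hS hH hc d'‖ ≤ ‖d - d'‖ / 2 := by
  refine (ContinuousMap.norm_le _ (by positivity)).2 fun t => ?_
  have hint (d : C(Icc 0 S, E)) : IntervalIntegrable
      (fun τ => H τ (weightedCurve L hS d τ)) volume 0 t :=
    (continuous_comp_graph hH (continuous_weightedCurve L hS d)).intervalIntegrable _ _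
  have key : ‖∫ τ in (0 : ℝ)..t,
      (H τ (weightedCurve L hS d τ) - H τ (weightedCurve L hS d' τ))‖
      ≤ Real.exp (2 * L * t) * (‖d - d'‖ / 2) := by
    refine norm_integral_le_exp_mul (norm_nonneg _) t.2.1 fun τ hτ => ?_
    have hτS : τ ∈ Icc 0 S := ⟨hτ.1, hτ.2.trans t.2.2⟩
    refine ((hlip τ hτS).norm_sub_le (hd τ hτS) (hd' τ hτS)).trans ?_
    rw [weightedCurve_sub]
    gcongr
    exact norm_weightedCurve_le _ _ _ _
  rw [ContinuousMap.sub_apply]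
  simp only [weightedVolterra, ContinuousMap.coe_mk]
  rw [← smul_sub, add_sub_add_left_eq_sub, ← intervalIntegral.integral_sub (hint d) (hint d'),
    norm_smul, Real.norm_of_nonneg (Real.exp_pos _).le, Real.exp_neg,
    inv_mul_le_iff₀ (Real.exp_pos _)]
  exact key

lemma solvesVolterra_of_isFixedPt {L : ℝ} (hS : 0 ≤ S) (hH : Continuous (Function.uncurry H))
    (hc : Continuous c) {d : C(Icc 0 S, E)}
    (hd : Function.IsFixedPt (weightedVolterra L hS hH hc) d) :
    SolvesVolterra H S c (weightedCurve L hS d) := by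
  intro t ht
  have h : d ⟨t, ht⟩ = Real.exp (-(2 * L * t)) •
      (c t + ∫ τ in (0 : ℝ)..t, H τ (weightedCurve L hS d τ)) :=
    (DFunLike.congr_fun hd ⟨t, ht⟩).symm
  rw [weightedCurve, projIcc_of_mem hS ht, h, smul_smul, ← Real.exp_add, add_neg_cancel,
    Real.exp_zero, one_smul]

section Existence

variable [CompleteSpace E]

lemma exists_solvesVolterra_near_zero (hH : Continuous (Function.uncurry H)) (hS : 0 ≤ S)
    (hc : Continuous c) {ε a : ℝ} {L : ℝ≥0}
    (hlip : ∀ t ∈ Icc 0 S, LipschitzOnWith L (H t) {x | ‖x‖ ≤ ε})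
    (hres : ∀ t ∈ Icc 0 S, ‖c t + ∫ τ in (0 : ℝ)..t, H τ 0‖ ≤ a)
    (ha : 2 * a * Real.exp (2 * L * S) ≤ ε) :
    ∃ y : ℝ → E, Continuous y ∧ SolvesVolterra H S c y ∧ ∀ t ∈ Icc 0 S, ‖y t‖ ≤ ε := by
  have ha0 : 0 ≤ a := (norm_nonneg _).trans (hres 0 (left_mem_Icc.2 hS))
  set Φ := weightedVolterra L hS hH hc
  set B := Metric.closedBall (0 : C(Icc 0 S, E)) (2 * a)
  have hbound : ∀ d ∈ B, ∀ t ∈ Icc 0 S, ‖weightedCurve L hS d t‖ ≤ ε := fun d hd t ht => by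
    refine (norm_weightedCurve_le _ _ _ _).trans (le_trans ?_ ha)
    rw [mul_comm]
    gcongr
    exacts [mem_closedBall_zero_iff.1 hd, ht.2]
  have hhalf : ∀ d ∈ B, ∀ d' ∈ B, ‖Φ d - Φ d'‖ ≤ ‖d - d'‖ / 2 := fun d hd d' hd' =>
    norm_weightedVolterra_sub_le hS hH hc hlip (hbound d hd) (hbound d' hd')
  have h0B : (0 : C(Icc 0 S, E)) ∈ B := Metric.mem_closedBall_self (by positivity)
  have hΦ0 : ‖Φ 0‖ ≤ a := (ContinuousMap.norm_le _ ha0).2 fun t => by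
    have h1 : Real.exp (-(2 * L * t)) ≤ 1 :=
      Real.exp_le_one_iff.2 (by have := t.2.1; simp only [Left.neg_nonpos_iff]; positivity)
    simp only [Φ, weightedVolterra, weightedCurve, ContinuousMap.coe_mk, ContinuousMap.zero_apply,
      smul_zero, norm_smul, Real.norm_of_nonneg (Real.exp_pos _).le]
    exact (mul_le_of_le_one_left (norm_nonneg _) h1).trans (hres t t.2)
  have hmaps : MapsTo Φ B B := fun d hd => by
    have hd' := mem_closedBall_zero_iff.1 hd
    refine mem_closedBall_zero_iff.2 ((norm_le_norm_sub_add (Φ d) (Φ 0)).trans ?_)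
    have := hhalf d hd 0 h0B
    rw [sub_zero] at this
    linarith
  have hcontr : ContractingWith (1 / 2) (hmaps.restrict Φ B B) := by
    refine ⟨by norm_num, LipschitzWith.of_dist_le_mul fun d d' => ?_⟩
    rw [Subtype.dist_eq, Subtype.dist_eq, dist_eq_norm, dist_eq_norm]
    refine (hhalf d d.2 d' d'.2).trans (le_of_eq ?_)
    push_cast
    ring
  obtain ⟨d, hd, hfix, -⟩ := hcontr.exists_fixedPoint' Metric.isClosed_closedBall.isComplete hmaps
    h0B (edist_ne_top _ _)
  exact ⟨_, continuous_weightedCurve _ _ d, solvesVolterra_of_isFixedPt hS hH hc hfix, hbound d hd⟩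

theorem exists_solvesVolterra_near (hH : Continuous (Function.uncurry H))
    (hS : 0 ≤ S) {ρ : ℝ → E} (hρ : Continuous ρ) (hc : Continuous c) {ε a : ℝ} {L : ℝ≥0}
    (hlip : ∀ t ∈ Icc 0 S, LipschitzOnWith L (H t) (Metric.closedBall (ρ t) ε))
    (hres : ∀ t ∈ Icc 0 S, ‖c t + (∫ τ in (0 : ℝ)..t, H τ (ρ τ)) - ρ t‖ ≤ a)
    (ha : 2 * a * Real.exp (2 * L * S) ≤ ε) :
    ∃ y : ℝ → E, Continuous y ∧ SolvesVolterra H S c y ∧ ∀ t ∈ Icc 0 S, ‖y t - ρ t‖ ≤ ε := by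
  obtain ⟨z, hz, hzs, hzε⟩ := exists_solvesVolterra_near_zero
    (H := fun t x => H t (ρ t + x)) (c := fun t => c t - ρ t) (ε := ε) (a := a) (L := L)
    (hH.comp (f := fun p : ℝ × E => (p.1, ρ p.1 + p.2)) (by fun_prop)) hS (hc.sub hρ)
    (fun t ht => LipschitzOnWith.of_dist_le_mul fun x hx x' hx' => by
      have hball (x : E) (hx : ‖x‖ ≤ ε) : ρ t + x ∈ Metric.closedBall (ρ t) ε := by
        simpa [mem_closedBall_iff_norm] using hx
      simpa using (hlip t ht).dist_le_mul _ (hball x hx) _ (hball x' hx'))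
    (fun t ht => by simpa only [add_zero, sub_add_eq_add_sub] using hres t ht) ha
  refine ⟨fun t => ρ t + z t, hρ.add hz, fun t ht => ?_, fun t ht => by simpa using hzε t ht⟩
  have h : z t = c t - ρ t + ∫ τ in (0 : ℝ)..t, H τ (ρ τ + z τ) := hzs t ht
  dsimp only
  rw [← add_sub_cancel (ρ t) (c t), add_assoc, ← h]

lemma exists_solvesVolterra_of_lipschitzWith (hH : Continuous (Function.uncurry H)) (hS : 0 ≤ S)
    (hc : Continuous c) {L : ℝ≥0} (hlip : ∀ t ∈ Icc 0 S, LipschitzWith L (H t)) :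
    ∃ y : ℝ → E, Continuous y ∧ SolvesVolterra H S c y := by
  have hI : Continuous fun t => ∫ τ in (0 : ℝ)..t, H τ 0 :=
    intervalIntegral.continuous_primitive (fun _ _ =>
      (continuous_comp_graph hH continuous_const).intervalIntegrable _ _) 0
  obtain ⟨a, ha⟩ := isCompact_Icc.exists_bound_of_continuousOn (s := Icc 0 S)
    (hc.add hI).continuousOn
  obtain ⟨y, hy, hys, -⟩ := exists_solvesVolterra_near_zero hH hS hc
    (fun t ht => (hlip t ht).lipschitzOnWith) ha le_rfl
  exact ⟨y, hy, hys⟩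

theorem LipschitzOnBalls.exists_tolerance (hlip : LipschitzOnBalls H S)
    (hH : Continuous (Function.uncurry H)) (R : ℝ) {ε : ℝ} (hε : 0 < ε) :
    ∃ a > 0, ∀ S' ∈ Icc 0 S, ∀ ρ c : ℝ → E, Continuous ρ → Continuous c →
      (∀ t ∈ Icc 0 S', ‖ρ t‖ ≤ R) →
      (∀ t ∈ Icc 0 S', ‖c t + (∫ τ in (0 : ℝ)..t, H τ (ρ τ)) - ρ t‖ ≤ a) →
      ∃ y : ℝ → E, Continuous y ∧ SolvesVolterra H S' c y ∧
        ∀ t ∈ Icc 0 S', ‖y t - ρ t‖ ≤ ε := by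
  obtain ⟨L, hL⟩ := hlip (R + ε)
  refine ⟨ε / (2 * Real.exp (2 * L * S)), by positivity, fun S' hS' ρ c hρ hc hR hres => ?_⟩
  refine exists_solvesVolterra_near hH hS'.1 hρ hc
    (fun t ht => (hL t ⟨ht.1, ht.2.trans hS'.2⟩).mono ?_) hres ?_
  · refine Metric.closedBall_subset_closedBall' ?_
    rw [dist_zero_right]
    linarith [hR t ht]
  · have : Real.exp (2 * L * S') ≤ Real.exp (2 * L * S) := by gcongr; exact hS'.2
    calc 2 * (ε / (2 * Real.exp (2 * L * S))) * Real.exp (2 * L * S')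
        ≤ 2 * (ε / (2 * Real.exp (2 * L * S))) * Real.exp (2 * L * S) := by gcongr
      _ = ε := by field_simp

lemma LipschitzOnBalls.exists_short_solvesVolterra (hlip : LipschitzOnBalls H S)
    (hH : Continuous (Function.uncurry H)) (hS : 0 < S) (x : E) :
    ∃ δ ∈ Ioc 0 S, ∃ ξ : ℝ → E, Continuous ξ ∧ SolvesVolterra H δ (fun _ => x) ξ := by
  obtain ⟨a, ha, htol⟩ := hlip.exists_tolerance hH ‖x‖ one_pos
  have hI : Continuous fun t => ∫ τ in (0 : ℝ)..t, H τ x :=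
    intervalIntegral.continuous_primitive (fun _ _ =>
      (continuous_comp_graph hH continuous_const).intervalIntegrable _ _) 0
  have hsmall : ∀ᶠ t in 𝓝 (0 : ℝ), ‖∫ τ in (0 : ℝ)..t, H τ x‖ < a :=
    hI.norm.continuousAt.eventually_lt continuousAt_const (by simpa using ha)
  obtain ⟨δ, hδ, hδa⟩ := Metric.nhds_basis_closedBall.mem_iff.1 hsmall
  have hδS : min δ S ∈ Ioc 0 S := ⟨lt_min hδ hS, min_le_right _ _⟩
  obtain ⟨ξ, hξ, hξs, -⟩ := htol (min δ S) (Ioc_subset_Icc_self hδS) (fun _ => x) (fun _ => x)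
    continuous_const continuous_const (fun _ _ => le_rfl) fun t ht => by
      rw [add_sub_cancel_left]
      have htδ : t ∈ Metric.closedBall (0 : ℝ) δ := by
        simpa [abs_of_nonneg ht.1] using ht.2.trans (min_le_left _ _)
      exact (hδa htδ).le
  exact ⟨min δ S, hδS, ξ, hξ, hξs⟩

end Existence

section Uniqueness

lemma LipschitzOnBalls.eqOn_of_hasDerivWithinAt_sub (hlip : LipschitzOnBalls H S)
    (hy : ContinuousOn y (Icc 0 S)) (hz : ContinuousOn z (Icc 0 S))
    (hyz : ∀ t ∈ Icc 0 S,
      HasDerivWithinAt (fun t => y t - z t) (H t (y t) - H t (z t)) (Icc 0 S) t)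
    (h0 : y 0 = z 0) : EqOn y z (Icc 0 S) := by
  obtain ⟨R₁, hR₁⟩ := isCompact_Icc.exists_bound_of_continuousOn hy
  obtain ⟨R₂, hR₂⟩ := isCompact_Icc.exists_bound_of_continuousOn hz
  obtain ⟨L, hL⟩ := hlip (max R₁ R₂)
  have hzero := eq_zero_of_abs_deriv_le_mul_abs_self_of_eq_zero_right (K := L) (hy.sub hz)
    (fun t ht => (hyz t (Ico_subset_Icc_self ht)).mono_of_mem_nhdsWithin
      (Icc_mem_nhdsGE_of_mem ht)) (sub_eq_zero.2 h0) fun t ht => by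
    have ht' := Ico_subset_Icc_self ht
    exact (hL t ht').norm_sub_le
      (mem_closedBall_zero_iff.2 ((hR₁ t ht').trans (le_max_left _ _)))
      (mem_closedBall_zero_iff.2 ((hR₂ t ht').trans (le_max_right _ _)))
  exact fun t ht => sub_eq_zero.1 (hzero t ht)

variable [CompleteSpace E]

lemma hasDerivAt_integral_of_continuous {f : ℝ → E} (hf : Continuous f) (a t : ℝ) :
    HasDerivAt (fun t => ∫ τ in a..t, f τ) (f t) t :=
  intervalIntegral.integral_hasDerivAt_right (hf.intervalIntegrable _ _)
    hf.stronglyMeasurable.stronglyMeasurableAtFilter hf.continuousAt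

theorem SolvesVolterra.eqOn (hys : SolvesVolterra H S c y) (hzs : SolvesVolterra H S c z)
    (hH : Continuous (Function.uncurry H)) (hlip : LipschitzOnBalls H S) (hy : Continuous y)
    (hz : Continuous z) : EqOn y z (Icc 0 S) := by
  intro t ht
  have h0 : (0 : ℝ) ∈ Icc 0 S := left_mem_Icc.2 (ht.1.trans ht.2)
  have hsub : ∀ t ∈ Icc 0 S, y t - z t
      = (∫ τ in (0 : ℝ)..t, H τ (y τ)) - ∫ τ in (0 : ℝ)..t, H τ (z τ) := fun t ht => by
    rw [hys t ht, hzs t ht, add_sub_add_left_eq_sub]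
  refine hlip.eqOn_of_hasDerivWithinAt_sub hy.continuousOn hz.continuousOn (fun t ht => ?_)
    (by rw [hys 0 h0, hzs 0 h0, intervalIntegral.integral_same, intervalIntegral.integral_same]) ht
  exact ((hasDerivAt_integral_of_continuous (continuous_comp_graph hH hy) 0 t).sub
    (hasDerivAt_integral_of_continuous (continuous_comp_graph hH hz) 0 t)).hasDerivWithinAt.congr
    hsub (hsub t ht)

lemma SolvesVolterra.hasDerivWithinAt {a : E} (hy : SolvesVolterra H S (fun _ => a) y)
    (hc : Continuous fun t => H t (y t)) {t : ℝ} (ht : t ∈ Icc 0 S) :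
    HasDerivWithinAt y (H t (y t)) (Icc 0 S) t :=
  ((hasDerivAt_integral_of_continuous hc 0 t).const_add a).hasDerivWithinAt.congr hy (hy t ht)

end Uniqueness

section Dependence

variable [CompleteSpace E] {Λ : Type*} [TopologicalSpace Λ] {c y : Λ → ℝ → E}

lemma eventually_norm_solvesVolterra_sub_le (hH : Continuous (Function.uncurry H)) (hS : 0 ≤ S)
    (hlip : LipschitzOnBalls H S) (hc : Continuous (Function.uncurry c))
    (hy : ∀ l, Continuous (y l)) (hys : ∀ l, SolvesVolterra H S (c l) (y l)) (l₀ : Λ) {ε : ℝ}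
    (hε : 0 < ε) : ∀ᶠ l in 𝓝 l₀, ∀ t ∈ Icc 0 S, ‖y l t - y l₀ t‖ ≤ ε := by
  obtain ⟨R, hR⟩ := isCompact_Icc.exists_bound_of_continuousOn (s := Icc 0 S) (hy l₀).continuousOn
  obtain ⟨a, ha, htol⟩ := hlip.exists_tolerance hH R hε
  have hcl : ∀ l, Continuous (c l) := fun l => hc.uncurry_left l
  have hnear : ∀ᶠ l in 𝓝 l₀, ∀ t ∈ Icc 0 S, ‖c l t - c l₀ t‖ < a := by
    refine isCompact_Icc.eventually_forall_of_forall_eventually fun t _ => ?_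
    have : Continuous fun q : Λ × ℝ => ‖c q.1 q.2 - c l₀ q.2‖ :=
      (hc.sub ((hcl l₀).comp continuous_snd)).norm
    exact this.continuousAt.eventually_lt continuousAt_const (by simpa using ha)
  filter_upwards [hnear] with l hl t ht
  obtain ⟨z, hz, hzs, hzε⟩ := htol S ⟨hS, le_rfl⟩ (y l₀) (c l) (hy l₀) (hcl l) hR fun t ht => by
    have hdefect : c l t + (∫ τ in (0 : ℝ)..t, H τ (y l₀ τ)) - y l₀ t = c l t - c l₀ t := by
      rw [eq_sub_of_add_eq' (hys l₀ t ht).symm]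
      abel
    rw [hdefect]
    exact (hl t ht).le
  rw [(hys l).eqOn hzs hH hlip (hy l) hz ht]
  exact hzε t ht

theorem continuous_solvesVolterra (hH : Continuous (Function.uncurry H)) (hS : 0 ≤ S)
    (hlip : LipschitzOnBalls H S) (hc : Continuous (Function.uncurry c))
    (hy : ∀ l, Continuous (y l)) (hys : ∀ l, SolvesVolterra H S (c l) (y l)) :
    Continuous fun p : Λ × ℝ => y p.1 (projIcc 0 S hS p.2) := by
  refine continuous_iff_continuousAt.2 fun ⟨l₀, t₀⟩ => Metric.tendsto_nhds.2 fun ε hε => ?_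
  have hl := eventually_norm_solvesVolterra_sub_le hH hS hlip hc hy hys l₀ (half_pos hε)
  have ht : ∀ᶠ t in 𝓝 t₀, dist (y l₀ (projIcc 0 S hS t)) (y l₀ (projIcc 0 S hS t₀)) < ε / 2 :=
    Metric.tendsto_nhds.1 (((hy l₀).comp
      (continuous_subtype_val.comp continuous_projIcc)).tendsto t₀) _ (half_pos hε)
  rw [nhds_prod_eq]
  filter_upwards [hl.prod_mk ht] with p hp
  have := hp.1 (projIcc 0 S hS p.2) (projIcc 0 S hS p.2).2
  rw [← dist_eq_norm] at this
  linarith [dist_triangle (y p.1 (projIcc 0 S hS p.2)) (y l₀ (projIcc 0 S hS p.2))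
    (y l₀ (projIcc 0 S hS t₀)), hp.2]

end Dependence

end Volterra

/-! ### Continuous choice of large parameters -/

section Selection

theorem exists_continuous_of_eventually_forall_ge {Λ : Type*} [TopologicalSpace Λ] [NormalSpace Λ]
    [ParacompactSpace Λ] {Q : Λ → ℝ → Prop}
    (h : ∀ l₀, ∃ c, ∀ᶠ l in 𝓝 l₀, ∀ ω ≥ c, Q l ω) :
    ∃ ω : C(Λ, ℝ), ∀ l, 0 < ω l ∧ ∀ c ≥ ω l, Q l c :=
  exists_continuous_forall_mem_convex_of_local_const
    (t := fun l : Λ => {c : ℝ | 0 < c ∧ ∀ ω ≥ c, Q l ω})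
    (fun l => Set.OrdConnected.convex ⟨fun x hx y _ z hz =>
      ⟨hx.1.trans_le hz.1, fun ω hω => hx.2 ω (hz.1.trans hω)⟩⟩)
    (fun l₀ => by
      obtain ⟨c, hc⟩ := h l₀
      refine ⟨max c 1, hc.mono fun l hl => ⟨lt_max_of_lt_right one_pos, fun ω hω =>
        hl ω ((le_max_left _ _).trans hω)⟩⟩)

lemma eventually_forall_lt {X Y : Type*} [TopologicalSpace X] [TopologicalSpace Y] {K : Set Y}
    (hK : IsCompact K) {φ ψ : X → Y → ℝ} (hφ : Continuous (Function.uncurry φ))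
    (hψ : Continuous (Function.uncurry ψ)) {x₀ : X} (h : ∀ y ∈ K, φ x₀ y < ψ x₀ y) :
    ∀ᶠ x in 𝓝 x₀, ∀ y ∈ K, φ x y < ψ x y :=
  hK.eventually_forall_of_forall_eventually fun y hy =>
    (hφ.tendsto (x₀, y)).eventually_lt (hψ.tendsto (x₀, y)) (h y hy)

lemma exists_eventually_forall_norm_le {X Y E : Type*} [TopologicalSpace X] [TopologicalSpace Y]
    [SeminormedAddCommGroup E] {K : Set Y} (hK : IsCompact K) {φ : X → Y → E}
    (hφ : Continuous (Function.uncurry φ)) (x₀ : X) :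
    ∃ C > 0, ∀ᶠ x in 𝓝 x₀, ∀ y ∈ K, ‖φ x y‖ ≤ C := by
  obtain ⟨C, hC⟩ := hK.exists_bound_of_continuousOn (hφ.uncurry_left x₀).continuousOn
  refine ⟨max C 0 + 1, by positivity, (eventually_forall_lt hK (φ := fun x y => ‖φ x y‖)
    (ψ := fun _ _ => max C 0 + 1) hφ.norm continuous_const fun y hy => ?_).mono
    fun x hx y hy => (hx y hy).le⟩
  exact (hC y hy).trans_lt ((le_max_left _ _).trans_lt (lt_add_one _))

lemma exists_eventually_forall_mem_Icc_inv_lt {X Y : Type*} [TopologicalSpace X]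
    [TopologicalSpace Y] {K : Set Y} (hK : IsCompact K) {φ : X → ℝ → Y → ℝ} {ψ : X → ℝ}
    (hφ : Continuous fun p : X × ℝ × Y => φ p.1 p.2.1 p.2.2) (hψ : Continuous ψ) {x₀ : X}
    (h : ∀ y ∈ K, φ x₀ 0 y < ψ x₀) :
    ∃ c > 0, ∀ᶠ x in 𝓝 x₀, ∀ ω ≥ c, ∀ s ∈ Icc 0 ω⁻¹, ∀ y ∈ K, φ x s y < ψ x := by
  have hnear : ∀ᶠ p : X × ℝ in 𝓝 (x₀, 0), ∀ y ∈ K, φ p.1 p.2 y < ψ p.1 :=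
    eventually_forall_lt (φ := fun (p : X × ℝ) y => φ p.1 p.2 y) (ψ := fun p _ => ψ p.1) hK
      (hφ.comp (f := fun q : (X × ℝ) × Y => (q.1.1, q.1.2, q.2)) (by fun_prop)) (by fun_prop) h
  rw [nhds_prod_eq] at hnear
  obtain ⟨p, hp, q, hq, hpq⟩ := eventually_prod_iff.1 hnear
  obtain ⟨δ, hδ, hδq⟩ := Metric.nhds_basis_closedBall.mem_iff.1 hq
  refine ⟨δ⁻¹, inv_pos.2 hδ, hp.mono fun x hx ω hω s hs => hpq hx (hδq ?_)⟩
  rw [mem_closedBall_zero_iff, Real.norm_of_nonneg hs.1]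
  exact hs.2.trans (inv_le_of_inv_le₀ hδ hω)

theorem exists_continuous_of_eventually_forall_ge_prod {Λ Y : Type*} [TopologicalSpace Λ]
    [NormalSpace Λ] [ParacompactSpace Λ] [TopologicalSpace Y] [NormalSpace (Λ × Y)]
    [ParacompactSpace (Λ × Y)] {K : Set Y} (hK : IsCompact K) {Q : Λ × Y → ℝ → Prop}
    (h : ∀ p₀, ∃ c, ∀ᶠ p in 𝓝 p₀, ∀ ω ≥ c, Q p ω) :
    ∃ ω : C(Λ, ℝ), ∀ l, 0 < ω l ∧ ∀ y ∈ K, ∀ c ≥ ω l, Q (l, y) c := by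
  obtain ⟨c, hc⟩ := exists_continuous_of_eventually_forall_ge h
  obtain ⟨ω, hω⟩ := exists_continuous_of_eventually_forall_ge
    (Q := fun l ω => ∀ y ∈ K, c (l, y) ≤ ω) fun l₀ => by
      obtain ⟨B, hB⟩ := (hK.image (f := fun y => c (l₀, y)) (by fun_prop)).bddAbove
      refine ⟨B + 1, (eventually_forall_lt hK (φ := fun l y => c (l, y)) (ψ := fun _ _ => B + 1)
        c.continuous continuous_const (x₀ := l₀) fun y hy => ?_).mono
        fun l hl ω hω y hy => (hl y hy).le.trans hω⟩
      exact (hB (mem_image_of_mem _ hy)).trans_lt (lt_add_one B)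
  exact ⟨ω, fun l => ⟨(hω l).1, fun y hy d hd => (hc (l, y)).2 d ((hω l).2 d hd y hy)⟩⟩

end Selection

/-! ### Averaging and smoothing -/

section Averaging

variable {E : Type*} [NormedAddCommGroup E]

lemma norm_le_of_periodic {f : ℝ → E} (hf : Function.Periodic f 1) {C : ℝ}
    (hC : ∀ θ ∈ Icc (0 : ℝ) 1, ‖f θ‖ ≤ C) (θ : ℝ) : ‖f θ‖ ≤ C := by
  have hfract : f (Int.fract θ) = f θ := by simpa using hf.sub_int_mul_eq (x := θ) ⌊θ⌋
  rw [← hfract]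
  exact hC _ ⟨Int.fract_nonneg θ, (Int.fract_lt_one θ).le⟩

variable [NormedSpace ℝ E]

lemma norm_integral_le_mul_sub {f : ℝ → E} {a b C : ℝ} (hab : a ≤ b)
    (hC : ∀ x ∈ Ioc a b, ‖f x‖ ≤ C) : ‖∫ x in a..b, f x‖ ≤ C * (b - a) := by
  rw [← abs_of_nonneg (sub_nonneg.2 hab)]
  exact intervalIntegral.norm_integral_le_of_norm_le_const (by rwa [uIoc_of_le hab])

lemma norm_integral_le_of_eq_zero_middle {f : ℝ → E} (hf : Continuous f) {a b δ C : ℝ}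
    (hab : a ≤ b) (hδ : 0 < δ) (hC : ∀ x ∈ Icc a b, ‖f x‖ ≤ C)
    (h0 : ∀ x ∈ Icc (a + δ) (b - δ), f x = 0) : ‖∫ x in a..b, f x‖ ≤ 2 * C * δ := by
  have hC0 : 0 ≤ C := (norm_nonneg _).trans (hC a (left_mem_Icc.2 hab))
  have hsub (u v : ℝ) (hau : a ≤ u) (huv : u ≤ v) (hvb : v ≤ b) :
      ‖∫ x in u..v, f x‖ ≤ C * (v - u) :=
    norm_integral_le_mul_sub huv fun x hx => hC x ⟨hau.trans hx.1.le, hx.2.trans hvb⟩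
  rcases le_or_gt (b - a) (2 * δ) with hshort | hlong
  · refine (hsub a b le_rfl hab le_rfl).trans ?_
    nlinarith
  · have hmid : ∫ x in (a + δ)..(b - δ), f x = 0 := by
      rw [intervalIntegral.integral_congr (g := fun _ => (0 : E)), intervalIntegral.integral_zero]
      rwa [uIcc_of_le (by linarith)]
    rw [← intervalIntegral.integral_add_adjacent_intervals (b := a + δ)
      (hf.intervalIntegrable _ _) (hf.intervalIntegrable _ _),
      ← intervalIntegral.integral_add_adjacent_intervals (a := a + δ) (b := b - δ)
      (hf.intervalIntegrable _ _) (hf.intervalIntegrable _ _), hmid, zero_add]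
    refine (norm_add_le _ _).trans ?_
    have hleft := hsub a (a + δ) le_rfl (by linarith) (by linarith)
    have hright := hsub (b - δ) b (by linarith) (by linarith) le_rfl
    linarith

section Oscillating

variable {G : ℝ → ℝ → E} {S ω ε C : ℝ}

lemma norm_integral_oscillating_cell_le (hG : Continuous (Function.uncurry G)) {a : ℝ}
    (hper : Function.Periodic (G a) 1) (hmean : ∫ θ in (0 : ℝ)..1, G a θ = 0) (hω : 0 < ω)
    (hosc : ∀ s ∈ Icc 0 ω⁻¹, ∀ θ, ‖G (a + s) θ - G a θ‖ ≤ ε) :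
    ‖∫ τ in a..(a + ω⁻¹), G τ (ω * τ)‖ ≤ ε * ω⁻¹ := by
  have hzero : ∫ τ in a..(a + ω⁻¹), G a (ω * τ) = 0 := by
    rw [intervalIntegral.integral_comp_mul_left _ hω.ne', mul_add, mul_inv_cancel₀ hω.ne',
      hper.intervalIntegral_add_eq _ 0, zero_add, hmean, smul_zero]
  have hint : Continuous fun τ => G τ (ω * τ) := hG.comp (by fun_prop : Continuous fun τ =>
    (τ, ω * τ))
  have hint' : Continuous fun τ => G a (ω * τ) := hG.comp (by fun_prop : Continuous fun τ =>
    (a, ω * τ))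
  rw [← sub_zero (∫ τ in a..(a + ω⁻¹), G τ (ω * τ)), ← hzero,
    ← intervalIntegral.integral_sub (hint.intervalIntegrable _ _) (hint'.intervalIntegrable _ _)]
  refine (norm_integral_le_mul_sub (by simpa using hω.le) fun τ hτ => ?_).trans_eq
    (by rw [add_sub_cancel_left])
  have := hosc (τ - a) ⟨by linarith [hτ.1], by linarith [hτ.2]⟩ (ω * τ)
  rwa [add_sub_cancel] at this

lemma norm_integral_oscillating_cells_le (hG : Continuous (Function.uncurry G))
    (hper : ∀ τ, Function.Periodic (G τ) 1) (hmean : ∀ τ, ∫ θ in (0 : ℝ)..1, G τ θ = 0)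
    (hω : 0 < ω) (hosc : ∀ a ∈ Icc 0 S, ∀ s ∈ Icc 0 ω⁻¹, ∀ θ, ‖G (a + s) θ - G a θ‖ ≤ ε) (j : ℕ)
    (hj : j * ω⁻¹ ≤ S) : ‖∫ τ in (0 : ℝ)..(j * ω⁻¹), G τ (ω * τ)‖ ≤ ε * (j * ω⁻¹) := by
  have hG' : Continuous fun τ => G τ (ω * τ) := hG.comp (by fun_prop : Continuous fun τ =>
    (τ, ω * τ))
  induction j with
  | zero => simp
  | succ j ih =>
    rw [Nat.cast_succ, add_one_mul] at hj ⊢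
    have hω' := inv_pos.2 hω
    have hj' : j * ω⁻¹ ∈ Icc 0 S := ⟨by positivity, by linarith⟩
    rw [← intervalIntegral.integral_add_adjacent_intervals (b := j * ω⁻¹)
      (hG'.intervalIntegrable _ _) (hG'.intervalIntegrable _ _), mul_add]
    exact norm_add_le_of_le (ih hj'.2)
      (norm_integral_oscillating_cell_le hG (hper _) (hmean _) hω (hosc _ hj'))

lemma norm_integral_oscillating_le (hG : Continuous (Function.uncurry G))
    (hper : ∀ τ, Function.Periodic (G τ) 1) (hmean : ∀ τ, ∫ θ in (0 : ℝ)..1, G τ θ = 0)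
    (hω : 0 < ω) (hosc : ∀ a ∈ Icc 0 S, ∀ s ∈ Icc 0 ω⁻¹, ∀ θ, ‖G (a + s) θ - G a θ‖ ≤ ε)
    (hC : ∀ τ ∈ Icc 0 S, ∀ θ, ‖G τ θ‖ ≤ C) {t : ℝ} (ht : t ∈ Icc 0 S) :
    ‖∫ τ in (0 : ℝ)..t, G τ (ω * τ)‖ ≤ ε * t + C * ω⁻¹ := by
  have hG' : Continuous fun τ => G τ (ω * τ) := hG.comp (by fun_prop : Continuous fun τ =>
    (τ, ω * τ))
  have hε : 0 ≤ ε := (norm_nonneg _).trans (hosc t ht 0 ⟨le_rfl, (inv_pos.2 hω).le⟩ 0)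
  have hC0 : 0 ≤ C := (norm_nonneg _).trans (hC t ht 0)
  set j := ⌊ω * t⌋₊
  have hjt : j * ω⁻¹ ≤ t := by
    rw [← div_eq_mul_inv, div_le_iff₀' hω]
    exact Nat.floor_le (mul_nonneg hω.le ht.1)
  have htj : t - j * ω⁻¹ ≤ ω⁻¹ := by
    rw [sub_le_iff_le_add', ← add_one_mul, ← div_eq_mul_inv, le_div_iff₀' hω]
    exact (Nat.lt_floor_add_one _).le
  rw [← intervalIntegral.integral_add_adjacent_intervals (b := j * ω⁻¹)
    (hG'.intervalIntegrable _ _) (hG'.intervalIntegrable _ _)]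
  refine norm_add_le_of_le
    ((norm_integral_oscillating_cells_le hG hper hmean hω hosc j (hjt.trans ht.2)).trans
      (by gcongr))
    ((norm_integral_le_mul_sub hjt fun τ hτ => hC τ ⟨?_, hτ.2.trans ht.2⟩ _).trans (by gcongr))
  exact le_trans (by positivity) hτ.1.le

end Oscillating

theorem eventually_norm_integral_oscillating_le {Λ : Type*} [TopologicalSpace Λ]
    {G : Λ → ℝ → ℝ → E} (hG : Continuous fun p : Λ × ℝ × ℝ => G p.1 p.2.1 p.2.2)
    (hper : ∀ l τ, Function.Periodic (G l τ) 1)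
    (hmean : ∀ l τ, ∫ θ in (0 : ℝ)..1, G l τ θ = 0)
    {S : ℝ} (hS : 0 ≤ S) {η : ℝ} (hη : 0 < η) (l₀ : Λ) :
    ∃ c, ∀ᶠ l in 𝓝 l₀, ∀ ω ≥ c, ∀ t ∈ Icc 0 S, ‖∫ τ in (0 : ℝ)..t, G l τ (ω * τ)‖ ≤ η := by
  have hGl (l : Λ) : Continuous (Function.uncurry (G l)) := hG.comp (by fun_prop :
    Continuous fun p : ℝ × ℝ => (l, p.1, p.2))
  have hK : IsCompact (Icc 0 S ×ˢ Icc (0 : ℝ) 1) := isCompact_Icc.prod isCompact_Icc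
  obtain ⟨C, hC⟩ := hK.exists_bound_of_continuousOn (hGl l₀).continuousOn
  have hbound : ∀ᶠ l in 𝓝 l₀, ∀ y ∈ Icc 0 S ×ˢ Icc (0 : ℝ) 1, ‖G l y.1 y.2‖ < C + 1 :=
    eventually_forall_lt hK (φ := fun l y => ‖G l y.1 y.2‖) (ψ := fun _ _ => C + 1) hG.norm
      continuous_const fun y hy => (hC y hy).trans_lt (lt_add_one C)
  obtain ⟨c, hc, hosc⟩ := exists_eventually_forall_mem_Icc_inv_lt hK
    (φ := fun l s y => ‖G l (y.1 + s) y.2 - G l y.1 y.2‖) (ψ := fun _ => η / (2 * (S + 1)))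
    ((hG.comp (f := fun p : Λ × ℝ × ℝ × ℝ => (p.1, p.2.2.1 + p.2.1, p.2.2.2)) (by fun_prop)).sub
      (hG.comp (f := fun p : Λ × ℝ × ℝ × ℝ => (p.1, p.2.2)) (by fun_prop))).norm
    continuous_const (x₀ := l₀) fun y _ => by simpa using (by positivity : 0 < η / (2 * (S + 1)))
  refine ⟨max c (2 * (C + 1) / η), ?_⟩
  filter_upwards [hbound, hosc] with l hl hosc ω hω t ht
  obtain ⟨hωc, hωC⟩ := max_le_iff.1 hω
  have hω0 : 0 < ω := hc.trans_le hωc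
  refine (norm_integral_oscillating_le (hGl l) (hper l) (hmean l) hω0
    (fun a ha s hs => norm_le_of_periodic ((hper l _).sub (hper l _)) fun θ hθ =>
      (hosc ω hωc s hs (a, θ) ⟨ha, hθ⟩).le)
    (fun τ hτ => norm_le_of_periodic (hper l τ) fun θ hθ => (hl (τ, θ) ⟨hτ, hθ⟩).le) ht).trans ?_
  have hfirst : η / (2 * (S + 1)) * t ≤ η / 2 := by
    rw [div_mul_eq_mul_div, div_le_div_iff₀ (by positivity) two_pos]
    nlinarith [ht.2]
  have hsecond : (C + 1) * ω⁻¹ ≤ η / 2 := by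
    rw [div_le_iff₀ hη] at hωC
    rw [← div_eq_mul_inv, div_le_iff₀ hω0]
    linarith
  linarith

section Smoothing

variable {v : ℝ → E} {S h ε : ℝ}

lemma integral_forward_difference (hv : Continuous v) (h t : ℝ) :
    ∫ τ in (0 : ℝ)..t, h⁻¹ • (v (τ + h) - v τ)
      = h⁻¹ • (∫ τ in t..(t + h), v τ) - h⁻¹ • ∫ τ in (0 : ℝ)..(0 + h), v τ := by
  have hshift : Continuous fun τ => v (τ + h) := by fun_prop
  rw [intervalIntegral.integral_smul, intervalIntegral.integral_sub
    (hshift.intervalIntegrable _ _) (hv.intervalIntegrable _ _),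
    intervalIntegral.integral_comp_add_right v,
    intervalIntegral.integral_interval_sub_interval_comm' (hv.intervalIntegrable _ _)
      (hv.intervalIntegrable _ _) (hv.intervalIntegrable _ _), smul_sub]

variable [CompleteSpace E]

lemma norm_average_sub_le (hv : Continuous v) {t : ℝ} (hh : 0 < h)
    (hosc : ∀ s ∈ Icc 0 h, ‖v (t + s) - v t‖ ≤ ε) :
    ‖h⁻¹ • (∫ τ in t..(t + h), v τ) - v t‖ ≤ ε := by
  have hsub : h⁻¹ • (∫ τ in t..(t + h), v τ) - v t = h⁻¹ • ∫ τ in t..(t + h), (v τ - v t) := by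
    rw [intervalIntegral.integral_sub (hv.intervalIntegrable _ _) intervalIntegrable_const,
      intervalIntegral.integral_const, smul_sub, add_sub_cancel_left, inv_smul_smul₀ hh.ne']
  rw [hsub, norm_smul, norm_inv, Real.norm_of_nonneg hh.le, inv_mul_le_iff₀ hh, mul_comm h]
  refine (norm_integral_le_mul_sub (by linarith) fun τ hτ => ?_).trans_eq
    (by rw [add_sub_cancel_left])
  simpa using hosc (τ - t) ⟨by linarith [hτ.1], by linarith [hτ.2]⟩

lemma norm_add_integral_forward_difference_sub_le (hv : Continuous v) (hh : 0 < h)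
    (hosc : ∀ t ∈ Icc 0 S, ∀ s ∈ Icc 0 h, ‖v (t + s) - v t‖ ≤ ε) {t : ℝ} (ht : t ∈ Icc 0 S) :
    ‖v 0 + (∫ τ in (0 : ℝ)..t, h⁻¹ • (v (τ + h) - v τ)) - v t‖ ≤ ε + ε := by
  have h0 : (0 : ℝ) ∈ Icc 0 S := left_mem_Icc.2 (ht.1.trans ht.2)
  have hsplit (a b : E) : v 0 + (a - b) - v t = (a - v t) - (b - v 0) := by abel
  rw [integral_forward_difference hv, hsplit]
  exact norm_sub_le_of_le (norm_average_sub_le hv hh (hosc t ht))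
    (norm_average_sub_le hv hh (hosc 0 h0))

/-- The integrand `q`, changed by a constant so that its primitive with initial value `x` takes
the value `y` at `S`. -/
noncomputable def correctEndpoint (S : ℝ) (x y : E) (q : ℝ → E) (t : ℝ) : E :=
  q t + S⁻¹ • (y - x - ∫ τ in (0 : ℝ)..S, q τ)

lemma integral_correctEndpoint {q : ℝ → E} (hq : Continuous q) (S : ℝ) (x y : E) (t : ℝ) :
    ∫ τ in (0 : ℝ)..t, correctEndpoint S x y q τ
      = (∫ τ in (0 : ℝ)..t, q τ) + (t / S) • (y - x - ∫ τ in (0 : ℝ)..S, q τ) := by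
  simp only [correctEndpoint]
  rw [intervalIntegral.integral_add (hq.intervalIntegrable _ _) intervalIntegrable_const,
    intervalIntegral.integral_const, smul_smul, sub_zero, div_eq_mul_inv]

lemma add_integral_correctEndpoint {q : ℝ → E} (hq : Continuous q) (hS : S ≠ 0) (x y : E) :
    x + ∫ τ in (0 : ℝ)..S, correctEndpoint S x y q τ = y := by
  rw [integral_correctEndpoint hq, div_self hS, one_smul]
  abel

lemma norm_add_integral_correctEndpoint_sub_le {q : ℝ → E} (hq : Continuous q) (hS : 0 < S)
    (hε : ∀ t ∈ Icc 0 S, ‖v 0 + (∫ τ in (0 : ℝ)..t, q τ) - v t‖ ≤ ε) {t : ℝ} (ht : t ∈ Icc 0 S) :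
    ‖v 0 + (∫ τ in (0 : ℝ)..t, correctEndpoint S (v 0) (v S) q τ) - v t‖ ≤ ε + ε := by
  rw [integral_correctEndpoint hq, ← add_assoc, add_sub_right_comm]
  refine norm_add_le_of_le (hε t ht) ?_
  rw [norm_smul, Real.norm_of_nonneg (div_nonneg ht.1 hS.le), sub_sub, norm_sub_rev]
  exact (mul_le_of_le_one_left (norm_nonneg _) ((div_le_one hS).2 ht.2)).trans
    (hε S (right_mem_Icc.2 hS.le))

theorem exists_smoothing {Λ : Type*} [TopologicalSpace Λ] [NormalSpace Λ] [ParacompactSpace Λ]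
    {v : Λ → ℝ → E} (hv : Continuous (Function.uncurry v)) {S : ℝ} (hS : 0 < S)
    {η : Λ → ℝ} (hη : Continuous η) (hη0 : ∀ l, 0 < η l) :
    ∃ q : Λ → ℝ → E, Continuous (Function.uncurry q) ∧
      (∀ l, v l 0 + ∫ τ in (0 : ℝ)..S, q l τ = v l S) ∧
      ∀ l, ∀ t ∈ Icc 0 S, ‖v l 0 + (∫ τ in (0 : ℝ)..t, q l τ) - v l t‖ ≤ η l := by
  have hvl : ∀ l, Continuous (v l) := fun l => hv.uncurry_left l
  obtain ⟨ω, hω⟩ := exists_continuous_of_eventually_forall_ge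
    (Q := fun l ω => ∀ s ∈ Icc 0 ω⁻¹, ∀ t ∈ Icc 0 S, ‖v l (t + s) - v l t‖ < η l / 4) fun l₀ => by
      obtain ⟨c, -, hc⟩ := exists_eventually_forall_mem_Icc_inv_lt isCompact_Icc
        (φ := fun l s t => ‖v l (t + s) - v l t‖) (ψ := fun l => η l / 4)
        ((hv.comp (f := fun q : Λ × ℝ × ℝ => (q.1, q.2.2 + q.2.1)) (by fun_prop)).sub
          (hv.comp (f := fun q : Λ × ℝ × ℝ => (q.1, q.2.2)) (by fun_prop))).norm
        (by fun_prop) (x₀ := l₀) fun t _ => by simpa using hη0 l₀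
      exact ⟨c, hc⟩
  have hωinv (l : Λ) : 0 < (ω l)⁻¹ := inv_pos.2 (hω l).1
  let q₀ : Λ → ℝ → E := fun l t => (ω l)⁻¹⁻¹ • (v l (t + (ω l)⁻¹) - v l t)
  have hωc : Continuous fun l => (ω l)⁻¹ := ω.continuous.inv₀ fun l => (hω l).1.ne'
  have hq₀ : Continuous (Function.uncurry q₀) :=
    ((hωc.inv₀ fun l => (hωinv l).ne').comp continuous_fst).smul
      ((hv.comp (continuous_fst.prodMk (continuous_snd.add (hωc.comp continuous_fst)))).sub hv)
  have hq₀l (l : Λ) : Continuous (q₀ l) := hq₀.uncurry_left l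
  refine ⟨fun l => correctEndpoint S (v l 0) (v l S) (q₀ l), ?_,
    fun l => add_integral_correctEndpoint (hq₀l l) hS.ne' _ _, fun l t ht => ?_⟩
  · exact hq₀.add (continuous_const.smul ((((hv.comp (by fun_prop : Continuous fun p : Λ × ℝ =>
      (p.1, S))).sub (hv.comp (by fun_prop : Continuous fun p : Λ × ℝ => (p.1, (0 : ℝ)))))).sub
      ((intervalIntegral.continuous_parametric_intervalIntegral_of_continuous' hq₀ _ _).comp
        continuous_fst)))
  · refine (norm_add_integral_correctEndpoint_sub_le (hq₀l l) hS (fun t ht =>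
      norm_add_integral_forward_difference_sub_le (hvl l) (hωinv l)
        (fun t ht s hs => ((hω l).2 _ le_rfl s hs t ht).le) ht) ht).trans_eq (by ring)

end Smoothing

end Averaging

/-! ### Time sharing -/

section Weights

variable {P V Y ι : Type*} [NormedAddCommGroup Y] [NormedSpace ℝ Y] [Fintype ι]

/-- The map that sends weights `a` to the weighted sum `∑ j, a j • x j` together with the total
weight. -/
noncomputable def weightedSum (x : ι → Y) : (ι → ℝ) →L[ℝ] Y × ℝ :=
  ∑ j, (ContinuousLinearMap.proj (R := ℝ) (φ := fun _ : ι => ℝ) j).smulRight (x j, (1 : ℝ))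

lemma weightedSum_apply (x : ι → Y) (a : ι → ℝ) :
    weightedSum x a = (∑ j, a j • x j, ∑ j, a j) := by
  simp [weightedSum, Prod.ext_iff, Prod.fst_sum, Prod.snd_sum]

lemma continuous_weightedSum : Continuous (weightedSum : (ι → Y) → (ι → ℝ) →L[ℝ] Y × ℝ) :=
  continuous_finsetSum _ fun j _ => (ContinuousLinearMap.smulRightL ℝ (ι → ℝ) (Y × ℝ)
    (ContinuousLinearMap.proj (R := ℝ) (φ := fun _ : ι => ℝ) j)).continuous.comp (by fun_prop)

lemma isInvertible_weightedSum [FiniteDimensional ℝ Y] (b : AffineBasis ι ℝ Y) :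
    (weightedSum b).IsInvertible := by
  have hinj : Function.Injective (weightedSum b : (ι → ℝ) →ₗ[ℝ] Y × ℝ) := by
    refine (injective_iff_map_eq_zero _).2 fun a ha => ?_
    rw [ContinuousLinearMap.coe_coe, weightedSum_apply, Prod.mk_eq_zero] at ha
    exact funext fun j =>
      affineIndependent_iff.1 b.ind Finset.univ a ha.2 ha.1 j (Finset.mem_univ j)
  have hdim : Module.finrank ℝ (ι → ℝ) = Module.finrank ℝ (Y × ℝ) := by
    rw [Module.finrank_fintype_fun_eq_card, Module.finrank_prod, Module.finrank_self,
      b.card_eq_finrank_add_one]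
  exact ⟨(LinearMap.linearEquivOfInjective _ hinj hdim).toContinuousLinearEquiv,
    ContinuousLinearMap.ext fun _ => rfl⟩

lemma weightedSum_coords (b : AffineBasis ι ℝ Y) (y : Y) :
    weightedSum b (fun j => b.coord j y) = (y, 1) := by
  rw [weightedSum_apply, b.linear_combination_coord_eq_self, b.sum_coord_apply_eq_one]

variable [TopologicalSpace P]

/-- Barycentric coordinates depend continuously on the simplex. -/
lemma exists_weights_near_affineBasis [FiniteDimensional ℝ Y] {x : P → ι → Y} (hx : Continuous x)
    {q : P → Y} (hq : Continuous q) {p₀ : P} (b : AffineBasis ι ℝ Y) (hb : x p₀ = b)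
    (hpos : ∀ j, 0 < b.coord j (q p₀)) :
    ∃ a : P → ι → ℝ, ∀ᶠ p in 𝓝 p₀, ContinuousAt a p ∧ (∀ j, 0 ≤ a p j) ∧
      ∑ j, a p j = 1 ∧ ∑ j, a p j • x p j = q p := by
  have hT : Continuous fun p => weightedSum (x p) := continuous_weightedSum.comp hx
  have hT₀ : (weightedSum (x p₀)).IsInvertible := hb ▸ isInvertible_weightedSum b
  let a p : ι → ℝ := (weightedSum (x p)).inverse (q p, 1)
  have ha p (hp : (weightedSum (x p)).IsInvertible) : ContinuousAt a p :=
    ((hp.contDiffAt_map_inverse (n := 0)).continuousAt.comp (f := fun p => weightedSum (x p))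
      hT.continuousAt).clm_apply (hq.prodMk continuous_const).continuousAt
  have ha₀ : a p₀ = fun j => b.coord j (q p₀) := by
    rw [hT₀.inverse_apply_eq, hb, weightedSum_coords]
  have hinv : ∀ᶠ p in 𝓝 p₀, (weightedSum (x p)).IsInvertible :=
    hT.continuousAt.eventually (ContinuousLinearEquiv.isOpen.mem_nhds hT₀)
  have hnonneg : ∀ᶠ p in 𝓝 p₀, ∀ j, 0 < a p j := eventually_all.2 fun j =>
    ((continuous_apply j).continuousAt.comp (ha p₀ hT₀)).eventually
      (lt_mem_nhds (by simpa only [ha₀, Function.comp_apply] using hpos j))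
  refine ⟨a, (hinv.and hnonneg).mono fun p hp => ?_⟩
  have hsum := (weightedSum_apply (x p) (a p)).symm.trans (hp.1.self_apply_inverse _)
  exact ⟨ha p hp.1, fun j => (hp.2 j).le, (Prod.mk.inj hsum).2, (Prod.mk.inj hsum).1⟩

lemma exists_affineBasis_coord_pos [FiniteDimensional ℝ Y] (y : Y) :
    ∃ b : AffineBasis (Fin (Module.finrank ℝ Y + 1)) ℝ Y, ∀ j, 0 < b.coord j y := by
  obtain ⟨b⟩ := AffineBasis.exists_affineBasis_of_finiteDimensional
    (ι := Fin (Module.finrank ℝ Y + 1)) (k := ℝ) (P := Y) (Fintype.card_fin _)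
  refine ⟨(y - Finset.univ.centroid ℝ b) +ᵥ b, fun j => ?_⟩
  have hj : ((y - Finset.univ.centroid ℝ b) +ᵥ b).coord j y
      = b.coord j (Finset.univ.centroid ℝ b) := by simp [AffineEquiv.constVAdd_symm]
  rw [hj, b.coord_apply_centroid (Finset.mem_univ j)]
  positivity

lemma exists_local_weights [TopologicalSpace V] [FiniteDimensional ℝ Y] {g : P → V → Y}
    (hg : Continuous (Function.uncurry g)) {q : P → Y} (hq : Continuous q) (p₀ : P)
    (hsurj : Function.Surjective (g p₀)) :
    ∃ (v : Fin (Module.finrank ℝ Y + 1) → V) (a : P → Fin (Module.finrank ℝ Y + 1) → ℝ),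
      ∀ᶠ p in 𝓝 p₀, ContinuousAt a p ∧ (∀ j, 0 ≤ a p j) ∧ ∑ j, a p j = 1 ∧
        ∑ j, a p j • g p (v j) = q p := by
  obtain ⟨b, hb⟩ := exists_affineBasis_coord_pos (q p₀)
  choose v hv using fun j => hsurj (b j)
  exact ⟨v, exists_weights_near_affineBasis (x := fun p j => g p (v j))
    (continuous_pi fun j => hg.uncurry_right (v j)) hq b (funext hv) hb⟩

lemma finsum_partitionOfUnity_mul_smul {κ M : Type*} [AddCommGroup M] [Module ℝ M]
    (φ : PartitionOfUnity κ P) {p : P} {a : κ → ι → ℝ} {f : κ × ι → M} {m : M}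
    (h : ∀ n, φ n p ≠ 0 → ∑ j, a n j • f (n, j) = m) :
    ∑ᶠ i : κ × ι, (φ i.1 p * a i.1 i.2) • f i = m := by
  have hsupp : (Function.support fun i : κ × ι => (φ i.1 p * a i.1 i.2) • f i)
      ⊆ (φ.finsupport p ×ˢ Finset.univ : Finset (κ × ι)) := by
    intro i hi
    have hφ : φ i.1 p ≠ 0 := fun h0 => hi (by simp only [h0, zero_mul, zero_smul])
    simpa using hφ
  rw [finsum_eq_sum_of_support_subset _ hsupp, Finset.sum_product]
  simp only [mul_smul, ← Finset.smul_sum]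
  calc ∑ n ∈ φ.finsupport p, φ n p • ∑ j, a n j • f (n, j)
      = ∑ n ∈ φ.finsupport p, φ n p • m := Finset.sum_congr rfl fun n hn => by
        rw [h n ((φ.mem_finsupport p).1 hn)]
    _ = m := by rw [← Finset.sum_smul, φ.sum_finsupport (mem_univ p), one_smul]

lemma exists_partitionOfUnity_mul {κ κ' : Type*} (φ : PartitionOfUnity κ P) (e : κ' ≃ κ × ι)
    {a : κ → P → ι → ℝ} (ha : ∀ n, ∀ p ∈ tsupport (φ n),
      ContinuousAt (a n) p ∧ (∀ j, 0 ≤ a n p j) ∧ ∑ j, a n p j = 1) :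
    ∃ α : PartitionOfUnity κ' P, ∀ k p, α k p = φ (e k).1 p * a (e k).1 p (e k).2 := by
  have hsum p : ∑ᶠ k, φ (e k).1 p * a (e k).1 p (e k).2 = 1 := by
    rw [finsum_comp_equiv e (f := fun i => φ i.1 p * a i.1 p i.2)]
    simpa using finsum_partitionOfUnity_mul_smul φ (a := fun n => a n p) (f := fun _ => (1 : ℝ))
      (m := 1) fun n hn => by simpa using (ha n p (subset_tsupport _ hn)).2.2
  refine ⟨{
    toFun k := ⟨fun p => φ (e k).1 p * a (e k).1 p (e k).2,
      φ.continuous_smul (g := fun p => a (e k).1 p (e k).2) fun p hp =>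
        (continuous_apply (e k).2).continuousAt.comp (ha (e k).1 p hp).1⟩
    locallyFinite' p := ?_
    nonneg' k p := ?_
    sum_eq_one' p _ := hsum p
    sum_le_one' p := (hsum p).le }, fun _ _ => rfl⟩
  · obtain ⟨U, hU, hfin⟩ := φ.locallyFinite p
    refine ⟨U, hU, ((hfin.prod finite_univ).preimage e.injective.injOn).subset fun k hk => ?_⟩
    exact ⟨hk.imp fun x hx => ⟨left_ne_zero_of_mul hx.1, hx.2⟩, mem_univ _⟩
  · change 0 ≤ φ (e k).1 p * a (e k).1 p (e k).2
    by_cases h : φ (e k).1 p = 0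
    · rw [h, zero_mul]
    · exact mul_nonneg (φ.nonneg _ _) ((ha _ p (subset_tsupport _ h)).2.1 _)

lemma exists_partitionOfUnity_isSubordinate_range [SecondCountableTopology P] [NormalSpace P]
    [ParacompactSpace P] [Nonempty P] {U : P → Set P} (hU : ∀ p, U p ∈ 𝓝 p) :
    ∃ (x : ℕ → P) (φ : PartitionOfUnity ℕ P), ∀ n, tsupport (φ n) ⊆ U (x n) := by
  obtain ⟨s, hs, hcov⟩ := TopologicalSpace.countable_cover_nhds fun p =>
    interior_mem_nhds.2 (hU p)
  have hsne : s.Nonempty := (nonempty_biUnion.1 (hcov ▸ univ_nonempty)).imp fun _ hp => hp.1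
  obtain ⟨x, rfl⟩ := hs.exists_eq_range hsne
  rw [biUnion_range] at hcov
  obtain ⟨φ, hφ⟩ := PartitionOfUnity.exists_isSubordinate isClosed_univ _
    (fun _ => isOpen_interior) hcov.ge
  exact ⟨x, φ, fun n => (hφ n).trans interior_subset⟩

theorem exists_partitionOfUnity_finsum_smul_eq [TopologicalSpace V] [FiniteDimensional ℝ Y]
    [SecondCountableTopology P] [NormalSpace P] [ParacompactSpace P] [Nonempty P] {g : P → V → Y}
    (hg : Continuous (Function.uncurry g)) {q : P → Y} (hq : Continuous q)
    (hsurj : ∀ p, Function.Surjective (g p)) :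
    ∃ (v : ℕ → V) (α : PartitionOfUnity ℕ P), ∀ p, ∑ᶠ k, α k p • g p (v k) = q p := by
  choose v a hva using fun p => exists_local_weights hg hq p (hsurj p)
  obtain ⟨x, φ, hφ⟩ := exists_partitionOfUnity_isSubordinate_range hva
  obtain ⟨e⟩ : Nonempty (ℕ ≃ ℕ × Fin (Module.finrank ℝ Y + 1)) := nonempty_equiv_of_countable
  obtain ⟨α, hα⟩ := exists_partitionOfUnity_mul φ e (a := fun n => a (x n)) fun n p hp =>
    (hφ n hp).imp_right fun h => ⟨h.1, h.2.1⟩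
  refine ⟨fun k => v (x (e k).1) (e k).2, α, fun p => ?_⟩
  simp only [hα]
  rw [finsum_comp_equiv e
    (f := fun i => (φ i.1 p * a (x i.1) p i.2) • g p (v (x i.1) i.2))]
  exact finsum_partitionOfUnity_mul_smul φ (a := fun n => a (x n) p)
    (f := fun i => g p (v (x i.1) i.2)) fun n hn => (hφ n (subset_tsupport _ hn)).2.2.2

end Weights

section Plateau

/-- A piecewise linear cutoff of slope `±M`: it vanishes outside `[a, b]` and equals one on
`[a + M⁻¹, b - M⁻¹]`. Taking `|M|` makes it vanish at `a` and `b` for every real `M`. -/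
def plateau (M a b θ : ℝ) : ℝ := max 0 (min 1 (|M| * min (θ - a) (b - θ)))

variable {M a b θ : ℝ}

@[fun_prop]
lemma continuous_plateau {X : Type*} [TopologicalSpace X] {M a b θ : X → ℝ} (hM : Continuous M)
    (ha : Continuous a) (hb : Continuous b) (hθ : Continuous θ) :
    Continuous fun x => plateau (M x) (a x) (b x) (θ x) := by
  unfold plateau
  fun_prop

lemma plateau_nonneg : 0 ≤ plateau M a b θ := le_max_left _ _

lemma plateau_le_one : plateau M a b θ ≤ 1 := max_le zero_le_one (min_le_left _ _)

lemma plateau_eq_zero (h : θ ≤ a ∨ b ≤ θ) : plateau M a b θ = 0 := by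
  refine max_eq_left ((min_le_right _ _).trans (mul_nonpos_of_nonneg_of_nonpos (abs_nonneg M) ?_))
  exact min_le_iff.2 (h.imp sub_nonpos.2 sub_nonpos.2)

lemma plateau_eq_one (hM : 0 < M) (hθ : θ ∈ Icc (a + M⁻¹) (b - M⁻¹)) : plateau M a b θ = 1 := by
  have hmin : M⁻¹ ≤ min (θ - a) (b - θ) := le_min (by linarith [hθ.1]) (by linarith [hθ.2])
  rw [inv_le_iff_one_le_mul₀' hM] at hmin
  rw [plateau, abs_of_pos hM, min_eq_left hmin, max_eq_right zero_le_one]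

lemma norm_plateau_smul_le {E : Type*} [SeminormedAddCommGroup E] [NormedSpace ℝ E] (x : E) :
    ‖plateau M a b θ • x‖ ≤ ‖x‖ := by
  rw [norm_smul, Real.norm_of_nonneg plateau_nonneg]
  exact mul_le_of_le_one_left (norm_nonneg _) plateau_le_one

end Plateau

section TimeSharing

variable {P V Y : Type*} [TopologicalSpace P] [NormedAddCommGroup V] [NormedSpace ℝ V]
  [NormedAddCommGroup Y] [NormedSpace ℝ Y] (α : PartitionOfUnity ℕ P) (v : ℕ → V)

/-- The sum of the first `k` weights, at which the curve `visit` leaves `v (k - 1)` for `v k`. -/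
noncomputable def partialSum (k : ℕ) (p : P) : ℝ := ∑ j ∈ Finset.range k, α j p

/-- The curve that visits the points `v k` during consecutive intervals whose lengths are the
weights, passing through the origin in between. -/
noncomputable def visit (M : ℝ) (p : P) (θ : ℝ) : V :=
  ∑ᶠ k, plateau M (partialSum α k p) (partialSum α (k + 1) p) θ • v k

lemma partialSum_zero (p : P) : partialSum α 0 p = 0 := Finset.sum_range_zero _

lemma partialSum_succ (k : ℕ) (p : P) : partialSum α (k + 1) p = partialSum α k p + α k p :=
  Finset.sum_range_succ _ _

lemma partialSum_mono (p : P) : Monotone fun k => partialSum α k p :=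
  monotone_nat_of_le_succ fun k => by
    rw [partialSum_succ]
    exact le_add_of_nonneg_right (α.nonneg k p)

@[fun_prop]
lemma continuous_partialSum (k : ℕ) : Continuous (partialSum α k) := by
  unfold partialSum
  fun_prop

lemma exists_eventually_forall_ge_eq_zero (p₀ : P) :
    ∃ N : ℕ, ∀ᶠ p in 𝓝 p₀, ∀ k ≥ N, α k p = 0 := by
  obtain ⟨I, hI⟩ := α.exists_finset_nhds p₀
  obtain ⟨N, hN⟩ := I.bddAbove
  refine ⟨N + 1, hI.mono fun p hp k hk => ?_⟩
  by_contra hne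
  exact (hN (hp.2 hne)).not_gt hk

variable {α} {M θ : ℝ} {p : P} {k N : ℕ}

lemma sum_range_smul_eq_finsum {E : Type*} [AddCommGroup E] [Module ℝ E]
    (hN : ∀ k ≥ N, α k p = 0) (x : ℕ → E) :
    ∑ k ∈ Finset.range N, α k p • x k = ∑ᶠ k, α k p • x k := by
  refine (finsum_eq_sum_of_support_subset _ fun k hk => ?_).symm
  rw [Finset.coe_range, mem_Iio]
  by_contra! h
  exact hk (by simp only [hN k h, zero_smul])

lemma partialSum_eq_one (hN : ∀ k ≥ N, α k p = 0) : partialSum α N p = 1 := by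
  simpa [partialSum, α.sum_eq_one (mem_univ p)] using sum_range_smul_eq_finsum hN fun _ => (1 : ℝ)

lemma partialSum_le_one : partialSum α k p ≤ 1 := by
  obtain ⟨N, hN⟩ := exists_eventually_forall_ge_eq_zero α p
  rw [← partialSum_eq_one fun j (hj : j ≥ max N k) =>
    hN.self_of_nhds j ((le_max_left _ _).trans hj)]
  exact partialSum_mono α p (le_max_right _ _)

lemma plateau_partialSum_eq_zero (h : α k p = 0) :
    plateau M (partialSum α k p) (partialSum α (k + 1) p) θ = 0 :=
  plateau_eq_zero (by simpa only [partialSum_succ, h, add_zero] using le_total θ _)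

lemma continuous_visit : Continuous fun x : ℝ × P × ℝ => visit α v x.1 x.2.1 x.2.2 := by
  refine continuous_finsum (fun k => by fun_prop) ((α.locallyFinite.preimage_continuous
    (g := fun x : ℝ × P × ℝ => x.2.1) (by fun_prop)).subset fun k x hx => ?_)
  by_contra h
  exact hx (by simp only [plateau_partialSum_eq_zero (Function.notMem_support.1 h), zero_smul])

lemma norm_visit_le (hN : ∀ k ≥ N, α k p = 0) :
    ‖visit α v M p θ‖ ≤ ∑ k ∈ Finset.range N, ‖v k‖ := by
  have hsum : visit α v M p θ = ∑ k ∈ Finset.range N,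
      plateau M (partialSum α k p) (partialSum α (k + 1) p) θ • v k := by
    refine finsum_eq_sum_of_support_subset _ fun k hk => ?_
    rw [Finset.coe_range, mem_Iio]
    by_contra! h
    exact hk (by simp only [plateau_partialSum_eq_zero (hN k h), zero_smul])
  rw [hsum]
  exact norm_sum_le_of_le _ fun k _ => norm_plateau_smul_le _

lemma visit_eq_smul (hθ : θ ∈ Icc (partialSum α k p) (partialSum α (k + 1) p)) :
    visit α v M p θ = plateau M (partialSum α k p) (partialSum α (k + 1) p) θ • v k := by
  refine finsum_eq_single _ _ fun j hj => ?_
  have hj' : θ ≤ partialSum α j p ∨ partialSum α (j + 1) p ≤ θ :=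
    (lt_or_gt_of_ne hj).symm.imp (fun h => hθ.2.trans (partialSum_mono α p h))
      fun h => (partialSum_mono α p h).trans hθ.1
  rw [plateau_eq_zero hj', zero_smul]

lemma visit_zero : visit α v M p 0 = 0 := finsum_eq_zero_of_forall_eq_zero fun k => by
  have hk : 0 ≤ partialSum α k p :=
    (partialSum_zero α p).symm.trans_le (partialSum_mono α p (Nat.zero_le k))
  rw [plateau_eq_zero (Or.inl hk), zero_smul]

lemma visit_one : visit α v M p 1 = 0 := finsum_eq_zero_of_forall_eq_zero fun k => by
  rw [plateau_eq_zero (Or.inr partialSum_le_one), zero_smul]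

variable {v} {g : V → Y} {C : ℝ}

lemma norm_integral_visit_cell_sub_le [CompleteSpace Y] (hg : Continuous g) (hM : 0 < M)
    (hC : ∀ w : V, ‖w‖ ≤ ‖v k‖ → ‖g w‖ ≤ C) :
    ‖(∫ θ in partialSum α k p..partialSum α (k + 1) p, g (visit α v M p θ)) - α k p • g (v k)‖
      ≤ 4 * C * M⁻¹ := by
  have hgv : Continuous fun θ => g (visit α v M p θ) :=
    hg.comp ((continuous_visit v).comp (f := fun θ : ℝ => (M, p, θ)) (by fun_prop))
  have hle : partialSum α k p ≤ partialSum α (k + 1) p := partialSum_mono α p k.le_succ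
  have hlen : partialSum α (k + 1) p - partialSum α k p = α k p := by
    rw [partialSum_succ, add_sub_cancel_left]
  rw [← hlen, ← intervalIntegral.integral_const, ← intervalIntegral.integral_sub
    (hgv.intervalIntegrable _ _) intervalIntegrable_const]
  refine (norm_integral_le_of_eq_zero_middle
    (f := fun θ => g (visit α v M p θ) - g (v k)) (hgv.sub continuous_const) hle
    (inv_pos.2 hM) (C := C + C) (fun θ hθ => norm_sub_le_of_le ?_ (hC _ le_rfl))
    fun θ hθ => ?_).trans_eq (by ring)
  · rw [visit_eq_smul v hθ]
    exact hC _ (norm_plateau_smul_le _)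
  · have hM' := inv_pos.2 hM
    rw [visit_eq_smul v (k := k) ⟨by linarith [hθ.1], by linarith [hθ.2]⟩, plateau_eq_one hM hθ,
      one_smul, sub_self]

lemma norm_integral_visit_sub_le [CompleteSpace Y] (hg : Continuous g)
    (hN : ∀ k ≥ N, α k p = 0) (hM : 0 < M)
    (hC : ∀ w : V, ‖w‖ ≤ ∑ k ∈ Finset.range N, ‖v k‖ → ‖g w‖ ≤ C) :
    ‖(∫ θ in (0 : ℝ)..1, g (visit α v M p θ)) - ∑ᶠ k, α k p • g (v k)‖ ≤ N * (4 * C * M⁻¹) := by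
  have hgv : Continuous fun θ => g (visit α v M p θ) :=
    hg.comp ((continuous_visit v).comp (f := fun θ : ℝ => (M, p, θ)) (by fun_prop))
  rw [← partialSum_eq_one hN, ← partialSum_zero α p, ← sum_range_smul_eq_finsum hN,
    ← intervalIntegral.sum_integral_adjacent_intervals (a := fun k => partialSum α k p)
      fun k _ => hgv.intervalIntegrable _ _, ← Finset.sum_sub_distrib]
  refine (norm_sum_le_of_le _ fun k hk => norm_integral_visit_cell_sub_le hg hM fun w hw =>
    hC w (hw.trans ?_)).trans_eq (by rw [Finset.sum_const, Finset.card_range, nsmul_eq_mul])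
  exact Finset.single_le_sum (f := fun k => ‖v k‖) (fun _ _ => norm_nonneg _) hk

theorem exists_timeSharing [FiniteDimensional ℝ Y] [FiniteDimensional ℝ V]
    [SecondCountableTopology P] [NormalSpace P] [ParacompactSpace P] [Nonempty P] {g : P → V → Y}
    (hg : Continuous (Function.uncurry g)) {q : P → Y} (hq : Continuous q)
    (hsurj : ∀ p, Function.Surjective (g p)) :
    ∃ W : ℝ → P → ℝ → V, Continuous (fun x : ℝ × P × ℝ => W x.1 x.2.1 x.2.2) ∧
      (∀ M p, Function.Periodic (W M p) 1) ∧
      (∀ p₀, ∃ R, ∀ᶠ p in 𝓝 p₀, ∀ M θ, ‖W M p θ‖ ≤ R) ∧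
      ∀ p₀, ∀ a > 0, ∃ c, ∀ᶠ p in 𝓝 p₀, ∀ M ≥ c,
        ‖(∫ θ in (0 : ℝ)..1, g p (W M p θ)) - q p‖ ≤ a := by
  have : CompleteSpace Y := FiniteDimensional.complete ℝ Y
  obtain ⟨v, α, hα⟩ := exists_partitionOfUnity_finsum_smul_eq hg hq hsurj
  have hends (M : ℝ) (p : P) : visit α v M p 0 = visit α v M p 1 := by rw [visit_zero, visit_one]
  refine ⟨fun M p θ => visit α v M p (Int.fract θ), ?_,
    fun M p θ => by simp only [Int.fract_add_one], fun p₀ => ?_, fun p₀ a ha => ?_⟩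
  · exact (ContinuousOn.comp_fract' (f := fun (x : ℝ × P) θ => visit α v x.1 x.2 θ)
      ((continuous_visit v).comp (f := fun y : (ℝ × P) × ℝ => (y.1.1, y.1.2, y.2))
        (by fun_prop)).continuousOn fun x => hends x.1 x.2).comp
      (f := fun x : ℝ × P × ℝ => ((x.1, x.2.1), x.2.2)) (by fun_prop)
  · obtain ⟨N, hN⟩ := exists_eventually_forall_ge_eq_zero α p₀
    exact ⟨_, hN.mono fun p hp M θ => norm_visit_le v hp⟩
  · obtain ⟨N, hN⟩ := exists_eventually_forall_ge_eq_zero α p₀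
    obtain ⟨C, -, hC⟩ := exists_eventually_forall_norm_le
      (isCompact_closedBall (0 : V) (∑ k ∈ Finset.range N, ‖v k‖)) hg p₀
    refine ⟨max 1 (N * (4 * C) / a), ?_⟩
    filter_upwards [hN, hC] with p hNp hCp M hM
    have hM0 : 0 < M := one_pos.trans_le ((le_max_left _ _).trans hM)
    have hfract : ∫ θ in (0 : ℝ)..1, g p (visit α v M p (Int.fract θ))
        = ∫ θ in (0 : ℝ)..1, g p (visit α v M p θ) :=
      intervalIntegral.integral_congr_Ioo_of_le zero_le_one fun θ hθ => by
        simp only [Int.fract_eq_self.2 ⟨hθ.1.le, hθ.2⟩]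
    rw [hfract, ← hα p]
    refine (norm_integral_visit_sub_le (hg.uncurry_left p) hNp hM0 fun w hw =>
      hCp w (mem_closedBall_zero_iff.2 hw)).trans ?_
    rw [← mul_assoc, ← div_eq_mul_inv, div_le_comm₀ hM0 ha]
    exact (le_max_right _ _).trans hM

end TimeSharing

/-! ### Chattering controls -/

section Chattering

variable {Λ V Y : Type*} [TopologicalSpace Λ] [NormedAddCommGroup V] [NormedSpace ℝ V]
  [NormedAddCommGroup Y] [NormedSpace ℝ Y]

/-- The control `u`, cross-faded into `ℓ` near the endpoints of `[0, S]`; the fading takes time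
`ω⁻¹` at either end. -/
noncomputable def crossfade (ω S : ℝ) (ℓ u : ℝ → V) (t : ℝ) : V :=
  AffineMap.lineMap (ℓ t) (u t) (plateau ω 0 S t)

section Crossfade

variable {ω S t : ℝ} {ℓ u : ℝ → V}

lemma crossfade_zero : crossfade ω S ℓ u 0 = ℓ 0 := by
  rw [crossfade, plateau_eq_zero (Or.inl le_rfl), AffineMap.lineMap_apply_zero]

lemma crossfade_right : crossfade ω S ℓ u S = ℓ S := by
  rw [crossfade, plateau_eq_zero (Or.inr le_rfl), AffineMap.lineMap_apply_zero]

lemma crossfade_eq (hω : 0 < ω) (ht : t ∈ Icc ω⁻¹ (S - ω⁻¹)) : crossfade ω S ℓ u t = u t := by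
  rw [crossfade, plateau_eq_one hω (by rwa [zero_add]), AffineMap.lineMap_apply_one]

lemma norm_crossfade_le {R : ℝ} (hℓ : ‖ℓ t‖ ≤ R) (hu : ‖u t‖ ≤ R) :
    ‖crossfade ω S ℓ u t‖ ≤ R :=
  mem_closedBall_zero_iff.1 ((convex_closedBall (0 : V) R).lineMap_mem
    (mem_closedBall_zero_iff.2 hℓ) (mem_closedBall_zero_iff.2 hu) ⟨plateau_nonneg, plateau_le_one⟩)

lemma continuous_crossfade {X : Type*} [TopologicalSpace X] {ω t : X → ℝ} {ℓ u : X → ℝ → V}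
    (hω : Continuous ω) (ht : Continuous t) (hℓ : Continuous fun x => ℓ x (t x))
    (hu : Continuous fun x => u x (t x)) :
    Continuous fun x => crossfade (ω x) S (ℓ x) (u x) (t x) :=
  hℓ.lineMap hu (continuous_plateau hω continuous_const continuous_const ht)

end Crossfade

lemma norm_integral_le_of_norm_le_div {E : Type*} [NormedAddCommGroup E] [NormedSpace ℝ E]
    {f : ℝ → E} {S t a : ℝ} (hS : 0 < S) (ht : t ∈ Icc 0 S)
    (hf : ∀ τ ∈ Icc 0 S, ‖f τ‖ ≤ a / S) : ‖∫ τ in (0 : ℝ)..t, f τ‖ ≤ a := by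
  have ha : 0 ≤ a / S := (norm_nonneg _).trans (hf t ht)
  refine (norm_integral_le_mul_sub ht.1 fun τ hτ => hf τ ⟨hτ.1.le, hτ.2.trans ht.2⟩).trans ?_
  rw [sub_zero]
  exact (mul_le_mul_of_nonneg_left ht.2 ha).trans_eq (div_mul_cancel₀ a hS.ne')

lemma norm_integral_sub_le_add {E : Type*} [NormedAddCommGroup E] [NormedSpace ℝ E]
    {f g h : ℝ → E} (hf : Continuous f) (hg : Continuous g) (hh : Continuous h) {a b A B : ℝ}
    (hfg : ‖∫ τ in a..b, (f τ - g τ)‖ ≤ A) (hgh : ‖∫ τ in a..b, (g τ - h τ)‖ ≤ B) :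
    ‖∫ τ in a..b, (f τ - h τ)‖ ≤ A + B := by
  have hsplit : ∫ τ in a..b, (f τ - h τ)
      = (∫ τ in a..b, (f τ - g τ)) + ∫ τ in a..b, (g τ - h τ) := by
    rw [intervalIntegral.integral_sub (hf.intervalIntegrable _ _) (hh.intervalIntegrable _ _),
      intervalIntegral.integral_sub (hf.intervalIntegrable _ _) (hg.intervalIntegrable _ _),
      intervalIntegral.integral_sub (hg.intervalIntegrable _ _) (hh.intervalIntegrable _ _),
      sub_add_sub_cancel]
  rw [hsplit]
  exact norm_add_le_of_le hfg hgh

variable {g : Λ × ℝ → V → Y} {U : Λ → ℝ → ℝ → V} {ℓ : Λ → ℝ → V} {S : ℝ}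

lemma exists_eventually_norm_integral_crossfade_sub_le [ProperSpace V]
    (hg : Continuous (Function.uncurry g))
    (hU : Continuous fun x : Λ × ℝ × ℝ => U x.1 x.2.1 x.2.2)
    (hℓ : Continuous (Function.uncurry ℓ)) {R : C(Λ, ℝ)}
    (hUR : ∀ l, ∀ t ∈ Icc 0 S, ∀ θ, ‖U l t θ‖ ≤ R l) (hℓR : ∀ l, ∀ t ∈ Icc 0 S, ‖ℓ l t‖ ≤ R l)
    {η : ℝ} (hη : 0 < η) (l₀ : Λ) :
    ∃ c, ∀ᶠ l in 𝓝 l₀, ∀ ω ≥ c, ∀ t ∈ Icc 0 S,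
      ‖∫ τ in (0 : ℝ)..t, (g (l, τ) (crossfade ω S (ℓ l) (fun s => U l s (ω * s)) τ)
        - g (l, τ) (U l τ (ω * τ)))‖ ≤ η := by
  obtain ⟨C, hC0, hC⟩ := exists_eventually_forall_norm_le
    (isCompact_Icc.prod (isCompact_closedBall (0 : V) (R l₀ + 1)))
    (φ := fun l (y : ℝ × V) => g (l, y.1) y.2)
    (hg.comp (f := fun x : Λ × ℝ × V => ((x.1, x.2.1), x.2.2)) (by fun_prop)) l₀
  have hR : ∀ᶠ l in 𝓝 l₀, R l ≤ R l₀ + 1 :=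
    (R.continuous.tendsto l₀).eventually_le_const (lt_add_one _)
  refine ⟨4 * C / η, ?_⟩
  filter_upwards [hC, hR] with l hCl hRl ω hω t ht
  have hω0 : 0 < ω := (by positivity : 0 < 4 * C / η).trans_le hω
  have hUl : Continuous fun τ => U l τ (ω * τ) :=
    hU.comp (f := fun τ : ℝ => (l, τ, ω * τ)) (by fun_prop)
  have hgl {w : ℝ → V} (hw : Continuous w) : Continuous fun τ => g (l, τ) (w τ) :=
    hg.comp (f := fun τ => ((l, τ), w τ)) (by fun_prop)
  have hbound {τ : ℝ} (hτ : τ ∈ Icc 0 S) {w : V} (hw : ‖w‖ ≤ R l) : ‖g (l, τ) w‖ ≤ C :=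
    hCl (τ, w) ⟨hτ, mem_closedBall_zero_iff.2 (hw.trans hRl)⟩
  refine (norm_integral_le_of_eq_zero_middle
    (f := fun τ => g (l, τ) (crossfade ω S (ℓ l) (fun s => U l s (ω * s)) τ)
      - g (l, τ) (U l τ (ω * τ)))
    ((hgl (continuous_crossfade continuous_const continuous_id (hℓ.uncurry_left l) hUl)).sub
      (hgl hUl)) ht.1 (inv_pos.2 hω0) (C := C + C) (fun τ hτ => ?_) fun τ hτ => ?_).trans ?_
  · have hτS : τ ∈ Icc 0 S := ⟨hτ.1, hτ.2.trans ht.2⟩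
    exact norm_sub_le_of_le
      (hbound hτS (norm_crossfade_le (hℓR l τ hτS) (hUR l τ hτS _))) (hbound hτS (hUR l τ hτS _))
  · rw [crossfade_eq hω0 ⟨by linarith [hτ.1], by linarith [hτ.2, ht.2]⟩, sub_self]
  · rw [← div_eq_mul_inv, div_le_iff₀ hω0]
    linarith [(div_le_iff₀ hη).1 hω]

lemma continuous_integral_period {G : Λ → ℝ → ℝ → Y}
    (hG : Continuous fun x : Λ × ℝ × ℝ => G x.1 x.2.1 x.2.2) :
    Continuous fun x : Λ × ℝ => ∫ θ in (0 : ℝ)..1, G x.1 x.2 θ :=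
  intervalIntegral.continuous_parametric_intervalIntegral_of_continuous'
    (f := fun (x : Λ × ℝ) θ => G x.1 x.2 θ)
    (hG.comp (f := fun y : (Λ × ℝ) × ℝ => (y.1.1, y.1.2, y.2)) (by fun_prop)) 0 1

lemma exists_eventually_norm_integral_sub_average_le [CompleteSpace Y] {G : Λ → ℝ → ℝ → Y}
    (hG : Continuous fun x : Λ × ℝ × ℝ => G x.1 x.2.1 x.2.2)
    (hper : ∀ l τ, Function.Periodic (G l τ) 1) (hS : 0 ≤ S) {η : ℝ} (hη : 0 < η) (l₀ : Λ) :
    ∃ c, ∀ᶠ l in 𝓝 l₀, ∀ ω ≥ c, ∀ t ∈ Icc 0 S,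
      ‖∫ τ in (0 : ℝ)..t, (G l τ (ω * τ) - ∫ θ in (0 : ℝ)..1, G l τ θ)‖ ≤ η := by
  refine eventually_norm_integral_oscillating_le
    (G := fun l τ θ => G l τ θ - ∫ θ in (0 : ℝ)..1, G l τ θ)
    (hG.sub ((continuous_integral_period hG).comp (f := fun x : Λ × ℝ × ℝ => (x.1, x.2.1))
      (by fun_prop)))
    (fun l τ θ => by simp only [hper l τ θ]) (fun l τ => ?_) hS hη l₀
  have hGθ : Continuous (G l τ) := hG.comp (f := fun θ : ℝ => (l, τ, θ)) (by fun_prop)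
  rw [intervalIntegral.integral_sub (hGθ.intervalIntegrable _ _) intervalIntegrable_const,
    intervalIntegral.integral_const, sub_zero, one_smul, sub_self]

variable [NormalSpace Λ] [ParacompactSpace Λ]

lemma exists_chattering_frequency [ProperSpace V] [CompleteSpace Y]
    (hg : Continuous (Function.uncurry g))
    (hU : Continuous fun x : Λ × ℝ × ℝ => U x.1 x.2.1 x.2.2)
    (hper : ∀ l τ, Function.Periodic (U l τ) 1) (hℓ : Continuous (Function.uncurry ℓ))
    {R : C(Λ, ℝ)} (hUR : ∀ l, ∀ t ∈ Icc 0 S, ∀ θ, ‖U l t θ‖ ≤ R l)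
    (hℓR : ∀ l, ∀ t ∈ Icc 0 S, ‖ℓ l t‖ ≤ R l) (hS : 0 ≤ S) {a : C(Λ, ℝ)} (ha : ∀ l, 0 < a l) :
    ∃ ω : C(Λ, ℝ), ∀ l, ∀ t ∈ Icc 0 S,
      ‖∫ τ in (0 : ℝ)..t, (g (l, τ) (crossfade (ω l) S (ℓ l) (fun s => U l s (ω l * s)) τ)
        - ∫ θ in (0 : ℝ)..1, g (l, τ) (U l τ θ))‖ ≤ a l := by
  have hG : Continuous fun x : Λ × ℝ × ℝ => g (x.1, x.2.1) (U x.1 x.2.1 x.2.2) :=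
    hg.comp ((by fun_prop : Continuous fun x : Λ × ℝ × ℝ => (x.1, x.2.1)).prodMk hU)
  obtain ⟨ω, hω⟩ := exists_continuous_of_eventually_forall_ge
    (Q := fun l ω => ∀ t ∈ Icc 0 S,
      ‖∫ τ in (0 : ℝ)..t, (g (l, τ) (crossfade ω S (ℓ l) (fun s => U l s (ω * s)) τ)
        - ∫ θ in (0 : ℝ)..1, g (l, τ) (U l τ θ))‖ ≤ a l) fun l₀ => by
    obtain ⟨c₁, hc₁⟩ := exists_eventually_norm_integral_crossfade_sub_le hg hU hℓ hUR hℓR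
      (η := a l₀ / 4) (by linarith [ha l₀]) l₀
    obtain ⟨c₂, hc₂⟩ := exists_eventually_norm_integral_sub_average_le
      (G := fun l τ θ => g (l, τ) (U l τ θ)) hG (fun l τ θ => by simp only [hper l τ θ]) hS
      (η := a l₀ / 4) (by linarith [ha l₀]) l₀
    have hal : ∀ᶠ l in 𝓝 l₀, a l₀ / 2 ≤ a l :=
      (a.continuous.tendsto l₀).eventually_const_le (half_lt_self (ha l₀))
    refine ⟨max c₁ c₂, ?_⟩
    filter_upwards [hc₁, hc₂, hal] with l h₁ h₂ hal ω hω t ht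
    have hUl : Continuous fun τ => U l τ (ω * τ) :=
      hU.comp (f := fun τ : ℝ => (l, τ, ω * τ)) (by fun_prop)
    have hgl {w : ℝ → V} (hw : Continuous w) : Continuous fun τ => g (l, τ) (w τ) :=
      hg.comp (f := fun τ => ((l, τ), w τ)) (by fun_prop)
    have hmean : Continuous fun τ => ∫ θ in (0 : ℝ)..1, g (l, τ) (U l τ θ) :=
      (continuous_integral_period (G := fun l τ θ => g (l, τ) (U l τ θ)) hG).along_snd
    exact (norm_integral_sub_le_add
      (hgl (continuous_crossfade continuous_const continuous_id (hℓ.uncurry_left l) hUl))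
      (hgl hUl) hmean
      (h₁ ω ((le_max_left _ _).trans hω) t ht)
      (h₂ ω ((le_max_right _ _).trans hω) t ht)).trans (by linarith)
  exact ⟨ω, fun l => (hω l).2 _ le_rfl⟩

omit [NormedSpace ℝ V] [NormedSpace ℝ Y] in
lemma exists_continuous_tolerance [ProperSpace V] (hg : Continuous (Function.uncurry g))
    (R : C(Λ, ℝ)) {a : C(Λ, ℝ)} (ha : ∀ l, 0 < a l) :
    ∃ δ : C(Λ, ℝ), ∀ l, 0 < δ l ∧ ∀ t ∈ Icc 0 S, ∀ v w : V, ‖v‖ ≤ R l → ‖w - v‖ ≤ δ l →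
      ‖g (l, t) w - g (l, t) v‖ ≤ a l := by
  obtain ⟨η, hη⟩ := exists_continuous_of_eventually_forall_ge
    (Q := fun l η => ∀ t ∈ Icc 0 S, ∀ v w : V, ‖v‖ ≤ R l → ‖w - v‖ ≤ η⁻¹ →
      ‖g (l, t) w - g (l, t) v‖ ≤ a l) fun l₀ => by
    have hR : ∀ᶠ l in 𝓝 l₀, R l ≤ R l₀ + 1 :=
      (R.continuous.tendsto l₀).eventually_le_const (lt_add_one _)
    have hsmall : ∀ᶠ x in 𝓝 (l₀, (0 : V)), ∀ y ∈ Icc 0 S ×ˢ Metric.closedBall (0 : V) (R l₀ + 1),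
        ‖g (x.1, y.1) (y.2 + x.2) - g (x.1, y.1) y.2‖ < a x.1 := by
      refine eventually_forall_lt (isCompact_Icc.prod (isCompact_closedBall _ _))
        (φ := fun (x : Λ × V) (y : ℝ × V) => ‖g (x.1, y.1) (y.2 + x.2) - g (x.1, y.1) y.2‖)
        (ψ := fun (x : Λ × V) _ => a x.1) ?_ (by fun_prop) fun y _ => ?_
      · exact ((hg.comp (f := fun z : (Λ × V) × ℝ × V => ((z.1.1, z.2.1), z.2.2 + z.1.2))
          (by fun_prop)).sub (hg.comp (f := fun z : (Λ × V) × ℝ × V => ((z.1.1, z.2.1), z.2.2))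
          (by fun_prop))).norm
      · simpa only [add_zero, sub_self, norm_zero] using ha l₀
    rw [nhds_prod_eq] at hsmall
    obtain ⟨p, hp, q, hq, hpq⟩ := eventually_prod_iff.1 hsmall
    obtain ⟨δ, hδ, hδq⟩ := Metric.nhds_basis_closedBall.mem_iff.1 hq
    refine ⟨δ⁻¹, ?_⟩
    filter_upwards [hp, hR] with l hpl hRl η hη t ht v w hv hvw
    have hq' : q (w - v) := hδq (mem_closedBall_zero_iff.2
      (hvw.trans (inv_le_of_inv_le₀ hδ hη)))
    simpa only [add_sub_cancel] using
      (hpq hpl hq' (t, v) ⟨ht, mem_closedBall_zero_iff.2 (hv.trans hRl)⟩).le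
  exact ⟨⟨fun l => (η l)⁻¹, η.continuous.inv₀ fun l => (hη l).1.ne'⟩,
    fun l => ⟨inv_pos.2 (hη l).1, (hη l).2 _ le_rfl⟩⟩

end Chattering

section Chattering

variable {Λ V Y : Type*} [MetricSpace Λ] [SecondCountableTopology Λ] [Nonempty Λ]
  [NormedAddCommGroup V] [NormedSpace ℝ V] [FiniteDimensional ℝ V] [NormedAddCommGroup Y]
  [NormedSpace ℝ Y] [FiniteDimensional ℝ Y] {g : Λ × ℝ → V → Y} {S : ℝ}

lemma exists_timeSharing_Icc (hg : Continuous (Function.uncurry g))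
    (hsurj : ∀ p, Function.Surjective (g p)) {q : Λ → ℝ → Y}
    (hq : Continuous (Function.uncurry q)) {ℓ : Λ → ℝ → V} (hℓ : Continuous (Function.uncurry ℓ)) :
    ∃ R : C(Λ, ℝ), (∀ l, ∀ t ∈ Icc 0 S, ‖ℓ l t‖ ≤ R l) ∧
      ∀ a : C(Λ, ℝ), (∀ l, 0 < a l) → ∃ U : Λ → ℝ → ℝ → V,
        Continuous (fun x : Λ × ℝ × ℝ => U x.1 x.2.1 x.2.2) ∧
        (∀ l t, Function.Periodic (U l t) 1) ∧ (∀ l, ∀ t ∈ Icc 0 S, ∀ θ, ‖U l t θ‖ ≤ R l) ∧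
        ∀ l, ∀ t ∈ Icc 0 S, ‖(∫ θ in (0 : ℝ)..1, g (l, t) (U l t θ)) - q l t‖ ≤ a l := by
  obtain ⟨W, hW, hWper, hWbdd, hWmean⟩ := exists_timeSharing hg hq hsurj
  obtain ⟨R, hR⟩ := exists_continuous_of_eventually_forall_ge_prod (isCompact_Icc (a := 0) (b := S))
    (Q := fun p R => ‖ℓ p.1 p.2‖ ≤ R ∧ ∀ M θ, ‖W M p θ‖ ≤ R) fun p₀ => by
      obtain ⟨C, hC⟩ := hWbdd p₀
      refine ⟨max (‖ℓ p₀.1 p₀.2‖ + 1) C, ?_⟩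
      filter_upwards [hC, (hℓ.norm.tendsto p₀).eventually_le_const (lt_add_one _)]
        with p hWp hℓp R hR
      exact ⟨hℓp.trans ((le_max_left _ _).trans hR),
        fun M θ => (hWp M θ).trans ((le_max_right _ _).trans hR)⟩
  refine ⟨R, fun l t ht => ((hR l).2 t ht _ le_rfl).1, fun a ha => ?_⟩
  obtain ⟨M, hM⟩ := exists_continuous_of_eventually_forall_ge_prod (isCompact_Icc (a := 0) (b := S))
    (Q := fun p M => ‖(∫ θ in (0 : ℝ)..1, g p (W M p θ)) - q p.1 p.2‖ ≤ a p.1) fun p₀ => by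
      obtain ⟨c, hc⟩ := hWmean p₀ (a p₀.1 / 2) (half_pos (ha p₀.1))
      have hap : Continuous fun p : Λ × ℝ => a p.1 := by fun_prop
      exact ⟨c, (hc.and ((hap.tendsto p₀).eventually_const_le (half_lt_self (ha p₀.1)))).mono
        fun p hp M hM => (hp.1 M hM).trans hp.2⟩
  exact ⟨fun l t θ => W (M l) (l, t) θ,
    hW.comp (f := fun x : Λ × ℝ × ℝ => (M x.1, (x.1, x.2.1), x.2.2)) (by fun_prop),
    fun l t => hWper _ _, fun l t ht => ((hR l).2 t ht _ le_rfl).2 _,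
    fun l t ht => (hM l).2 t ht _ le_rfl⟩

lemma exists_chattering_of_continuous (hg : Continuous (Function.uncurry g))
    (hsurj : ∀ p, Function.Surjective (g p)) {q : Λ → ℝ → Y}
    (hq : Continuous (Function.uncurry q)) {ℓ : Λ → ℝ → V} (hℓ : Continuous (Function.uncurry ℓ))
    (hS : 0 < S) :
    ∃ R : C(Λ, ℝ), ∀ a : C(Λ, ℝ), (∀ l, 0 < a l) →
      ∃ w : Λ → ℝ → V, Continuous (Function.uncurry w) ∧
        ∀ l, w l 0 = ℓ l 0 ∧ w l S = ℓ l S ∧ ∀ t ∈ Icc 0 S, ‖w l t‖ ≤ R l ∧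
          ‖∫ τ in (0 : ℝ)..t, (g (l, τ) (w l τ) - q l τ)‖ ≤ a l := by
  have : CompleteSpace Y := FiniteDimensional.complete ℝ Y
  have : ProperSpace V := FiniteDimensional.proper ℝ V
  obtain ⟨R, hℓR, hR⟩ := exists_timeSharing_Icc (S := S) hg hsurj hq hℓ
  refine ⟨R, fun a ha => ?_⟩
  obtain ⟨U, hU, hper, hUR, hmean⟩ := hR ⟨fun l => a l / 2 / S, by fun_prop⟩
    fun l => div_pos (half_pos (ha l)) hS
  obtain ⟨ω, hω⟩ := exists_chattering_frequency (a := ⟨fun l => a l / 2, by fun_prop⟩) hg hU hper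
    hℓ hUR hℓR hS.le fun l => half_pos (ha l)
  have hw : Continuous fun x : Λ × ℝ =>
      crossfade (ω x.1) S (ℓ x.1) (fun s => U x.1 s (ω x.1 * s)) x.2 :=
    continuous_crossfade (u := fun x s => U x.1 s (ω x.1 * s)) (by fun_prop)
      continuous_snd hℓ (hU.comp (f := fun x : Λ × ℝ => (x.1, x.2, ω x.1 * x.2)) (by fun_prop))
  refine ⟨fun l => crossfade (ω l) S (ℓ l) fun s => U l s (ω l * s), hw,
    fun l => ⟨crossfade_zero, crossfade_right, fun t ht =>
      ⟨norm_crossfade_le (hℓR l t ht) (hUR l t ht _), ?_⟩⟩⟩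
  have hgw : Continuous fun τ => g (l, τ) (crossfade (ω l) S (ℓ l) (fun s => U l s (ω l * s)) τ) :=
    hg.comp ((Continuous.prodMk_right l).prodMk hw.along_snd)
  have hgU : Continuous fun τ => ∫ θ in (0 : ℝ)..1, g (l, τ) (U l τ θ) :=
    (continuous_integral_period (G := fun l τ θ => g (l, τ) (U l τ θ))
      (hg.comp ((by fun_prop : Continuous fun x : Λ × ℝ × ℝ => (x.1, x.2.1)).prodMk hU))).along_snd
  exact (norm_integral_sub_le_add hgw hgU (hq.uncurry_left l) (hω l t ht)
    (norm_integral_le_of_norm_le_div hS ht (hmean l))).trans_eq (add_halves (a l))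

theorem exists_chattering (hg : Continuous (Function.uncurry g))
    (hsurj : ∀ p, Function.Surjective (g p)) {q : Λ → ℝ → Y}
    (hq : Continuous (Function.uncurry q)) {ℓ : Λ → ℝ → V} (hℓ : Continuous (Function.uncurry ℓ))
    (hS : 0 < S) :
    ∃ R : C(Λ, ℝ), ∀ a : C(Λ, ℝ), (∀ l, 0 < a l) →
      ∃ w p : Λ → ℝ → V, Continuous (Function.uncurry w) ∧ Continuous (Function.uncurry p) ∧
        ∀ l, w l 0 = ℓ l 0 ∧ w l S = ℓ l S ∧ ∀ t ∈ Icc 0 S,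
          w l t = w l 0 + (∫ τ in (0 : ℝ)..t, p l τ) ∧ ‖w l t‖ ≤ R l ∧
          ‖∫ τ in (0 : ℝ)..t, (g (l, τ) (w l τ) - q l τ)‖ ≤ a l := by
  have : CompleteSpace V := FiniteDimensional.complete ℝ V
  have : ProperSpace V := FiniteDimensional.proper ℝ V
  obtain ⟨R, hR⟩ := exists_chattering_of_continuous hg hsurj hq hℓ hS
  refine ⟨R + 1, fun a ha => ?_⟩
  obtain ⟨v, hv, hvR⟩ := hR ⟨fun l => a l / 2, by fun_prop⟩ fun l => half_pos (ha l)
  obtain ⟨δ, hδ⟩ := exists_continuous_tolerance (S := S) hg R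
    (a := ⟨fun l => a l / 2 / S, by fun_prop⟩) fun l => div_pos (half_pos (ha l)) hS
  obtain ⟨p, hp, hpS, hpv⟩ := exists_smoothing hv hS (η := fun l => min (δ l) 1) (by fun_prop)
    fun l => lt_min (hδ l).1 one_pos
  have hw : Continuous fun x : Λ × ℝ => v x.1 0 + ∫ τ in (0 : ℝ)..x.2, p x.1 τ :=
    (hv.comp (f := fun x : Λ × ℝ => (x.1, (0 : ℝ))) (by fun_prop)).add
      (intervalIntegral.continuous_parametric_intervalIntegral_of_continuous
        (f := fun (x : Λ × ℝ) τ => p x.1 τ)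
        (hp.comp (f := fun y : (Λ × ℝ) × ℝ => (y.1.1, y.2)) (by fun_prop)) continuous_snd)
  have hgl (l : Λ) {w : ℝ → V} (hw : Continuous w) : Continuous fun τ => g (l, τ) (w τ) :=
    hg.comp (f := fun τ => ((l, τ), w τ)) (by fun_prop)
  refine ⟨fun l t => v l 0 + ∫ τ in (0 : ℝ)..t, p l τ, p, hw, hp, fun l =>
    ⟨?_, (hpS l).trans (hvR l).2.1, fun t ht => ⟨?_, ?_, ?_⟩⟩⟩
  · simpa only [intervalIntegral.integral_same, add_zero] using (hvR l).1
  · simp only [intervalIntegral.integral_same, add_zero]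
  · dsimp only
    rw [← sub_add_cancel (v l 0 + _) (v l t), add_comm]
    exact norm_add_le_of_le ((hvR l).2.2 t ht).1 ((hpv l t ht).trans (min_le_right _ _))
  · refine (norm_integral_sub_le_add (hgl l (Continuous.along_snd hw))
      (hgl l (hv.uncurry_left l)) (hq.uncurry_left l)
      (norm_integral_le_of_norm_le_div hS ht fun τ hτ => ?_)
      ((hvR l).2.2 t ht).2).trans_eq (add_halves (a l))
    exact (hδ l).2 τ hτ _ _ ((hvR l).2.2 τ hτ).1 ((hpv l τ hτ).trans (min_le_left _ _))

end Chattering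

/-! ### Approximate steering by backstepping -/

lemma integral_pi_apply {ι : Type*} [Fintype ι] {E : ι → Type*} [∀ i, NormedAddCommGroup (E i)]
    [∀ i, NormedSpace ℝ (E i)] [∀ i, CompleteSpace (E i)] {f : ℝ → (i : ι) → E i}
    (hf : Continuous f) (a b : ℝ) (i : ι) : (∫ τ in a..b, f τ) i = ∫ τ in a..b, f τ i :=
  ((ContinuousLinearMap.proj (R := ℝ) (φ := E) i).intervalIntegral_comp_comm
    (hf.intervalIntegrable a b)).symm

lemma LipschitzOnBalls.exists_continuous_residual_bound {Λ E : Type*} [TopologicalSpace Λ]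
    [NormalSpace Λ] [ParacompactSpace Λ] [NormedAddCommGroup E] [NormedSpace ℝ E] [CompleteSpace E]
    {H : ℝ → E → E} {S : ℝ} (hlip : LipschitzOnBalls H S) (hH : Continuous (Function.uncurry H))
    (hS : 0 ≤ S) (R : C(Λ, ℝ)) {ε : ℝ} (hε : 0 < ε) :
    ∃ a : C(Λ, ℝ), ∀ l, 0 < a l ∧ ∀ ρ c : ℝ → E, Continuous ρ → Continuous c →
      (∀ t ∈ Icc 0 S, ‖ρ t‖ ≤ R l) →
      (∀ t ∈ Icc 0 S, ‖c t + (∫ τ in (0 : ℝ)..t, H τ (ρ τ)) - ρ t‖ ≤ a l) →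
      ∃ y : ℝ → E, Continuous y ∧ SolvesVolterra H S c y ∧ ∀ t ∈ Icc 0 S, ‖y t - ρ t‖ ≤ ε := by
  obtain ⟨b, hb⟩ := exists_continuous_of_eventually_forall_ge (Λ := Λ)
    (Q := fun l b => ∀ ρ c : ℝ → E, Continuous ρ → Continuous c →
      (∀ t ∈ Icc 0 S, ‖ρ t‖ ≤ R l) →
      (∀ t ∈ Icc 0 S, ‖c t + (∫ τ in (0 : ℝ)..t, H τ (ρ τ)) - ρ t‖ ≤ b⁻¹) →
      ∃ y : ℝ → E, Continuous y ∧ SolvesVolterra H S c y ∧ ∀ t ∈ Icc 0 S, ‖y t - ρ t‖ ≤ ε)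
    fun l₀ => by
      obtain ⟨a, ha, htol⟩ := hlip.exists_tolerance hH (R l₀ + 1) hε
      refine ⟨a⁻¹, ((R.continuous.tendsto l₀).eventually_le_const (lt_add_one _)).mono
        fun l hl b hb ρ c hρ hc hρR hres => htol S ⟨hS, le_rfl⟩ ρ c hρ hc
          (fun t ht => (hρR t ht).trans hl) fun t ht => (hres t ht).trans ?_⟩
      exact inv_le_of_inv_le₀ ha hb
  exact ⟨⟨fun l => (b l)⁻¹, b.continuous.inv₀ fun l => (hb l).1.ne'⟩, fun l =>
    ⟨inv_pos.2 (hb l).1, (hb l).2 _ le_rfl⟩⟩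

variable {ν : ℕ} {m : Fin (ν + 1) → ℕ} {F : Components m}

/-- The space of all blocks `(x_1, …, x_ν, x_{ν+1})`, the control `u = x_{ν+1}` included. -/
abbrev Ext (m : Fin (ν + 1) → ℕ) : Type := (j : Fin (ν + 1)) → Vec (m j)

/-- The right-hand side of triangular form as a function of all blocks. -/
def extField (F : Components m) (t : ℝ) (z : Ext m) : State m :=
  fun i => F i t (fun j => z j.1.castSucc) (z i.succ)

lemma extField_congr (F : Components m) (t : ℝ) {z z' : Ext m} {i : Fin ν}
    (h : ∀ j ≤ i.succ, z j = z' j) : extField F t z i = extField F t z' i := by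
  unfold extField
  rw [h _ le_rfl]
  congr 1
  funext j
  exact h _ ((Fin.castSucc_le_castSucc_iff.2 j.2).trans i.castSucc_lt_succ.le)

section Mask

variable {κ i : Fin ν} {j : Fin (ν + 1)} {z₀ : Ext m} {ρ y : ℝ → Ext m} {S t : ℝ}

/-- The components `f_1, …, f_k` of the right-hand side, as a vector field on the space of all
blocks in which the other blocks do not move. -/
def maskField (F : Components m) (κ : Fin ν) (t : ℝ) (z : Ext m) : Ext m :=
  Fin.snoc (α := fun j => Vec (m j)) (fun i : Fin ν => if i ≤ κ then extField F t z i else 0) 0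

lemma maskField_castSucc (F : Components m) (κ : Fin ν) (t : ℝ) (z : Ext m) (i : Fin ν) :
    maskField F κ t z i.castSucc = if i ≤ κ then extField F t z i else 0 :=
  Fin.snoc_castSucc (α := fun j => Vec (m j)) _ _ _

lemma maskField_of_lt (F : Components m) (t : ℝ) (z : Ext m) (hj : κ.castSucc < j) :
    maskField F κ t z j = 0 := by
  induction j using Fin.lastCases with
  | last => exact Fin.snoc_last (α := fun j => Vec (m j)) _ _
  | cast i => rw [maskField_castSucc, if_neg (not_le.2 (Fin.castSucc_lt_castSucc_iff.1 hj))]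

lemma continuous_maskField (hF : Continuous (Function.uncurry (extField F))) (κ : Fin ν) :
    Continuous (Function.uncurry (maskField F κ)) := by
  refine continuous_pi fun j => ?_
  induction j using Fin.lastCases with
  | last =>
    simp only [Function.uncurry_def, maskField_of_lt F _ _ (Fin.castSucc_lt_last κ)]
    exact continuous_const
  | cast i =>
    simp only [Function.uncurry_def, maskField_castSucc]
    split_ifs
    · exact (continuous_apply i).comp hF
    · exact continuous_const

lemma lipschitzOnBalls_maskField (hF : LipschitzOnBalls (extField F) S) (κ : Fin ν) :
    LipschitzOnBalls (maskField F κ) S := by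
  refine fun R => (hF R).imp fun L hL t ht =>
    LipschitzOnWith.of_dist_le_mul fun x hx y hy => le_trans ?_ ((hL t ht).dist_le_mul x hx y hy)
  refine (dist_pi_le_iff dist_nonneg).2 fun j => ?_
  induction j using Fin.lastCases with
  | last => simp only [maskField_of_lt F _ _ (Fin.castSucc_lt_last κ), dist_self, dist_nonneg]
  | cast i =>
    rw [maskField_castSucc, maskField_castSucc]
    split_ifs
    · exact dist_le_pi_dist _ _ i
    · rw [dist_self]
      exact dist_nonneg

lemma integral_maskField_castSucc (hF : Continuous (Function.uncurry (extField F)))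
    (hy : Continuous y) (hi : i ≤ κ) (t : ℝ) :
    (∫ τ in (0 : ℝ)..t, maskField F κ τ (y τ)) i.castSucc =
      ∫ τ in (0 : ℝ)..t, extField F τ (y τ) i := by
  rw [integral_pi_apply (continuous_comp_graph (continuous_maskField hF κ) hy)]
  simp only [maskField_castSucc, if_pos hi]

lemma integral_maskField_of_lt (hF : Continuous (Function.uncurry (extField F)))
    (hy : Continuous y) (hj : κ.castSucc < j) (t : ℝ) :
    (∫ τ in (0 : ℝ)..t, maskField F κ τ (y τ)) j = 0 := by
  rw [integral_pi_apply (continuous_comp_graph (continuous_maskField hF κ) hy)]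
  simp only [maskField_of_lt F _ _ hj, intervalIntegral.integral_zero]

/-- The free term of the Volterra equation for `maskField F κ` whose first blocks start at `z₀` and
whose blocks after the `κ`-th one are prescribed by `ρ`. -/
def maskDatum (κ : Fin ν) (z₀ : Ext m) (ρ : ℝ → Ext m) (t : ℝ) : Ext m :=
  fun j => if j ≤ κ.castSucc then z₀ j else ρ t j

lemma maskDatum_of_le (z₀ : Ext m) (ρ : ℝ → Ext m) (t : ℝ) (hi : i ≤ κ) :
    maskDatum κ z₀ ρ t i.castSucc = z₀ i.castSucc :=
  if_pos (Fin.castSucc_le_castSucc_iff.2 hi)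

lemma maskDatum_of_lt (z₀ : Ext m) (ρ : ℝ → Ext m) (t : ℝ) (hj : κ.castSucc < j) :
    maskDatum κ z₀ ρ t j = ρ t j :=
  if_neg hj.not_ge

lemma maskDatum_of_eq (h : ρ t = z₀) : maskDatum κ z₀ ρ t = z₀ := by
  funext j
  rw [maskDatum, h, ite_self]

lemma continuous_maskDatum {Λ : Type*} [TopologicalSpace Λ] (κ : Fin ν) {z₀ : Λ → Ext m}
    (hz₀ : Continuous z₀) {ρ : Λ → ℝ → Ext m} (hρ : Continuous (Function.uncurry ρ)) :
    Continuous (Function.uncurry fun l => maskDatum κ (z₀ l) (ρ l)) := by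
  refine continuous_pi fun j => ?_
  simp only [Function.uncurry_def, maskDatum]
  split_ifs
  · fun_prop
  · exact (continuous_apply j).comp hρ

lemma SolvesVolterra.apply_castSucc (hF : Continuous (Function.uncurry (extField F)))
    (hys : SolvesVolterra (maskField F κ) S (maskDatum κ z₀ ρ) y) (hy : Continuous y)
    (ht : t ∈ Icc 0 S) (hi : i ≤ κ) :
    y t i.castSucc = z₀ i.castSucc + ∫ τ in (0 : ℝ)..t, extField F τ (y τ) i := by
  rw [congrFun (hys t ht) i.castSucc, Pi.add_apply, maskDatum_of_le z₀ ρ t hi,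
    integral_maskField_castSucc hF hy hi]

lemma SolvesVolterra.apply_of_lt (hF : Continuous (Function.uncurry (extField F)))
    (hys : SolvesVolterra (maskField F κ) S (maskDatum κ z₀ ρ) y) (hy : Continuous y)
    (ht : t ∈ Icc 0 S) (hj : κ.castSucc < j) : y t j = ρ t j := by
  rw [hys t ht, Pi.add_apply, maskDatum_of_lt z₀ ρ t hj, integral_maskField_of_lt hF hy hj,
    add_zero]

end Mask

section Splice

variable {κ : Fin ν} {j : Fin (ν + 1)} {z₀ : Ext m} {Z : ℝ → Ext m} {w : ℝ → Vec (m κ.succ)}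
  {t : ℝ}

/-- The curve `Z` with the block that drives the `κ`-th equation replaced by `w`. -/
def splice (κ : Fin ν) (Z : ℝ → Ext m) (w : ℝ → Vec (m κ.succ)) (t : ℝ) : Ext m :=
  Function.update (Z t) κ.succ (w t)

lemma splice_succ (Z : ℝ → Ext m) (w : ℝ → Vec (m κ.succ)) (t : ℝ) :
    splice κ Z w t κ.succ = w t :=
  Function.update_self _ _ _

lemma splice_of_ne (Z : ℝ → Ext m) (w : ℝ → Vec (m κ.succ)) (t : ℝ) (hj : j ≠ κ.succ) :
    splice κ Z w t j = Z t j :=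
  Function.update_of_ne hj _ _

lemma splice_of_eq (h : w t = Z t κ.succ) : splice κ Z w t = Z t := by
  rw [splice, h, Function.update_eq_self]

lemma continuous_splice {Λ : Type*} [TopologicalSpace Λ] {Z : Λ → ℝ → Ext m}
    (hZ : Continuous (Function.uncurry Z)) {w : Λ → ℝ → Vec (m κ.succ)}
    (hw : Continuous (Function.uncurry w)) :
    Continuous (Function.uncurry fun l => splice κ (Z l) (w l)) :=
  hZ.update κ.succ hw

lemma norm_splice_le {A B : ℝ} (hZ : ‖Z t‖ ≤ A) (hw : ‖w t‖ ≤ B) : ‖splice κ Z w t‖ ≤ A + B := by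
  have hA : 0 ≤ A := (norm_nonneg _).trans hZ
  have hB : 0 ≤ B := (norm_nonneg _).trans hw
  refine (pi_norm_le_iff_of_nonneg (add_nonneg hA hB)).2 fun j => ?_
  rcases eq_or_ne j κ.succ with rfl | hj
  · rw [splice_succ]
    exact hw.trans (le_add_of_nonneg_left hA)
  · rw [splice_of_ne Z w t hj]
    exact (norm_le_pi_norm (Z t) j).trans (hZ.trans (le_add_of_nonneg_right hB))

-- The equations before the `κ`-th one do not involve the replaced block, so they hold exactly.
lemma norm_residual_splice_le (hF : Continuous (Function.uncurry (extField F)))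
    (hρ : Continuous (splice κ Z w)) {a : ℝ}
    (hZ : ∀ i < κ, Z t i.castSucc = z₀ i.castSucc + ∫ τ in (0 : ℝ)..t, extField F τ (Z τ) i)
    (hκ : ‖z₀ κ.castSucc + (∫ τ in (0 : ℝ)..t, extField F τ (splice κ Z w τ) κ) -
      Z t κ.castSucc‖ ≤ a) :
    ‖maskDatum κ z₀ (splice κ Z w) t + (∫ τ in (0 : ℝ)..t, maskField F κ τ (splice κ Z w τ)) -
      splice κ Z w t‖ ≤ a := by
  have ha : 0 ≤ a := (norm_nonneg _).trans hκ
  refine (pi_norm_le_iff_of_nonneg ha).2 fun j => ?_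
  rw [Pi.sub_apply, Pi.add_apply]
  rcases lt_or_ge κ.castSucc j with hj | hj
  · rwa [integral_maskField_of_lt hF hρ hj, maskDatum_of_lt z₀ _ t hj, add_zero, sub_self,
      norm_zero]
  obtain ⟨i, rfl⟩ : ∃ i : Fin ν, i.castSucc = j :=
    ⟨_, Fin.castSucc_castPred j (hj.trans_lt (Fin.castSucc_lt_last κ)).ne⟩
  have hi : i ≤ κ := Fin.castSucc_le_castSucc_iff.1 hj
  rw [integral_maskField_castSucc hF hρ hi, maskDatum_of_le z₀ _ t hi,
    splice_of_ne Z w t (hj.trans_lt Fin.castSucc_lt_succ).ne]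
  rcases hi.eq_or_lt with rfl | hi
  · exact hκ
  · have hsame (τ : ℝ) : extField F τ (splice κ Z w τ) i = extField F τ (Z τ) i :=
      extField_congr F τ fun j hj =>
        splice_of_ne Z w τ (hj.trans_lt (Fin.succ_lt_succ_iff.2 hi)).ne
    simp only [hsame]
    rwa [← hZ i hi, sub_self, norm_zero]

end Splice

section Response

variable {Λ : Type*} {κ : Fin ν} {Z : Λ → ℝ → Ext m}

/-- The velocity of the `κ`-th block along the curve `Z l`, as a function of the next block. -/
def response (F : Components m) (κ : Fin ν) (Z : Λ → ℝ → Ext m) (p : Λ × ℝ)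
    (w : Vec (m κ.succ)) : Vec (m κ.castSucc) :=
  F κ p.2 (fun j => Z p.1 p.2 j.1.castSucc) w

lemma response_apply_eq_extField_splice (F : Components m) (Z : Λ → ℝ → Ext m) (l : Λ)
    (w : ℝ → Vec (m κ.succ)) (t : ℝ) :
    response F κ Z (l, t) (w t) = extField F t (splice κ (Z l) w t) κ := by
  simp only [response, extField, splice_succ]
  congr 1
  funext j
  exact (splice_of_ne (Z l) w t
    ((Fin.castSucc_le_castSucc_iff.2 j.2).trans_lt Fin.castSucc_lt_succ).ne).symm

lemma continuous_response [TopologicalSpace Λ] (hF : Continuous (Function.uncurry (extField F)))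
    (κ : Fin ν) (hZ : Continuous (Function.uncurry Z)) :
    Continuous (Function.uncurry (response F κ Z)) := by
  have hupdate : Continuous fun x : (Λ × ℝ) × Vec (m κ.succ) =>
      Function.update (Z x.1.1 x.1.2) κ.succ x.2 :=
    (hZ.comp continuous_fst).update κ.succ continuous_snd
  refine ((continuous_apply κ).comp (hF.comp ((continuous_snd.comp continuous_fst).prodMk
    hupdate))).congr fun x => ?_
  exact (response_apply_eq_extField_splice F Z x.1.1 (fun _ => x.2) x.1.2).symm

end Response

section Steering

variable {Λ : Type*} [MetricSpace Λ] {S : ℝ} {z₀ : Λ → Ext m} {zS : Ext m} {ε δ : ℝ}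
  {Z : Λ → ℝ → Ext m}

/-- Families of curves that start at `z₀`, end near `zS`, and whose blocks before the `k`-th one
follow the triangular system. The `k`-th block has a continuous derivative, to be matched by the
next step of the construction, and this and all later blocks end exactly at `zS`. -/
structure SteeredUpTo (F : Components m) (S : ℝ) (z₀ : Λ → Ext m) (zS : Ext m) (ε : ℝ) (k : ℕ)
    (Z : Λ → ℝ → Ext m) : Prop where
  continuous : Continuous (Function.uncurry Z)
  start : ∀ l, Z l 0 = z₀ l
  solves : ∀ l, ∀ i : Fin ν, i.val < k → ∀ t ∈ Icc 0 S,
    Z l t i.castSucc = z₀ l i.castSucc + ∫ τ in (0 : ℝ)..t, extField F τ (Z l τ) i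
  primitive : ∀ j : Fin (ν + 1), j.val = k → ∃ q : Λ → ℝ → Vec (m j),
    Continuous (Function.uncurry q) ∧
    ∀ l, ∀ t ∈ Icc 0 S, Z l t j = z₀ l j + ∫ τ in (0 : ℝ)..t, q l τ
  terminal : ∀ l, ∀ j : Fin (ν + 1), k ≤ j.val → Z l S j = zS j
  near : ∀ l, ‖Z l S - zS‖ ≤ ε

lemma exists_steeredUpTo_zero (F : Components m) (hS : 0 < S) (hz₀ : Continuous z₀) (zS : Ext m)
    (hε : 0 ≤ ε) : ∃ Z, SteeredUpTo F S z₀ zS ε 0 Z := by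
  have hend (l : Λ) : z₀ l + (S / S) • (zS - z₀ l) = zS := by
    rw [div_self hS.ne', one_smul, add_sub_cancel]
  refine ⟨fun l t => z₀ l + (t / S) • (zS - z₀ l), ?_, fun l => ?_,
    fun l i hi => absurd hi (Nat.not_lt_zero _),
    fun j _ => ⟨fun l _ => S⁻¹ • (zS j - z₀ l j), ?_, fun l t _ => ?_⟩,
    fun l j _ => congrFun (hend l) j, fun l => ?_⟩
  · simp only [Function.uncurry_def]
    fun_prop
  · simp only [zero_div, zero_smul, add_zero]
  · simp only [Function.uncurry_def]
    fun_prop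
  · rw [intervalIntegral.integral_const, sub_zero, smul_smul]
    rfl
  · rwa [hend, sub_self, norm_zero]

lemma SteeredUpTo.continuous_start {k : ℕ} (hZ : SteeredUpTo F S z₀ zS ε k Z) : Continuous z₀ :=
  (hZ.continuous.uncurry_right 0).congr hZ.start

variable {κ : Fin ν} {w : Λ → ℝ → Vec (m κ.succ)} {y : Λ → ℝ → Ext m}

lemma SteeredUpTo.norm_residual_le (hF : Continuous (Function.uncurry (extField F)))
    (hZ : SteeredUpTo F S z₀ zS ε κ.val Z) (hw : Continuous (Function.uncurry w))
    {q : Λ → ℝ → Vec (m κ.castSucc)} (hq : Continuous (Function.uncurry q)) {l : Λ} {t : ℝ}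
    (ht : t ∈ Icc 0 S) (hZq : Z l t κ.castSucc = z₀ l κ.castSucc + ∫ τ in (0 : ℝ)..t, q l τ)
    {a : ℝ} (ha : ‖∫ τ in (0 : ℝ)..t, (response F κ Z (l, τ) (w l τ) - q l τ)‖ ≤ a) :
    ‖maskDatum κ (z₀ l) (splice κ (Z l) (w l)) t +
      (∫ τ in (0 : ℝ)..t, maskField F κ τ (splice κ (Z l) (w l) τ)) -
      splice κ (Z l) (w l) t‖ ≤ a := by
  have hρ : Continuous (splice κ (Z l) (w l)) :=
    (continuous_splice hZ.continuous hw).uncurry_left l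
  refine norm_residual_splice_le hF hρ (fun i hi => hZ.solves l i hi t ht) ?_
  have hvel : Continuous fun τ => extField F τ (splice κ (Z l) (w l) τ) κ :=
    (continuous_apply κ).comp (continuous_comp_graph hF hρ)
  simp only [response_apply_eq_extField_splice] at ha
  rwa [hZq, add_sub_add_left_eq_sub, ← intervalIntegral.integral_sub
    (hvel.intervalIntegrable _ _) ((hq.uncurry_left l).intervalIntegrable _ _)]

lemma SteeredUpTo.succ_of_solvesVolterra (hF : Continuous (Function.uncurry (extField F)))
    (hS : 0 ≤ S) (hlip : LipschitzOnBalls (extField F) S)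
    (hZ : SteeredUpTo F S z₀ zS ε κ.val Z) (hw : Continuous (Function.uncurry w))
    (hw0 : ∀ l, w l 0 = Z l 0 κ.succ) (hwS : ∀ l, w l S = Z l S κ.succ)
    {p : Λ → ℝ → Vec (m κ.succ)} (hp : Continuous (Function.uncurry p))
    (hwp : ∀ l, ∀ t ∈ Icc 0 S, w l t = w l 0 + ∫ τ in (0 : ℝ)..t, p l τ)
    (hy : ∀ l, Continuous (y l))
    (hys : ∀ l, SolvesVolterra (maskField F κ) S
      (maskDatum κ (z₀ l) (splice κ (Z l) (w l))) (y l))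
    (hyρ : ∀ l, ∀ t ∈ Icc 0 S, ‖y l t - splice κ (Z l) (w l) t‖ ≤ δ) :
    SteeredUpTo F S z₀ zS (ε + δ) (κ.val + 1) fun l t => y l (projIcc 0 S hS t) := by
  have hproj (l : Λ) {t : ℝ} (ht : t ∈ Icc 0 S) : y l (projIcc 0 S hS t) = y l t := by
    rw [projIcc_of_mem hS ht]
  have hS₀ : S ∈ Icc 0 S := right_mem_Icc.2 hS
  have hρ0 (l : Λ) : splice κ (Z l) (w l) 0 = z₀ l :=
    (splice_of_eq (hw0 l)).trans (hZ.start l)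
  refine ⟨continuous_solvesVolterra (continuous_maskField hF κ) hS
      (lipschitzOnBalls_maskField hlip κ)
      (continuous_maskDatum κ hZ.continuous_start (continuous_splice hZ.continuous hw)) hy hys,
    fun l => ?_, fun l i hi t ht => ?_, fun j hj => ?_, fun l j hj => ?_, fun l => ?_⟩
  · rw [hproj l (left_mem_Icc.2 hS), hys l 0 (left_mem_Icc.2 hS), intervalIntegral.integral_same,
      add_zero, maskDatum_of_eq (hρ0 l)]
  · rw [hproj l ht, (hys l).apply_castSucc hF (hy l) ht (Nat.lt_succ_iff.1 hi)]
    congr 1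
    refine intervalIntegral.integral_congr fun τ hτ => ?_
    rw [uIcc_of_le ht.1] at hτ
    simp only [hproj l ⟨hτ.1, hτ.2.trans ht.2⟩]
  · obtain rfl : j = κ.succ := Fin.ext hj
    refine ⟨p, hp, fun l t ht => ?_⟩
    rw [hproj l ht, (hys l).apply_of_lt hF (hy l) ht Fin.castSucc_lt_succ, splice_succ, hwp l t ht,
      hw0, hZ.start]
  · rw [hproj l hS₀, (hys l).apply_of_lt hF (hy l) hS₀ (Fin.lt_def.2 (Nat.lt_of_succ_le hj)),
      splice_of_eq (hwS l)]
    exact hZ.terminal l j (Nat.le_of_succ_le hj)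
  · rw [hproj l hS₀, ← sub_add_sub_cancel (y l S) (Z l S) zS, add_comm ε]
    exact norm_add_le_of_le (splice_of_eq (hwS l) ▸ hyρ l S hS₀) (hZ.near l)

variable [SecondCountableTopology Λ]

theorem SteeredUpTo.exists_succ [Nonempty Λ] (hF : Continuous (Function.uncurry (extField F)))
    (hS : 0 < S) (hlip : LipschitzOnBalls (extField F) S)
    (hsurj : ∀ t y, Function.Surjective (F κ t y)) (hδ : 0 < δ)
    (hZ : SteeredUpTo F S z₀ zS ε κ.val Z) :
    ∃ Z', SteeredUpTo F S z₀ zS (ε + δ) (κ.val + 1) Z' := by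
  obtain ⟨q, hq, hZq⟩ := hZ.primitive κ.castSucc rfl
  obtain ⟨R, hR⟩ := exists_chattering (continuous_response hF κ hZ.continuous)
    (fun p => hsurj _ _) hq (ℓ := fun l t => Z l t κ.succ)
    ((continuous_apply κ.succ).comp hZ.continuous) hS
  obtain ⟨RZ, hRZ⟩ := exists_continuous_of_eventually_forall_ge_prod (Λ := Λ)
    (isCompact_Icc (a := 0) (b := S)) (Q := fun p c => ‖Z p.1 p.2‖ ≤ c) fun p₀ =>
      ⟨‖Z p₀.1 p₀.2‖ + 1, ((hZ.continuous.norm.tendsto p₀).eventually_le_const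
        (lt_add_one _)).mono fun p hp c hc => hp.trans hc⟩
  obtain ⟨a, ha⟩ := (lipschitzOnBalls_maskField hlip κ).exists_continuous_residual_bound
    (continuous_maskField hF κ) hS.le (RZ + R) hδ
  obtain ⟨w, p, hw, hp, hwp⟩ := hR a fun l => (ha l).1
  have hρ : Continuous (Function.uncurry fun l => splice κ (Z l) (w l)) :=
    continuous_splice hZ.continuous hw
  have hexists (l : Λ) := (ha l).2 (splice κ (Z l) (w l))
    (maskDatum κ (z₀ l) (splice κ (Z l) (w l))) (hρ.uncurry_left l)
    ((continuous_maskDatum κ hZ.continuous_start hρ).uncurry_left l)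
    (fun t ht => norm_splice_le ((hRZ l).2 t ht _ le_rfl) ((hwp l).2.2 t ht).2.1)
    (fun t ht => hZ.norm_residual_le hF hw hq ht (hZq l t ht) ((hwp l).2.2 t ht).2.2)
  choose y hy hys hyρ using hexists
  exact ⟨_, hZ.succ_of_solvesVolterra hF hS.le hlip hw (fun l => (hwp l).1)
    (fun l => (hwp l).2.1) hp (fun l t ht => ((hwp l).2.2 t ht).1) hy hys hyρ⟩

theorem exists_approximate_steering [Nonempty Λ] (hF : Continuous (Function.uncurry (extField F)))
    (hS : 0 < S) (hlip : LipschitzOnBalls (extField F) S)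
    (hsurj : ∀ i t y, Function.Surjective (F i t y)) (hz₀ : Continuous z₀) (zS : Ext m)
    (hε : 0 < ε) : ∃ Z, SteeredUpTo F S z₀ zS ε ν Z := by
  have hstep : ∀ k ≤ ν, ∀ ε > 0, ∃ Z, SteeredUpTo F S z₀ zS ε k Z := by
    intro k
    induction k with
    | zero => exact fun _ ε hε => exists_steeredUpTo_zero F hS hz₀ zS (le_of_lt hε)
    | succ k ih =>
      intro hk ε hε
      obtain ⟨Z, hZ⟩ := ih (Nat.le_of_succ_le hk) (ε / 2) (half_pos hε)
      obtain ⟨Z', hZ'⟩ := SteeredUpTo.exists_succ (κ := ⟨k, hk⟩) hF hS hlip (hsurj _)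
        (half_pos hε) hZ
      exact ⟨Z', by rwa [add_halves] at hZ'⟩
  exact hstep ν le_rfl ε hε

end Steering

/-! ### Linear control systems -/

section Linear

variable {E : Type*} [NormedAddCommGroup E] [NormedSpace ℝ E] {S : ℝ}

lemma exists_forall_lipschitzWith_apply {A : ℝ → E →L[ℝ] E} (hA : Continuous A) (S : ℝ) :
    ∃ L : ℝ≥0, ∀ t ∈ Icc 0 S, LipschitzWith L (A t) := by
  obtain ⟨L, hL⟩ := isCompact_Icc.exists_bound_of_continuousOn (s := Icc 0 S) hA.continuousOn
  refine ⟨L.toNNReal, fun t ht => (A t).lipschitz.weaken ?_⟩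
  exact NNReal.le_toNNReal_of_coe_le (hL t ht)

lemma lipschitzOnBalls_apply {A : ℝ → E →L[ℝ] E} (hA : Continuous A) (S : ℝ) :
    LipschitzOnBalls (fun t x => A t x) S := fun _ =>
  (exists_forall_lipschitzWith_apply hA S).imp fun _ hL t ht => (hL t ht).lipschitzOnWith

lemma continuous_uncurry_apply {A : ℝ → E →L[ℝ] E} (hA : Continuous A) :
    Continuous (Function.uncurry fun t x => A t x) :=
  (hA.comp continuous_fst).clm_apply continuous_snd

lemma exists_solvesVolterra_linear [CompleteSpace E] {A : ℝ → E →L[ℝ] E} (hA : Continuous A)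
    (hS : 0 ≤ S) {h : ℝ → E} (hh : Continuous h) :
    ∃ ξ : ℝ → E, Continuous ξ ∧ SolvesVolterra (fun t x => A t x) S h ξ :=
  (exists_forall_lipschitzWith_apply hA S).elim fun _ hL =>
    exists_solvesVolterra_of_lipschitzWith (continuous_uncurry_apply hA) hS hh hL

variable {X U : Type*} [NormedAddCommGroup X] [NormedSpace ℝ X] [NormedAddCommGroup U]
  [NormedSpace ℝ U] {A : ℝ → X →L[ℝ] X} {B : ℝ → U →L[ℝ] X} {δ : ℝ}

/-- `η` solves the adjoint equation `η̇ = -η A(t)` on `[0, δ]`. -/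
def SolvesAdjoint (A : ℝ → X →L[ℝ] X) (δ : ℝ) (η : ℝ → X →L[ℝ] ℝ) : Prop :=
  ∀ t ∈ Icc 0 δ, η t = η δ + ∫ τ in t..δ, (η τ).comp (A τ)

/-- The linear control system `ẋ = A(t) x + B(t) u` is observable in the dual sense on `[0, δ]`:
the only solution of the adjoint equation that annihilates all the `B(t)` is `0`. -/
def IsDuallyObservable (A : ℝ → X →L[ℝ] X) (B : ℝ → U →L[ℝ] X) (δ : ℝ) : Prop :=
  ∀ η : ℝ → X →L[ℝ] ℝ, Continuous η → SolvesAdjoint A δ η →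
    (∀ t ∈ Icc 0 δ, (η t).comp (B t) = 0) → η δ = 0

/-- The control `v` steers the linear control system `ẋ = A(t) x + B(t) u` from `0` at time `0`
along the trajectory `ξ` on `[0, δ]`. -/
structure SteersLinear (A : ℝ → X →L[ℝ] X) (B : ℝ → U →L[ℝ] X) (δ : ℝ) (v : ℝ → U)
    (ξ : ℝ → X) : Prop where
  continuous_control : Continuous v
  continuous_state : Continuous ξ
  solves : SolvesVolterra (fun t x => A t x) δ (fun t => ∫ τ in (0 : ℝ)..t, B τ (v τ)) ξ

lemma steersLinear_zero : SteersLinear A B δ 0 0 where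
  continuous_control := continuous_zero
  continuous_state := continuous_zero
  solves := fun t _ => by
    simp only [Pi.zero_apply, map_zero, intervalIntegral.integral_zero, add_zero]

lemma SteersLinear.add (hA : Continuous A) (hB : Continuous B) {v v' : ℝ → U} {ξ ξ' : ℝ → X}
    (h : SteersLinear A B δ v ξ) (h' : SteersLinear A B δ v' ξ') :
    SteersLinear A B δ (v + v') (ξ + ξ') where
  continuous_control := h.continuous_control.add h'.continuous_control
  continuous_state := h.continuous_state.add h'.continuous_state
  solves := fun t ht => by
    simp only [Pi.add_apply, map_add]
    rw [intervalIntegral.integral_add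
        ((hB.clm_apply h.continuous_control).intervalIntegrable _ _)
        ((hB.clm_apply h'.continuous_control).intervalIntegrable _ _),
      intervalIntegral.integral_add ((hA.clm_apply h.continuous_state).intervalIntegrable _ _)
        ((hA.clm_apply h'.continuous_state).intervalIntegrable _ _), add_add_add_comm]
    exact congrArg₂ _ (h.solves t ht) (h'.solves t ht)

lemma SteersLinear.smul {v : ℝ → U} {ξ : ℝ → X} (h : SteersLinear A B δ v ξ) (r : ℝ) :
    SteersLinear A B δ (r • v) (r • ξ) where
  continuous_control := h.continuous_control.const_smul r
  continuous_state := h.continuous_state.const_smul r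
  solves := fun t ht => by
    simp only [Pi.smul_apply, map_smul]
    rw [intervalIntegral.integral_smul, intervalIntegral.integral_smul, ← smul_add]
    exact congrArg (r • ·) (h.solves t ht)

/-- The states that the linear control system `ẋ = A(t) x + B(t) u` reaches from `0` at time `δ`. -/
def reachableSubmodule (hA : Continuous A) (hB : Continuous B) (δ : ℝ) : Submodule ℝ X where
  carrier := {z | ∃ v ξ, SteersLinear A B δ v ξ ∧ ξ δ = z}
  zero_mem' := ⟨0, 0, steersLinear_zero, rfl⟩
  add_mem' := by
    rintro _ _ ⟨v, ξ, h, rfl⟩ ⟨v', ξ', h', rfl⟩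
    exact ⟨v + v', ξ + ξ', h.add hA hB h', rfl⟩
  smul_mem' := by
    rintro r _ ⟨v, ξ, h, rfl⟩
    exact ⟨r • v, r • ξ, h.smul r, rfl⟩

lemma exists_solvesAdjoint (hA : Continuous A) (hδ : 0 ≤ δ) (p : X →L[ℝ] ℝ) :
    ∃ η : ℝ → X →L[ℝ] ℝ, Continuous η ∧ η δ = p ∧ SolvesAdjoint A δ η := by
  have hA' : Continuous fun s => (ContinuousLinearMap.compL ℝ X X ℝ).flip (A (δ - s)) :=
    (ContinuousLinearMap.continuous _).comp (hA.comp (continuous_const.sub continuous_id))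
  obtain ⟨ζ, hζ, hζs⟩ := exists_solvesVolterra_linear hA' hδ (h := fun _ => p) continuous_const
  have hζ0 : ζ 0 = p := by
    rw [hζs 0 (left_mem_Icc.2 hδ), intervalIntegral.integral_same, add_zero]
  refine ⟨fun t => ζ (δ - t), hζ.comp (continuous_const.sub continuous_id), ?_, fun t ht => ?_⟩
  · dsimp only
    rw [sub_self, hζ0]
  · have hreverse := intervalIntegral.integral_comp_sub_left (a := t) (b := δ)
      (fun τ => (ζ τ).comp (A (δ - τ))) δ
    simp only [sub_sub_cancel, sub_self] at hreverse
    dsimp only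
    rw [sub_self, hζ0, hreverse]
    exact hζs (δ - t) ⟨sub_nonneg.2 ht.2, sub_le_self δ ht.1⟩

lemma SolvesAdjoint.apply_eq_integral [CompleteSpace X] {η : ℝ → X →L[ℝ] ℝ}
    (hηs : SolvesAdjoint A δ η) (hη : Continuous η) (hA : Continuous A) (hB : Continuous B)
    (hδ : 0 ≤ δ) {v : ℝ → U} {ξ : ℝ → X} (h : SteersLinear A B δ v ξ) :
    η δ (ξ δ) = ∫ τ in (0 : ℝ)..δ, η τ (B τ (v τ)) := by
  have hBv : Continuous fun τ => B τ (v τ) := hB.clm_apply h.continuous_control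
  have hAξ : Continuous fun τ => A τ (ξ τ) := hA.clm_apply h.continuous_state
  have hηA : Continuous fun τ => (η τ).comp (A τ) := hη.clm_comp hA
  -- On `[0, δ]` these are `ξ` and `η`, but they are differentiable everywhere.
  let ξ' : ℝ → X := fun t => ∫ τ in (0 : ℝ)..t, (B τ (v τ) + A τ (ξ τ))
  let η' : ℝ → X →L[ℝ] ℝ := fun t => η δ + ∫ τ in t..δ, (η τ).comp (A τ)
  have hξ' : ∀ t ∈ Icc 0 δ, ξ' t = ξ t := fun t ht =>
    (intervalIntegral.integral_add (hBv.intervalIntegrable _ _)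
      (hAξ.intervalIntegrable _ _)).trans (h.solves t ht).symm
  have hη' : ∀ t ∈ Icc 0 δ, η' t = η t := fun t ht => (hηs t ht).symm
  have hderiv : ∀ t ∈ uIcc 0 δ, HasDerivAt (fun s => η' s (ξ' s)) (η t (B t (v t))) t := by
    intro t ht
    rw [uIcc_of_le hδ] at ht
    have hξd : HasDerivAt ξ' (B t (v t) + A t (ξ t)) t :=
      hasDerivAt_integral_of_continuous (hBv.add hAξ) 0 t
    have hηd : HasDerivAt η' (-(η t).comp (A t)) t :=
      (intervalIntegral.integral_hasDerivAt_left (hηA.intervalIntegrable _ _)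
        hηA.stronglyMeasurable.stronglyMeasurableAtFilter hηA.continuousAt).const_add _
    refine (hηd.clm_apply hξd).congr_deriv ?_
    rw [hξ' t ht, hη' t ht, map_add, neg_apply, ContinuousLinearMap.comp_apply]
    abel
  have hξ0 : ξ' 0 = 0 := intervalIntegral.integral_same
  rw [intervalIntegral.integral_eq_sub_of_hasDerivAt hderiv
    ((hη.clm_apply hBv).intervalIntegrable _ _), hξ0, map_zero, sub_zero,
    hξ' δ (right_mem_Icc.2 hδ), hη' δ (right_mem_Icc.2 hδ)]

lemma clm_eq_zero_of_forall_integral_eq_zero {C : ℝ → U →L[ℝ] ℝ} (hC : Continuous C) (hδ : 0 < δ)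
    (h : ∀ v : ℝ → U, Continuous v → ∫ τ in (0 : ℝ)..δ, C τ (v τ) = 0) {t : ℝ}
    (ht : t ∈ Icc 0 δ) : C t = 0 := by
  ext w
  by_contra hw
  have hCw : Continuous fun τ => C τ w := hC.clm_apply continuous_const
  have hzero := h (fun τ => C τ w • w) (hCw.smul continuous_const)
  simp only [map_smul, smul_eq_mul] at hzero
  have hpos : 0 < ∫ τ in (0 : ℝ)..δ, C τ w * C τ w :=
    intervalIntegral.integral_pos hδ (hCw.mul hCw).continuousOn (fun τ _ => mul_self_nonneg _)
      ⟨t, ht, mul_self_pos.2 hw⟩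
  exact hpos.ne' hzero

variable [FiniteDimensional ℝ X]

/-- A proper reachable subspace would lie in the kernel of a functional `p`; the solution of the
adjoint equation that ends at `p` then annihilates `B`. -/
theorem IsDuallyObservable.reachableSubmodule_eq_top (hobs : IsDuallyObservable A B δ)
    (hA : Continuous A) (hB : Continuous B) (hδ : 0 < δ) : reachableSubmodule hA hB δ = ⊤ := by
  have : CompleteSpace X := FiniteDimensional.complete ℝ X
  by_contra hne
  obtain ⟨p, hp, hker⟩ := Submodule.exists_le_ker_of_lt_top _ (lt_top_iff_ne_top.2 hne)
  obtain ⟨η, hη, hηδ, hηs⟩ := exists_solvesAdjoint hA hδ.le p.toContinuousLinearMap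
  have hηB : ∀ t ∈ Icc 0 δ, (η t).comp (B t) = 0 := fun t ht => by
    refine clm_eq_zero_of_forall_integral_eq_zero (hη.clm_comp hB) hδ (fun v hv => ?_) ht
    obtain ⟨ξ, hξ, hξs⟩ := exists_solvesVolterra_linear hA hδ.le
      (h := fun t => ∫ τ in (0 : ℝ)..t, B τ (v τ)) (intervalIntegral.continuous_primitive
        (fun _ _ => (hB.clm_apply hv).intervalIntegrable _ _) _)
    have hsteer : SteersLinear A B δ v ξ := ⟨hv, hξ, hξs⟩
    have hpξ : p (ξ δ) = 0 := hker ⟨v, ξ, hsteer, rfl⟩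
    simp only [ContinuousLinearMap.comp_apply]
    rw [← hηs.apply_eq_integral hη hA hB hδ.le hsteer, hηδ]
    exact hpξ
  refine hp (LinearMap.ext fun x => ?_)
  have hzero : p.toContinuousLinearMap = 0 := hηδ ▸ hobs η hη hηs hηB
  exact DFunLike.congr_fun hzero x

theorem IsDuallyObservable.exists_steersLinear_family (hobs : IsDuallyObservable A B δ)
    (hA : Continuous A) (hB : Continuous B) (hδ : 0 < δ) :
    ∃ (V : ℝ → X →L[ℝ] U) (W : ℝ → X →L[ℝ] X), Continuous V ∧ Continuous W ∧ ∀ c,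
      SteersLinear A B δ (fun t => V t c) (fun t => W t c) ∧ W δ c = c := by
  let b := Module.finBasis ℝ X
  have hreach (k) : b k ∈ reachableSubmodule hA hB δ :=
    hobs.reachableSubmodule_eq_top hA hB hδ ▸ Submodule.mem_top
  choose v ξ h hξ using hreach
  let p (k) : X →L[ℝ] ℝ := (b.coord k).toContinuousLinearMap
  have hsum (c : X) (s) : SteersLinear A B δ (∑ k ∈ s, p k c • v k) (∑ k ∈ s, p k c • ξ k) := by
    induction s using Finset.cons_induction with
    | empty => exact steersLinear_zero
    | cons k s hk ih =>
      simp only [Finset.sum_cons]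
      exact ((h k).smul (p k c)).add hA hB ih
  refine ⟨fun t => ∑ k, (p k).smulRight (v k t), fun t => ∑ k, (p k).smulRight (ξ k t),
    continuous_finsetSum _ fun k _ => ?_, continuous_finsetSum _ fun k _ => ?_,
    fun c => ⟨?_, ?_⟩⟩
  · exact (ContinuousLinearMap.smulRightL ℝ X U (p k)).continuous.comp (h k).continuous_control
  · exact (ContinuousLinearMap.smulRightL ℝ X X (p k)).continuous.comp (h k).continuous_state
  · convert hsum c Finset.univ using 1 <;> ext t <;>
      simp only [sum_apply, ContinuousLinearMap.smulRight_apply, Finset.sum_apply,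
        Pi.smul_apply]
  · simp only [sum_apply, ContinuousLinearMap.smulRight_apply, hξ]
    exact b.sum_repr c

end Linear

/-! ### Local steering of nonlinear systems -/

lemma exists_continuousOn_section {E F : Type*} [NormedAddCommGroup E] [NormedSpace ℝ E]
    [CompleteSpace E] [NormedAddCommGroup F] [NormedSpace ℝ F] [CompleteSpace F] {Φ : E → F}
    {D : E →L[ℝ] F} {a : E} (hΦ : HasStrictFDerivAt Φ D a) (hD : Function.Bijective D) :
    ∃ s ∈ 𝓝 (Φ a), ∃ σ : F → E, ContinuousOn σ s ∧ ∀ y ∈ s, Φ (σ y) = y := by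
  let D' := ContinuousLinearEquiv.ofBijective D (LinearMap.ker_eq_bot.2 hD.1)
    (LinearMap.range_eq_top.2 hD.2)
  have hΦ' : HasStrictFDerivAt Φ (D' : E →L[ℝ] F) a := hΦ
  let e := hΦ'.toOpenPartialHomeomorph Φ
  exact ⟨e.target, e.open_target.mem_nhds hΦ'.image_mem_toOpenPartialHomeomorph_target, e.symm,
    e.continuousOn_symm, fun y hy => e.right_inv hy⟩

section Superposition

variable {K Y Z : Type*} [TopologicalSpace K] [CompactSpace K]
  [NormedAddCommGroup Y] [NormedSpace ℝ Y] [NormedAddCommGroup Z] [NormedSpace ℝ Z]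

/-- Pointwise application of a continuous family of operators, the derivative of a superposition
operator. -/
noncomputable def pointwiseCLM (A : C(K, Y →L[ℝ] Z)) : C(K, Y) →L[ℝ] C(K, Z) :=
  LinearMap.mkContinuous
    { toFun w := ⟨fun t => A t (w t), A.continuous.clm_apply w.continuous⟩
      map_add' _ _ := ContinuousMap.ext fun t => map_add (A t) _ _
      map_smul' _ _ := ContinuousMap.ext fun t => map_smul (A t) _ _ }
    ‖A‖ fun w => (ContinuousMap.norm_le _ (by positivity)).2 fun t =>
      (A t).le_of_opNorm_le_of_le (A.norm_coe_le_norm t) (w.norm_coe_le_norm t)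

omit [CompactSpace K] [NormedSpace ℝ Y] [NormedSpace ℝ Z] in
/-- The superposition (Nemytskii) operator `w ↦ f (·, w ·)` of a continuous map `f`. -/
def superposition (f : C(K × Y, Z)) (w : C(K, Y)) : C(K, Z) :=
  f.comp ((ContinuousMap.id K).prodMk w)

theorem hasStrictFDerivAt_superposition {f : C(K × Y, Z)} {f' : C(K × Y, Y →L[ℝ] Z)}
    (hf : ∀ t y, HasFDerivAt (fun y => f (t, y)) (f' (t, y)) y) (w₀ : C(K, Y)) :
    HasStrictFDerivAt (superposition f) (pointwiseCLM (superposition f' w₀)) w₀ := by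
  rw [hasStrictFDerivAt_iff_isLittleO, Asymptotics.isLittleO_iff]
  intro ε hε
  have hnear : ∀ᶠ h in 𝓝 (0 : Y), ∀ t ∈ (univ : Set K),
      ‖f' (t, w₀ t + h) - f' (t, w₀ t)‖ < ε := by
    refine isCompact_univ.eventually_forall_of_forall_eventually fun t _ => ?_
    have hcont : Continuous fun q : Y × K => ‖f' (q.2, w₀ q.2 + q.1) - f' (q.2, w₀ q.2)‖ := by
      fun_prop
    exact hcont.continuousAt.eventually_lt continuousAt_const (by simpa using hε)
  obtain ⟨r, hr, hball⟩ := Metric.eventually_nhds_iff_ball.1 hnear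
  filter_upwards [prod_mem_nhds (Metric.ball_mem_nhds w₀ hr) (Metric.ball_mem_nhds w₀ hr)]
    with p hp
  refine (ContinuousMap.norm_le _ (by positivity)).2 fun t => ?_
  have hmem : ∀ w ∈ Metric.ball w₀ r, w t ∈ Metric.ball (w₀ t) r := fun w hw =>
    (ContinuousMap.dist_apply_le_dist t).trans_lt hw
  have hbound : ∀ y ∈ Metric.ball (w₀ t) r, ‖f' (t, y) - f' (t, w₀ t)‖ ≤ ε := fun y hy => by
    have hy' := hball (y - w₀ t) (by simpa [dist_eq_norm] using hy) t (mem_univ t)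
    rw [add_sub_cancel] at hy'
    exact hy'.le
  have hmean := (convex_ball (w₀ t) r).norm_image_sub_le_of_norm_hasFDerivWithin_le'
    (fun y _ => (hf t y).hasFDerivWithinAt) hbound (hmem _ hp.2) (hmem _ hp.1)
  exact hmean.trans (mul_le_mul_of_nonneg_left ((p.1 - p.2).norm_coe_le_norm t) hε.le)

end Superposition

section Shooting

variable {X U : Type*} [NormedAddCommGroup X] [NormedSpace ℝ X] [NormedAddCommGroup U]
  [NormedSpace ℝ U] {δ : ℝ}

/-- The primitive on `[0, δ]` that vanishes at `0`, as an operator on continuous functions. -/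
noncomputable def primitiveCLM (X : Type*) [NormedAddCommGroup X] [NormedSpace ℝ X] (hδ : 0 ≤ δ) :
    C(Icc 0 δ, X) →L[ℝ] C(Icc 0 δ, X) :=
  have hint (w : C(Icc 0 δ, X)) (a b : ℝ) :
      IntervalIntegrable (IccExtend hδ w) volume a b :=
    w.continuous.Icc_extend'.intervalIntegrable a b
  LinearMap.mkContinuous
    { toFun w := ⟨fun t => ∫ τ in (0 : ℝ)..t, IccExtend hδ w τ,
        (intervalIntegral.continuous_primitive (hint w) 0).comp continuous_subtype_val⟩
      map_add' w w' := ContinuousMap.ext fun _ =>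
        intervalIntegral.integral_add (hint w _ _) (hint w' _ _)
      map_smul' r _ := ContinuousMap.ext fun _ => intervalIntegral.integral_smul r _ }
    δ fun w => (ContinuousMap.norm_le _ (by positivity)).2 fun t => by
      refine (intervalIntegral.norm_integral_le_of_norm_le_const fun τ _ =>
        w.norm_coe_le_norm (projIcc 0 δ hδ τ)).trans ?_
      rw [sub_zero, abs_of_nonneg t.2.1, mul_comm]
      exact mul_le_mul_of_nonneg_right t.2.2 (norm_nonneg _)

lemma primitiveCLM_apply_of_eq (hδ : 0 ≤ δ) {w : C(Icc 0 δ, X)} {h : ℝ → X}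
    (hw : ∀ t : Icc 0 δ, w t = h t) (t : Icc 0 δ) :
    primitiveCLM X hδ w t = ∫ τ in (0 : ℝ)..t, h τ := by
  refine intervalIntegral.integral_congr fun τ hτ => ?_
  rw [uIcc_of_le t.2.1] at hτ
  rw [IccExtend_of_mem hδ w ⟨hτ.1, hτ.2.trans t.2.2⟩, hw]

/-- The map `(x, c) ↦ (x, V c)`, which inserts the controls `V c` with parameter `c` next to the
state `x`. -/
noncomputable def inputCLM (V : C(Icc 0 δ, X →L[ℝ] U)) :
    C(Icc 0 δ, X) × X →L[ℝ] C(Icc 0 δ, X × U) :=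
  ((ContinuousLinearMap.inl ℝ X U).compLeftContinuous ℝ (Icc 0 δ)).coprod
    ((pointwiseCLM ⟨fun t => (ContinuousLinearMap.inr ℝ X U).comp (V t),
      continuous_const.clm_comp V.continuous⟩).comp (ContinuousLinearMap.const ℝ (Icc 0 δ)))

lemma inputCLM_apply (V : C(Icc 0 δ, X →L[ℝ] U)) (p : C(Icc 0 δ, X) × X) (t : Icc 0 δ) :
    inputCLM V p t = (p.1 t, V t p.2) := by
  change (p.1 t, 0) + (0, V t p.2) = _
  rw [Prod.mk_add_mk, add_zero, zero_add]

/-- The shooting map sends a state `x` and a parameter `c` to the defect of `x` in the integral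
equation of `ẋ = f(t, x, us + V(t) c)` and to the terminal value `x(δ)`. -/
noncomputable def shootingMap (hδ : 0 ≤ δ) (f : C(Icc 0 δ × (X × U), X))
    (V : C(Icc 0 δ, X →L[ℝ] U)) (us : U) (p : C(Icc 0 δ, X) × X) : C(Icc 0 δ, X) × X :=
  (p.1 - primitiveCLM X hδ (superposition f (inputCLM V p + ContinuousMap.const _ (0, us))),
    p.1 ⟨δ, right_mem_Icc.2 hδ⟩)

/-- The derivative of the shooting map when `G` is the derivative of `f` along `(x, us + V c)`. -/
noncomputable def shootingDeriv (hδ : 0 ≤ δ) (G : C(Icc 0 δ, X × U →L[ℝ] X))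
    (V : C(Icc 0 δ, X →L[ℝ] U)) : C(Icc 0 δ, X) × X →L[ℝ] C(Icc 0 δ, X) × X :=
  (ContinuousLinearMap.fst ℝ _ _ -
    (primitiveCLM X hδ).comp ((pointwiseCLM G).comp (inputCLM V))).prod
    ((ContinuousMap.evalCLM ℝ (M := X) (⟨δ, right_mem_Icc.2 hδ⟩ : Icc 0 δ)).comp
      (ContinuousLinearMap.fst ℝ _ _))

lemma hasStrictFDerivAt_shootingMap (hδ : 0 ≤ δ) {f : C(Icc 0 δ × (X × U), X)}
    {f' : C(Icc 0 δ × (X × U), X × U →L[ℝ] X)}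
    (hf : ∀ t w, HasFDerivAt (fun w => f (t, w)) (f' (t, w)) w) (V : C(Icc 0 δ, X →L[ℝ] U))
    (us : U) (p : C(Icc 0 δ, X) × X) :
    HasStrictFDerivAt (shootingMap hδ f V us) (shootingDeriv hδ
      (superposition f' (inputCLM V p + ContinuousMap.const _ (0, us))) V) p := by
  have hinput := (inputCLM V).hasStrictFDerivAt (x := p).add_const (ContinuousMap.const _ (0, us))
  have heval := (ContinuousMap.evalCLM ℝ (M := X)
    (⟨δ, right_mem_Icc.2 hδ⟩ : Icc 0 δ)).hasStrictFDerivAt (x := p.1)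
  exact (hasStrictFDerivAt_fst.sub ((primitiveCLM X hδ).hasStrictFDerivAt.comp p
    ((hasStrictFDerivAt_superposition hf _).comp p hinput))).prodMk
    (heval.comp p hasStrictFDerivAt_fst)

lemma shootingMap_eq_iff (hδ : 0 ≤ δ) {f : C(Icc 0 δ × (X × U), X)} {V : C(Icc 0 δ, X →L[ℝ] U)}
    {us : U} {p q : C(Icc 0 δ, X) × X} {F : ℝ → X → X} {x h : ℝ → X}
    (hF : ∀ t : Icc 0 δ, f (t, p.1 t, us + V t p.2) = F t (x t)) (hx : ∀ t : Icc 0 δ, p.1 t = x t)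
    (hh : ∀ t : Icc 0 δ, q.1 t = h t) :
    shootingMap hδ f V us p = q ↔ SolvesVolterra F δ h x ∧ x δ = q.2 := by
  have hdefect (t : Icc 0 δ) : (shootingMap hδ f V us p).1 t = q.1 t ↔
      x t = h t + ∫ τ in (0 : ℝ)..t, F τ (x τ) := by
    have hprim := primitiveCLM_apply_of_eq hδ
      (h := fun τ => F τ (x τ))
      (w := superposition f (inputCLM V p + ContinuousMap.const _ (0, us))) (fun t => by
        rw [← hF t]
        change f (t, inputCLM V p t + (0, us)) = _
        rw [inputCLM_apply, Prod.mk_add_mk, add_zero, add_comm us]) t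
    rw [← hprim, ← hx, ← hh, ← sub_eq_iff_eq_add]
    rfl
  rw [Prod.ext_iff, ContinuousMap.ext_iff, forall_congr' hdefect, SetCoe.forall]
  exact and_congr_right' (by rw [← hx ⟨δ, right_mem_Icc.2 hδ⟩]; rfl)

lemma shootingDeriv_eq_iff (hδ : 0 ≤ δ) {G : C(Icc 0 δ, X × U →L[ℝ] X)}
    {V : C(Icc 0 δ, X →L[ℝ] U)} {p q : C(Icc 0 δ, X) × X} {F : ℝ → X → X} {x h : ℝ → X}
    (hF : ∀ t : Icc 0 δ, G t (p.1 t, V t p.2) = F t (x t)) (hx : ∀ t : Icc 0 δ, p.1 t = x t)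
    (hh : ∀ t : Icc 0 δ, q.1 t = h t) :
    shootingDeriv hδ G V p = q ↔ SolvesVolterra F δ h x ∧ x δ = q.2 := by
  rw [← shootingMap_eq_iff hδ (f := ⟨fun w => G w.1 w.2, by fun_prop⟩) (us := 0)
    (fun t => by rw [zero_add]; exact hF t) hx hh]
  have hzero : ContinuousMap.const (Icc 0 δ) ((0 : X), (0 : U)) = 0 := rfl
  rw [shootingMap, hzero, add_zero]
  rfl

variable {A : ℝ → X →L[ℝ] X} {B : ℝ → U →L[ℝ] X}

lemma IsDuallyObservable.smul_of_ne_zero (hobs : IsDuallyObservable A B δ) (hB : Continuous B)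
    (hδ : 0 < δ) {β : ℝ → ℝ} (hβ : ∀ t ∈ Ioo 0 δ, β t ≠ 0) :
    IsDuallyObservable A (fun t => β t • B t) δ := by
  refine fun η hη hηA hηB => hobs η hη hηA fun t ht => ?_
  have hinterior : EqOn (fun t => (η t).comp (B t)) (fun _ => 0) (Ioo 0 δ) := fun t ht => by
    have hβB := hηB t (Ioo_subset_Icc_self ht)
    rw [ContinuousLinearMap.comp_smul] at hβB
    exact (smul_eq_zero.1 hβB).resolve_left (hβ t ht)
  rw [← closure_Ioo hδ.ne] at ht
  exact hinterior.closure (hη.clm_comp hB) continuous_const ht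

lemma IsDuallyObservable.exists_steersLinear_family_vanishing_ends [FiniteDimensional ℝ X]
    (hobs : IsDuallyObservable A B δ) (hA : Continuous A) (hB : Continuous B) (hδ : 0 < δ) :
    ∃ (V : ℝ → X →L[ℝ] U) (W : ℝ → X →L[ℝ] X), Continuous V ∧ Continuous W ∧ V 0 = 0 ∧ V δ = 0 ∧
      ∀ c, SteersLinear A B δ (fun t => V t c) (fun t => W t c) ∧ W δ c = c := by
  let β : ℝ → ℝ := fun t => t * (δ - t)
  have hβ : Continuous β := continuous_id.mul (continuous_const.sub continuous_id)
  obtain ⟨V, W, hV, hW, hVW⟩ := (hobs.smul_of_ne_zero hB hδ (β := β)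
    fun t ht => (mul_pos ht.1 (sub_pos.2 ht.2)).ne').exists_steersLinear_family hA (hβ.smul hB) hδ
  refine ⟨fun t => β t • V t, W, hβ.smul hV, hW, by simp [β], by simp [β],
    fun c => ⟨⟨(hβ.smul hV).clm_apply continuous_const, hW.clm_apply continuous_const, ?_⟩,
      (hVW c).2⟩⟩
  simpa only [smul_apply, map_smul] using (hVW c).1.solves

variable {G : C(Icc 0 δ, X × U →L[ℝ] X)} {V : ℝ → X →L[ℝ] U} {W : ℝ → X →L[ℝ] X}

lemma SolvesVolterra.add_steersLinear {h ζ : ℝ → X} {v : ℝ → U} {ξ : ℝ → X}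
    (hζs : SolvesVolterra (fun t x => A t x) δ h ζ) (hξ : SteersLinear A B δ v ξ)
    (hA : Continuous A) (hB : Continuous B) (hζ : Continuous ζ) :
    SolvesVolterra (fun t x => A t x + B t (v t)) δ h (fun t => ζ t + ξ t) := fun t ht => by
  have hAζ : Continuous fun τ => A τ (ζ τ) := hA.clm_apply hζ
  have hAξ : Continuous fun τ => A τ (ξ τ) := hA.clm_apply hξ.continuous_state
  have hBv : Continuous fun τ => B τ (v τ) := hB.clm_apply hξ.continuous_control
  have hAsum : Continuous fun τ => A τ (ζ τ) + A τ (ξ τ) := hAζ.add hAξ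
  have hsplit : ∫ τ in (0 : ℝ)..t, (A τ (ζ τ + ξ τ) + B τ (v τ)) = (∫ τ in (0 : ℝ)..t, A τ (ζ τ)) +
      (∫ τ in (0 : ℝ)..t, A τ (ξ τ)) + ∫ τ in (0 : ℝ)..t, B τ (v τ) := by
    simp only [map_add]
    rw [intervalIntegral.integral_add (hAsum.intervalIntegrable _ _)
      (hBv.intervalIntegrable _ _), intervalIntegral.integral_add (hAζ.intervalIntegrable _ _)
      (hAξ.intervalIntegrable _ _)]
  dsimp only
  rw [hsplit, hζs t ht, hξ.solves t ht]
  abel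

/-- The linearized boundary value problem is solved by superposition: its state is the sum of the
response `ζ` to the defect and of the response to the control. -/
lemma shootingDeriv_eq_iff_eq_add [CompleteSpace X] (hδ : 0 ≤ δ) (hA : Continuous A)
    (hB : Continuous B) (hG : ∀ t : Icc 0 δ, G t = (A t).coprod (B t)) (hV : Continuous V)
    (hVW : ∀ c, SteersLinear A B δ (fun t => V t c) (fun t => W t c) ∧ W δ c = c)
    {p q : C(Icc 0 δ, X) × X} {ζ : ℝ → X} (hζ : Continuous ζ)
    (hζs : SolvesVolterra (fun t x => A t x) δ (IccExtend hδ q.1) ζ) :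
    shootingDeriv hδ G ⟨fun t => V t, hV.comp continuous_subtype_val⟩ p = q ↔
      (∀ t : Icc 0 δ, p.1 t = ζ t + W t p.2) ∧ ζ δ + p.2 = q.2 := by
  obtain ⟨hsteer, hWδ⟩ := hVW p.2
  let F : ℝ → X → X := fun t x => A t x + B t (V t p.2)
  have hF : Continuous (Function.uncurry F) :=
    (continuous_uncurry_apply hA).add
      ((hB.clm_apply hsteer.continuous_control).comp continuous_fst)
  have hlip : LipschitzOnBalls F δ := fun R => (lipschitzOnBalls_apply hA δ R).imp
    fun L hL t ht => by simpa only [LipschitzOnWith, F, edist_add_right] using hL t ht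
  have hsum : SolvesVolterra F δ (IccExtend hδ q.1) (fun t => ζ t + W t p.2) :=
    hζs.add_steersLinear hsteer hA hB hζ
  have hval (w : C(Icc 0 δ, X)) (t : Icc 0 δ) : w t = IccExtend hδ w t :=
    (IccExtend_val hδ w t).symm
  rw [shootingDeriv_eq_iff hδ (F := F) (fun t => by rw [hG, ← hval]; rfl) (hval p.1) (hval q.1)]
  have hstate : SolvesVolterra F δ (IccExtend hδ q.1) (IccExtend hδ p.1) ↔
      ∀ t : Icc 0 δ, p.1 t = ζ t + W t p.2 := by
    simp only [hval p.1]
    refine ⟨fun h t => h.eqOn hsum hF hlip p.1.continuous.Icc_extend'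
      (hζ.add hsteer.continuous_state) t.2, fun h => ?_⟩
    exact hsum.congr fun t ht => h ⟨t, ht⟩
  rw [hstate]
  refine and_congr_right fun h => ?_
  rw [← hval p.1 ⟨δ, right_mem_Icc.2 hδ⟩, h, hWδ]

lemma bijective_shootingDeriv [CompleteSpace X] (hδ : 0 ≤ δ) (hA : Continuous A)
    (hB : Continuous B) (hG : ∀ t : Icc 0 δ, G t = (A t).coprod (B t)) (hV : Continuous V)
    (hVW : ∀ c, SteersLinear A B δ (fun t => V t c) (fun t => W t c) ∧ W δ c = c) :
    Function.Bijective (shootingDeriv hδ G ⟨fun t => V t, hV.comp continuous_subtype_val⟩) := by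
  refine Function.bijective_iff_existsUnique _ |>.2 fun q => ?_
  obtain ⟨ζ, hζ, hζs⟩ := exists_solvesVolterra_linear hA hδ q.1.continuous.Icc_extend'
  have hx : Continuous fun t => ζ t + W t (q.2 - ζ δ) :=
    hζ.add (hVW (q.2 - ζ δ)).1.continuous_state
  refine ⟨(⟨fun t => ζ t + W t (q.2 - ζ δ), hx.comp continuous_subtype_val⟩, q.2 - ζ δ), ?_, ?_⟩
  · exact (shootingDeriv_eq_iff_eq_add hδ hA hB hG hV hVW hζ hζs).2
      ⟨fun _ => rfl, add_sub_cancel _ _⟩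
  · intro p hp
    obtain ⟨hstate, hparam⟩ := (shootingDeriv_eq_iff_eq_add hδ hA hB hG hV hVW hζ hζs).1 hp
    have hc : p.2 = q.2 - ζ δ := eq_sub_of_add_eq' hparam
    exact Prod.ext (ContinuousMap.ext fun t => (hstate t).trans (by rw [hc]; rfl)) hc

/-- `f` restricted to times in `[0, δ]`. -/
def restrictTime {Y Z : Type*} [TopologicalSpace Y] [TopologicalSpace Z] (δ : ℝ) {f : ℝ → Y → Z}
    (hf : Continuous (Function.uncurry f)) : C(Icc 0 δ × Y, Z) :=
  ⟨fun w => f w.1 w.2, hf.comp (continuous_subtype_val.prodMap continuous_id)⟩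

variable [FiniteDimensional ℝ X] {f : ℝ → X × U → X} {f' : ℝ → X × U → X × U →L[ℝ] X}

lemma exists_continuousOn_section_shootingMap (hf : Continuous (Function.uncurry f))
    (hf' : Continuous (Function.uncurry f')) (hd : ∀ t w, HasFDerivAt (f t) (f' t w) w)
    (hδ : 0 < δ) {xs : X} {us : U} {ξ : ℝ → X} (hξ : Continuous ξ)
    (hξs : SolvesVolterra (fun t x => f t (x, us)) δ (fun _ => xs) ξ) (hV : Continuous V)
    (hVW : ∀ c, SteersLinear (fun t => (f' t (ξ t, us)).comp (ContinuousLinearMap.inl ℝ X U))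
      (fun t => (f' t (ξ t, us)).comp (ContinuousLinearMap.inr ℝ X U)) δ
      (fun t => V t c) (fun t => W t c) ∧ W δ c = c) :
    ∃ r > 0, ∃ σ : X → C(Icc 0 δ, X) × X, ContinuousOn σ (Metric.ball (ξ δ) r) ∧
      ∀ z ∈ Metric.ball (ξ δ) r, shootingMap hδ.le (restrictTime δ hf)
        ⟨fun t => V t, hV.comp continuous_subtype_val⟩ us (σ z) =
          (ContinuousMap.const _ xs, z) := by
  have : CompleteSpace X := FiniteDimensional.complete ℝ X
  have hf'ξ : Continuous fun t => f' t (ξ t, us) :=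
    hf'.comp (continuous_id.prodMk (hξ.prodMk continuous_const))
  let p₀ : C(Icc 0 δ, X) × X := (⟨fun t => ξ t, hξ.comp continuous_subtype_val⟩, 0)
  let q (z : X) : C(Icc 0 δ, X) × X := (ContinuousMap.const _ xs, z)
  let VK : C(Icc 0 δ, X →L[ℝ] U) := ⟨fun t => V t, hV.comp continuous_subtype_val⟩
  let w₀ : C(Icc 0 δ, X × U) := inputCLM VK p₀ + ContinuousMap.const _ (0, us)
  have hw₀ (t : Icc 0 δ) : w₀ t = (ξ t, us) := by
    change inputCLM VK p₀ t + (0, us) = _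
    rw [inputCLM_apply, map_zero, Prod.mk_add_mk, add_zero, zero_add]
    rfl
  have hderiv := hasStrictFDerivAt_shootingMap hδ.le (f := restrictTime δ hf)
    (f' := restrictTime δ hf') (fun t w => hd t w) VK us p₀
  have hbij := bijective_shootingDeriv hδ.le (hf'ξ.clm_comp continuous_const)
    (hf'ξ.clm_comp continuous_const) (G := superposition (restrictTime δ hf') w₀)
    (fun t => by rw [ContinuousLinearMap.coprod_comp_inl_inr, ← hw₀]; rfl) hV hVW
  have hp₀ : shootingMap hδ.le (restrictTime δ hf) VK us p₀ = q (ξ δ) :=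
    (shootingMap_eq_iff hδ.le (fun t => by rw [map_zero, add_zero]; rfl) (fun _ => rfl)
      fun _ => rfl).2 ⟨hξs, rfl⟩
  obtain ⟨s, hs, σ, hσ, hσs⟩ := exists_continuousOn_section hderiv hbij
  have hq : Continuous q := Continuous.prodMk_right _
  rw [hp₀] at hs
  obtain ⟨r, hr, hball⟩ := Metric.mem_nhds_iff.1 (hq.continuousAt hs)
  exact ⟨r, hr, σ ∘ q, hσ.comp hq.continuousOn hball, fun z hz => hσs (q z) (hball hz)⟩

theorem exists_local_steering (hf : Continuous (Function.uncurry f))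
    (hf' : Continuous (Function.uncurry f')) (hd : ∀ t w, HasFDerivAt (f t) (f' t w) w)
    (hδ : 0 < δ) {xs : X} {us : U} {ξ : ℝ → X} (hξ : Continuous ξ)
    (hξs : SolvesVolterra (fun t x => f t (x, us)) δ (fun _ => xs) ξ)
    (hobs : IsDuallyObservable (fun t => (f' t (ξ t, us)).comp (ContinuousLinearMap.inl ℝ X U))
      (fun t => (f' t (ξ t, us)).comp (ContinuousLinearMap.inr ℝ X U)) δ) :
    ∃ r > 0, ∃ u : X → ℝ → U, ContinuousOn (Function.uncurry u) (Metric.ball (ξ δ) r ×ˢ univ) ∧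
      ∀ z ∈ Metric.ball (ξ δ) r, u z 0 = us ∧ u z δ = us ∧ ∃ x : ℝ → X, Continuous x ∧
        SolvesVolterra (fun t x => f t (x, u z t)) δ (fun _ => xs) x ∧ x δ = z := by
  have hf'ξ : Continuous fun t => f' t (ξ t, us) :=
    hf'.comp (continuous_id.prodMk (hξ.prodMk continuous_const))
  obtain ⟨V, W, hV, -, hV0, hVδ, hVW⟩ := hobs.exists_steersLinear_family_vanishing_ends
    (hf'ξ.clm_comp continuous_const) (hf'ξ.clm_comp continuous_const) hδ
  obtain ⟨r, hr, σ, hσ, hσs⟩ :=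
    exists_continuousOn_section_shootingMap hf hf' hd hδ hξ hξs hV hVW
  refine ⟨r, hr, fun z t => us + V t (σ z).2, ?_, fun z hz => ?_⟩
  · exact continuousOn_const.add ((hV.comp continuous_snd).continuousOn.clm_apply
      (continuous_snd.comp_continuousOn (hσ.comp continuousOn_fst fun p hp => hp.1)))
  · have hval (t : Icc 0 δ) : (σ z).1 t = IccExtend hδ.le (σ z).1 t := (IccExtend_val _ _ t).symm
    obtain ⟨hsolves, hend⟩ := (shootingMap_eq_iff hδ.le (F := fun t x => f t (x, us + V t (σ z).2))
      (h := fun _ => xs) (fun t => by rw [← hval]; rfl) hval fun _ => rfl).1 (hσs z hz)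
    refine ⟨by simp [hV0], by simp [hVδ], _, (σ z).1.continuous.Icc_extend', hsolves, hend⟩

end Shooting

/-! ### Observability of triangular systems -/

section Split

variable {ν : ℕ} {m : Fin (ν + 1) → ℕ}

/-- The separation of all blocks `(x_1, …, x_ν, x_{ν+1})` into the state and the control. -/
def splitCLM (m : Fin (ν + 1) → ℕ) : Ext m →L[ℝ] State m × Control m :=
  (ContinuousLinearMap.pi fun i : Fin ν =>
    ContinuousLinearMap.proj (φ := fun j => Vec (m j)) i.castSucc).prod
    (ContinuousLinearMap.proj (Fin.last ν))

lemma splitCLM_apply (z : Ext m) :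
    splitCLM m z = ((fun i : Fin ν => z i.castSucc : State m), z (Fin.last ν)) := rfl

lemma splitCLM_single_castSucc (i : Fin ν) (v : Vec (m i.castSucc)) :
    splitCLM m (Pi.single i.castSucc v) = (Pi.single i v, 0) := by
  refine Prod.ext (funext fun j => ?_) ?_
  · by_cases hj : j = i
    · subst hj; simp [splitCLM_apply]
    · simp [splitCLM_apply, hj]
  · simp [splitCLM_apply]

lemma splitCLM_single_last (v : Control m) : splitCLM m (Pi.single (Fin.last ν) v) = (0, v) :=
  Prod.ext (funext fun j => by simp [splitCLM_apply]) (by simp [splitCLM_apply])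

/-- The tuple of all blocks made of a state and a control, inverse to `splitCLM`. -/
def join (x : State m) (u : Control m) : Ext m := Fin.snoc (α := fun j => Vec (m j)) x u

@[simp]
lemma join_castSucc (x : State m) (u : Control m) (i : Fin ν) : join x u i.castSucc = x i :=
  Fin.snoc_castSucc (α := fun j => Vec (m j)) _ _ _

@[simp]
lemma join_last (x : State m) (u : Control m) : join x u (Fin.last ν) = u :=
  Fin.snoc_last (α := fun j => Vec (m j)) _ _

lemma splitCLM_join (x : State m) (u : Control m) : splitCLM m (join x u) = (x, u) := by
  simp [splitCLM_apply]

lemma join_splitCLM (z : Ext m) : join (splitCLM m z).1 (splitCLM m z).2 = z :=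
  Fin.snoc_init_self (α := fun j => Vec (m j)) z

lemma continuous_join : Continuous fun p : State m × Control m => join p.1 p.2 :=
  continuous_fst.finSnoc (A := fun j => Vec (m j)) continuous_snd

lemma extField_join (F : Components m) (t : ℝ) (x : State m) (u : Control m) :
    extField F t (join x u) = field F t x u := by
  funext i
  simp only [extField, join_castSucc]
  rfl

lemma extField_eq_field (F : Components m) (t : ℝ) (z : Ext m) :
    extField F t z = field F t (splitCLM m z).1 (splitCLM m z).2 := by
  rw [← extField_join, join_splitCLM]

end Split

lemma lipschitzOnBalls_of_hasFDerivAt {E E' : Type*} [NormedAddCommGroup E] [NormedSpace ℝ E]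
    [ProperSpace E] [NormedAddCommGroup E'] [NormedSpace ℝ E'] {f : ℝ → E → E'}
    {f' : ℝ → E → E →L[ℝ] E'} (hf' : Continuous (Function.uncurry f'))
    (hd : ∀ t x, HasFDerivAt (f t) (f' t x) x) (S : ℝ) : LipschitzOnBalls f S := by
  intro R
  obtain ⟨L, hL⟩ := ((isCompact_Icc (a := 0) (b := S)).prod
    (isCompact_closedBall (0 : E) R)).exists_bound_of_continuousOn hf'.continuousOn
  refine ⟨L.toNNReal, fun t ht => ?_⟩
  exact (convex_closedBall (0 : E) R).lipschitzOnWith_of_nnnorm_hasFDerivWithin_le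
    (fun x _ => (hd t x).hasFDerivWithinAt)
    fun x hx => NNReal.le_toNNReal_of_coe_le (hL (t, x) ⟨ht, hx⟩)

lemma isOpen_setOf_surjective {𝕜 E G : Type*} [NontriviallyNormedField 𝕜] [CompleteSpace 𝕜]
    [NormedAddCommGroup E] [NormedSpace 𝕜 E] [NormedAddCommGroup G] [NormedSpace 𝕜 G]
    [FiniteDimensional 𝕜 G] : IsOpen {L : E →L[𝕜] G | Function.Surjective L} := by
  have : CompleteSpace G := FiniteDimensional.complete 𝕜 G
  refine isOpen_iff_mem_nhds.2 fun L hL => ?_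
  obtain ⟨R, hR⟩ := L.toLinearMap.exists_rightInverse_of_surjective (LinearMap.range_eq_top.2 hL)
  have hLR : L.comp R.toContinuousLinearMap = 1 :=
    ContinuousLinearMap.ext fun v => LinearMap.congr_fun hR v
  have hunit : ∀ᶠ M in 𝓝 L, IsUnit (M.comp R.toContinuousLinearMap) :=
    (continuous_id.clm_comp continuous_const).continuousAt.eventually
      (Units.isOpen.mem_nhds (show IsUnit (L.comp _) from hLR ▸ isUnit_one))
  filter_upwards [hunit] with M hM
  exact Function.Surjective.of_comp (g := R) (ContinuousLinearMap.isUnit_iff_bijective.1 hM).2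

lemma SolvesAdjoint.map_apply_eq_zero {X : Type*} [NormedAddCommGroup X] [NormedSpace ℝ X]
    {A : ℝ → X →L[ℝ] X} {δ : ℝ} {η : ℝ → X →L[ℝ] ℝ} (h : SolvesAdjoint A δ η) (hA : Continuous A)
    (hη : Continuous η) (hδ : 0 < δ) {x : X} (hx : ∀ t ∈ Icc 0 δ, η t x = 0) {t : ℝ}
    (ht : t ∈ Icc 0 δ) : η t (A t x) = 0 := by
  have hint (s : ℝ) (hs : s ∈ Icc 0 δ) : ∫ τ in s..δ, η τ (A τ x) = 0 := by
    have := congr($(h s hs) x)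
    rw [add_apply, hx s hs, hx δ (right_mem_Icc.2 hδ.le), zero_add,
      ContinuousLinearMap.intervalIntegral_apply
        ((hη.clm_comp hA).intervalIntegrable _ _)] at this
    exact this.symm
  have hcont : Continuous fun τ => η τ (A τ x) := hη.clm_apply (hA.clm_apply continuous_const)
  have hderiv : HasDerivWithinAt (fun s => ∫ τ in s..δ, η τ (A τ x)) (-η t (A t x)) (Icc 0 δ) t :=
    (intervalIntegral.integral_hasDerivAt_left (hcont.intervalIntegrable _ _)
      hcont.stronglyMeasurable.stronglyMeasurableAtFilter hcont.continuousAt).hasDerivWithinAt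
  exact neg_eq_zero.1 ((uniqueDiffOn_Icc hδ t ht).eq_deriv _ hderiv
    ((hasDerivWithinAt_const t _ (0 : ℝ)).congr hint (hint t ht)))

section Triangular

variable {ν : ℕ} {m : Fin (ν + 1) → ℕ} {F : Components m}
  {D : ℝ → State m × Control m → (State m × Control m →L[ℝ] State m)}

/-- A right-hand side of triangular form that is continuous, with a continuous total derivative
`D` in the state and the control, at all times. -/
structure HasContDeriv (F : Components m)
    (D : ℝ → State m × Control m → (State m × Control m →L[ℝ] State m)) : Prop where
  continuous_field : Continuous (Function.uncurry fun t (w : State m × Control m) =>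
    field F t w.1 w.2)
  continuous_deriv : Continuous (Function.uncurry D)
  hasFDerivAt : ∀ t w, HasFDerivAt (fun w : State m × Control m => field F t w.1 w.2) (D t w) w

namespace HasContDeriv

lemma continuous_extField (h : HasContDeriv F D) :
    Continuous (Function.uncurry (extField F)) := by
  simp only [Function.uncurry_def, extField_eq_field]
  exact h.continuous_field.comp (by fun_prop :
    Continuous fun p : ℝ × Ext m => (p.1, splitCLM m p.2))

lemma hasFDerivAt_extField (h : HasContDeriv F D) (t : ℝ) (z : Ext m) :
    HasFDerivAt (extField F t) ((D t (splitCLM m z)).comp (splitCLM m)) z := by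
  rw [funext (extField_eq_field F t)]
  exact (h.hasFDerivAt t (splitCLM m z)).comp z (splitCLM m).hasFDerivAt

lemma lipschitzOnBalls_extField (h : HasContDeriv F D) (S : ℝ) :
    LipschitzOnBalls (extField F) S :=
  lipschitzOnBalls_of_hasFDerivAt
    (f' := fun t z => (D t (splitCLM m z)).comp (splitCLM m))
    ((h.continuous_deriv.comp (by fun_prop :
      Continuous fun p : ℝ × Ext m => (p.1, splitCLM m p.2))).clm_comp continuous_const)
    h.hasFDerivAt_extField S

lemma continuous_uncurry_field (h : HasContDeriv F D) {u : ℝ → Control m} (hu : Continuous u) :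
    Continuous (Function.uncurry fun t x => field F t x (u t)) :=
  h.continuous_field.comp
    (continuous_fst.prodMk (continuous_snd.prodMk (hu.comp continuous_fst)))

lemma lipschitzOnBalls_field (h : HasContDeriv F D) {u : ℝ → Control m} (hu : Continuous u)
    (S : ℝ) : LipschitzOnBalls (fun t x => field F t x (u t)) S := by
  refine lipschitzOnBalls_of_hasFDerivAt
    (f' := fun t x => (D t (x, u t)).comp (ContinuousLinearMap.inl ℝ (State m) (Control m)))
    ((h.continuous_deriv.comp (by fun_prop : Continuous fun p : ℝ × State m =>
      (p.1, (p.2, u p.1)))).clm_comp continuous_const) (fun t x => ?_) S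
  exact HasFDerivAt.comp (g := fun w : State m × Control m => field F t w.1 w.2)
    (f := fun x => (x, u t)) x (h.hasFDerivAt t (x, u t)) (hasFDerivAt_prodMk_left x (u t))

lemma hasFDerivAt_extField_update (h : HasContDeriv F D) (t : ℝ) (z : Ext m) (k : Fin (ν + 1))
    (i : Fin ν) :
    HasFDerivAt (fun v => extField F t (Function.update z k v) i)
      ((ContinuousLinearMap.proj i).comp (((D t (splitCLM m z)).comp (splitCLM m)).comp
        (ContinuousLinearMap.single ℝ _ k))) (z k) := by
  have hsingle : ContinuousLinearMap.pi (Pi.single k (ContinuousLinearMap.id ℝ (Vec (m k)))) =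
      ContinuousLinearMap.single ℝ (fun j => Vec (m j)) k := by
    refine ContinuousLinearMap.ext fun v => funext fun j => ?_
    rcases eq_or_ne j k with rfl | hj
    · simp
    · simp [hj]
  have hfield := h.hasFDerivAt_extField t (Function.update z k (z k))
  have hupdate := (hasFDerivAt_apply (𝕜 := ℝ) i _).comp _
    (hfield.comp (z k) (hasFDerivAt_update z (z k)))
  rwa [Function.update_eq_self, hsingle] at hupdate

lemma deriv_single_eq_zero (h : HasContDeriv F D) (t : ℝ) (z : Ext m) {k : Fin (ν + 1)}
    {i : Fin ν} (hk : i.succ < k) (v : Vec (m k)) :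
    D t (splitCLM m z) (splitCLM m (Pi.single k v)) i = 0 := by
  have hconst : (fun v => extField F t (Function.update z k v) i) = fun _ => extField F t z i :=
    funext fun v => extField_congr F t fun j hj => Function.update_of_ne (hj.trans_lt hk).ne _ _
  have hderiv := h.hasFDerivAt_extField_update t z k i
  rw [hconst] at hderiv
  exact congr($(hderiv.unique (hasFDerivAt_const _ _)) v)

lemma deriv_single_succ (h : HasContDeriv F D) (t : ℝ) (z : Ext m) (i : Fin ν)
    (v : Vec (m i.succ)) :
    D t (splitCLM m z) (splitCLM m (Pi.single i.succ v)) i =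
      fderiv ℝ (F i t fun j => z j.1.castSucc) (z i.succ) v := by
  have hupdate : (fun v => extField F t (Function.update z i.succ v) i) =
      F i t fun j => z j.1.castSucc := by
    funext v
    simp only [extField, Function.update_self]
    congr 1
    funext j
    exact Function.update_of_ne (((Fin.castSucc_le_castSucc_iff.2 j.2).trans_lt
      i.castSucc_lt_succ).ne) _ _
  have hderiv := h.hasFDerivAt_extField_update t z i.succ i
  rw [hupdate] at hderiv
  exact congr($hderiv.fderiv v).symm

lemma continuous_fderiv_block (h : HasContDeriv F D) {ζ : ℝ → Ext m} (hζ : Continuous ζ)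
    (i : Fin ν) :
    Continuous fun t => fderiv ℝ (F i t fun j => ζ t j.1.castSucc) (ζ t i.succ) := by
  have hblock (t : ℝ) : fderiv ℝ (F i t fun j => ζ t j.1.castSucc) (ζ t i.succ) =
      (ContinuousLinearMap.proj i).comp (((D t (splitCLM m (ζ t))).comp (splitCLM m)).comp
        (ContinuousLinearMap.single ℝ (fun j => Vec (m j)) i.succ)) :=
    ContinuousLinearMap.ext fun v => (h.deriv_single_succ t (ζ t) i v).symm
  simp only [hblock]
  exact continuous_const.clm_comp (((h.continuous_deriv.comp (by fun_prop :
    Continuous fun t : ℝ => (t, splitCLM m (ζ t)))).clm_comp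
    continuous_const).clm_comp continuous_const)

lemma map_single_eq_zero (h : HasContDeriv F D) {t : ℝ} {z : Ext m} {k : Fin ν}
    (hsurj : Function.Surjective (fderiv ℝ (F k t fun j => z j.1.castSucc) (z k.succ)))
    {p : State m →L[ℝ] ℝ} (hp : ∀ i, k < i → ∀ v, p (Pi.single i v) = 0)
    (hpD : ∀ w, p (D t (splitCLM m z) (splitCLM m (Pi.single k.succ w))) = 0)
    (v : Vec (m k.castSucc)) : p (Pi.single k v) = 0 := by
  obtain ⟨w, rfl⟩ := hsurj v
  have hsum := hpD w
  rw [← Finset.univ_sum_single (D t _ _), map_sum, Finset.sum_eq_single k,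
    h.deriv_single_succ] at hsum
  · exact hsum
  · intro j _ hj
    rcases lt_or_gt_of_ne hj with hj | hj
    · rw [h.deriv_single_eq_zero _ _ (Fin.succ_lt_succ_iff.2 hj), Pi.single_zero, map_zero]
    · exact hp j hj _
  · simp

theorem isDuallyObservable (h : HasContDeriv F D) {δ : ℝ} (hδ : 0 < δ) {ζ : ℝ → Ext m}
    (hζ : Continuous ζ)
    (hsurj : ∀ i : Fin ν, ∀ t ∈ Icc 0 δ, Function.Surjective
      (fderiv ℝ (F i t fun j => ζ t j.1.castSucc) (ζ t i.succ))) :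
    IsDuallyObservable
      (fun t => (D t (splitCLM m (ζ t))).comp (ContinuousLinearMap.inl ℝ (State m) (Control m)))
      (fun t => (D t (splitCLM m (ζ t))).comp (ContinuousLinearMap.inr ℝ (State m) (Control m)))
      δ := by
  intro η hη hadj hB
  have hD : Continuous fun t => D t (splitCLM m (ζ t)) :=
    h.continuous_deriv.comp (continuous_id.prodMk ((splitCLM m).continuous.comp hζ))
  -- Downward induction on the block: once `η` kills the blocks after `k`, its product with
  -- `D` applied to the block `k + 1` only involves `∂f_k/∂x_{k+1}`.
  have hvanish (k : Fin (ν + 1)) :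
      (∀ i : Fin ν, k ≤ i.castSucc → ∀ t ∈ Icc 0 δ, ∀ v, η t (Pi.single i v) = 0) ∧
      ∀ t ∈ Icc 0 δ, ∀ v, η t (D t (splitCLM m (ζ t)) (splitCLM m (Pi.single k v))) = 0 := by
    induction k using Fin.reverseInduction with
    | last =>
      refine ⟨fun i hi => absurd hi (not_le.2 (Fin.castSucc_lt_last i)), fun t ht v => ?_⟩
      rw [splitCLM_single_last]
      exact congr($(hB t ht) v)
    | cast k ih =>
      have hlater (i : Fin ν) (hi : k < i) : ∀ t ∈ Icc 0 δ, ∀ v, η t (Pi.single i v) = 0 :=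
        ih.1 i (Fin.succ_le_castSucc_iff.2 hi)
      have hk : ∀ t ∈ Icc 0 δ, ∀ v, η t (Pi.single k v) = 0 := fun t ht =>
        h.map_single_eq_zero (hsurj k t ht) (fun i hi => hlater i hi t ht) (ih.2 t ht)
      refine ⟨fun i hi => ?_, fun t ht v => ?_⟩
      · rcases (Fin.castSucc_le_castSucc_iff.1 hi).eq_or_lt with rfl | hi
        · exact hk
        · exact hlater i hi
      · rw [splitCLM_single_castSucc]
        exact hadj.map_apply_eq_zero (hD.clm_comp continuous_const) hη hδ
          (fun t ht => hk t ht v) ht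
  refine ContinuousLinearMap.ext fun x => ?_
  rw [← Finset.univ_sum_single x, map_sum]
  exact Finset.sum_eq_zero fun i _ => (hvanish 0).1 i (Fin.zero_le _) δ (right_mem_Icc.2 hδ.le) _

lemma exists_local_steering (h : HasContDeriv F D) {xs : State m} {us : Control m}
    (hrank : ∀ i : Fin ν, Function.Surjective
      (fderiv ℝ (F i 0 (head xs i)) (next xs us i))) {S : ℝ} (hS : 0 < S) :
    ∃ δ ∈ Ioo 0 S, ∃ x₁ : State m, ∃ r > 0, ∃ u : State m → ℝ → Control m,
      ContinuousOn (Function.uncurry u) (Metric.ball x₁ r ×ˢ univ) ∧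
      ∀ z ∈ Metric.ball x₁ r, u z 0 = us ∧ u z δ = us ∧ ∃ x : ℝ → State m, Continuous x ∧
        SolvesVolterra (fun t x => field F t x (u z t)) δ (fun _ => xs) x ∧ x δ = z := by
  have hus : Continuous fun _ : ℝ => us := continuous_const
  obtain ⟨δ₀, hδ₀, ξ, hξ, hξs⟩ := (h.lipschitzOnBalls_field hus S).exists_short_solvesVolterra
    (h.continuous_uncurry_field hus) hS xs
  have hξ0 : ξ 0 = xs := by simpa using hξs 0 (left_mem_Icc.2 hδ₀.1.le)
  have hζ : Continuous fun t => join (ξ t) us := continuous_join.comp (hξ.prodMk hus)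
  have hnear : ∀ᶠ t in 𝓝 (0 : ℝ), ∀ i : Fin ν, Function.Surjective
      (fderiv ℝ (F i t fun j => join (ξ t) us j.1.castSucc) (join (ξ t) us i.succ)) := by
    refine eventually_all.2 fun i => (h.continuous_fderiv_block hζ i).continuousAt.eventually
      (isOpen_setOf_surjective.mem_nhds ?_)
    simp only [join_castSucc, hξ0]
    exact hrank i
  obtain ⟨ε, hε, hball⟩ := Metric.eventually_nhds_iff_ball.1 hnear
  obtain ⟨δ, hδ, hδmin⟩ := exists_between (lt_min hδ₀.1 hε)
  obtain ⟨hδδ₀, hδε⟩ := lt_min_iff.1 hδmin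
  have hsurj : ∀ i : Fin ν, ∀ t ∈ Icc 0 δ, Function.Surjective
      (fderiv ℝ (F i t fun j => join (ξ t) us j.1.castSucc) (join (ξ t) us i.succ)) := by
    refine fun i t ht => hball t ?_ i
    rw [Metric.mem_ball, Real.dist_eq, sub_zero, abs_of_nonneg ht.1]
    exact ht.2.trans_lt hδε
  have hobs := h.isDuallyObservable hδ hζ hsurj
  simp only [splitCLM_join] at hobs
  obtain ⟨r, hr, u, hu, hsteer⟩ := TriangularControl.exists_local_steering h.continuous_field
    h.continuous_deriv h.hasFDerivAt hδ hξ (hξs.mono hδδ₀.le) hobs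
  exact ⟨δ, ⟨hδ, hδδ₀.trans_le hδ₀.2⟩, ξ δ, r, hr, u, hu, hsteer⟩

end HasContDeriv

end Triangular

/-! ### Exact steering of triangular systems -/

section Glue

variable {E : Type*} [NormedAddCommGroup E] [NormedSpace ℝ E] {H : ℝ → E → E} {S δ : ℝ}

lemma SolvesVolterra.congr_rhs {H' : ℝ → E → E} {c y : ℝ → E} (hy : SolvesVolterra H S c y)
    (hH : ∀ t ∈ Icc 0 S, H t (y t) = H' t (y t)) : SolvesVolterra H' S c y := by
  intro t ht
  rw [hy t ht]
  congr 1
  refine intervalIntegral.integral_congr fun τ hτ => hH τ ?_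
  rw [uIcc_of_le ht.1] at hτ
  exact ⟨hτ.1, hτ.2.trans ht.2⟩

lemma SolvesVolterra.reverse_eq {b : E} {y : ℝ → E} (hH : Continuous (Function.uncurry H))
    (hy : Continuous y) (hys : SolvesVolterra (fun t z => -H (S - t) z) (S - δ) (fun _ => b) y)
    {t : ℝ} (ht : t ∈ Icc δ S) :
    y (S - t) = y (S - δ) + ∫ τ in δ..t, H τ (y (S - τ)) := by
  have hcont : Continuous fun τ => -H (S - τ) (y τ) :=
    (hH.comp ((continuous_const.sub continuous_id).prodMk hy)).neg
  have hsub : ∫ τ in δ..t, H τ (y (S - τ)) = -∫ τ in (S - t)..(S - δ), -H (S - τ) (y τ) := by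
    rw [← intervalIntegral.integral_comp_sub_left (fun τ => -H (S - τ) (y τ)),
      ← intervalIntegral.integral_neg]
    simp only [sub_sub_cancel, neg_neg]
  rw [hsub, hys (S - t) ⟨sub_nonneg.2 ht.2, sub_le_sub_left ht.1 S⟩,
    hys (S - δ) ⟨sub_nonneg.2 (ht.1.trans ht.2), le_rfl⟩,
    ← intervalIntegral.integral_add_adjacent_intervals
      (hcont.intervalIntegrable 0 (S - t)) (hcont.intervalIntegrable (S - t) (S - δ))]
  abel

lemma SolvesVolterra.glue {a : E} {x z : ℝ → E} (hH : Continuous (Function.uncurry H))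
    (hx : Continuous x) (hz : Continuous z) (hδ : 0 ≤ δ) (hxs : SolvesVolterra H δ (fun _ => a) x)
    (hzs : ∀ t ∈ Icc δ S, z t = z δ + ∫ τ in δ..t, H τ (z τ)) (hxz : x δ = z δ) :
    Continuous (fun t => if t ≤ δ then x t else z t) ∧
      SolvesVolterra H S (fun _ => a) fun t => if t ≤ δ then x t else z t := by
  set y : ℝ → E := fun t => if t ≤ δ then x t else z t
  have hyx : EqOn y x (Iic δ) := fun t ht => if_pos ht
  have hyz : EqOn y z (Ici δ) := fun t ht => by
    rcases (mem_Ici.1 ht).eq_or_lt with rfl | ht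
    · rw [hyx self_mem_Iic, hxz]
    · exact if_neg ht.not_ge
  have hy : Continuous y := hx.if_le hz continuous_id continuous_const
    fun t (ht : t = δ) => ht ▸ hxz
  have hint : ∀ a b, IntervalIntegrable (fun τ => H τ (y τ)) volume a b :=
    (continuous_comp_graph hH hy).intervalIntegrable
  have hys : SolvesVolterra H δ (fun _ => a) y := hxs.congr (hyx.mono fun t ht => ht.2)
  refine ⟨hy, fun t ht => ?_⟩
  rcases le_total t δ with htδ | hδt
  · exact hys t ⟨ht.1, htδ⟩
  · have hzy : ∫ τ in δ..t, H τ (z τ) = ∫ τ in δ..t, H τ (y τ) :=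
      intervalIntegral.integral_congr fun τ hτ => by
        rw [uIcc_of_le hδt] at hτ
        simp only [hyz hτ.1]
    rw [hyz hδt, hzs t ⟨hδt, ht.2⟩, hzy, ← hyz self_mem_Ici, hys δ ⟨hδ, le_rfl⟩, add_assoc,
      intervalIntegral.integral_add_adjacent_intervals (hint 0 δ) (hint δ t)]

end Glue

section Reparam

variable {ν : ℕ} {m : Fin (ν + 1) → ℕ} {F : Components m}
  {D : ℝ → State m × Control m → (State m × Control m →L[ℝ] State m)}

/-- The right-hand side of triangular form `σ • f(c(t), x, u)`, which results from a change of
time. -/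
def reparam (F : Components m) (σ : ℝ) (c : ℝ → ℝ) : Components m :=
  fun i t y v => σ • F i (c t) y v

lemma field_reparam (F : Components m) (σ : ℝ) (c : ℝ → ℝ) (t : ℝ) (x : State m) (u : Control m) :
    field (reparam F σ c) t x u = σ • field F (c t) x u := rfl

lemma HasContDeriv.reparam (h : HasContDeriv F D) (σ : ℝ) {c : ℝ → ℝ} (hc : Continuous c) :
    HasContDeriv (reparam F σ c) fun t w => σ • D (c t) w where
  continuous_field := (h.continuous_field.comp (by fun_prop :
    Continuous fun p : ℝ × (State m × Control m) => (c p.1, p.2))).const_smul σ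
  continuous_deriv := (h.continuous_deriv.comp (by fun_prop :
    Continuous fun p : ℝ × (State m × Control m) => (c p.1, p.2))).const_smul σ
  hasFDerivAt t w := (h.hasFDerivAt (c t) w).const_smul σ

lemma surjective_reparam {σ : ℝ} {c : ℝ → ℝ} {i : Fin ν} {t : ℝ} {y : Head m i} (hσ : σ ≠ 0)
    (hF : Function.Surjective (F i (c t) y)) : Function.Surjective (reparam F σ c i t y) :=
  (MulAction.surjective₀ hσ).comp hF

end Reparam

section Steering

variable {ν : ℕ} {m : Fin (ν + 1) → ℕ} {F : Components m}
  {D : ℝ → State m × Control m → (State m × Control m →L[ℝ] State m)}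

namespace HasContDeriv

lemma exists_approximate_steering (h : HasContDeriv F D)
    (hsurj : ∀ i t y, Function.Surjective (F i t y)) (x₁ : State m) (us : Control m) {S ε : ℝ}
    (hS : 0 < S) (hε : 0 < ε) :
    ∃ (y : State m → ℝ → State m) (v : State m → ℝ → Control m),
      Continuous (Function.uncurry y) ∧ Continuous (Function.uncurry v) ∧
      ∀ l, SolvesVolterra (fun t x => field F t x (v l t)) S (fun _ => l) (y l) ∧
        v l S = us ∧ ‖y l S - x₁‖ ≤ ε := by
  obtain ⟨Z, hZ⟩ := TriangularControl.exists_approximate_steering h.continuous_extField hS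
    (h.lipschitzOnBalls_extField S) hsurj (z₀ := fun l : State m => join l us)
    (continuous_join.comp (Continuous.prodMk_left us)) (join x₁ us) hε
  have hsplit : Continuous fun p : State m × ℝ => splitCLM m (Z p.1 p.2) :=
    (splitCLM m).continuous.comp hZ.continuous
  refine ⟨fun l t => (splitCLM m (Z l t)).1, fun l t => (splitCLM m (Z l t)).2,
    hsplit.fst, hsplit.snd, fun l => ⟨fun t ht => funext fun i => ?_, ?_, ?_⟩⟩
  · have hcont : Continuous fun τ => field F τ (splitCLM m (Z l τ)).1 (splitCLM m (Z l τ)).2 :=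
      h.continuous_field.comp
        (continuous_id.prodMk (hsplit.comp (Continuous.prodMk_right l)))
    have hsolves := hZ.solves l i i.2 t ht
    simp only [join_castSucc, extField_eq_field] at hsolves
    rwa [Pi.add_apply, integral_pi_apply hcont]
  · exact (hZ.terminal l (Fin.last ν) le_rfl).trans (join_last x₁ us)
  · refine (pi_norm_le_iff_of_nonneg hε.le).2 fun i => ?_
    have hi := (norm_le_pi_norm (Z l S - join x₁ us) i.castSucc).trans (hZ.near l)
    rwa [Pi.sub_apply, join_castSucc] at hi

/- The approximate steering runs backward in time from the target at time `S` to the points near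
the end of a short reference trajectory, which the local steering reaches exactly. -/
theorem exists_steering (h : HasContDeriv F D)
    (hsurj : ∀ i t y, Function.Surjective (F i t y)) {xs : State m} {us : Control m}
    (hrank : ∀ i : Fin ν, Function.Surjective
      (fderiv ℝ (F i 0 (head xs i)) (next xs us i))) {S : ℝ} (hS : 0 < S) :
    ∃ (u : State m → ℝ → Control m) (x : State m → ℝ → State m),
      Continuous (Function.uncurry u) ∧ ∀ l, u l 0 = us ∧ Continuous (x l) ∧
        SolvesVolterra (fun t x => field F t x (u l t)) S (fun _ => xs) (x l) ∧ x l S = l := by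
  obtain ⟨δ, hδ, x₁, r, hr, w, hw, hloc⟩ := h.exists_local_steering hrank hS
  obtain ⟨y, v, hy, hv, hback⟩ :=
    (h.reparam (-1) (c := fun t => S - t) (by fun_prop)).exists_approximate_steering
      (fun i t y => surjective_reparam (by norm_num) (hsurj i (S - t) y)) x₁ us
      (sub_pos.2 hδ.2) (half_pos hr)
  choose hys hvδ hyδ using hback
  have hball (l : State m) : y l (S - δ) ∈ Metric.ball x₁ r :=
    mem_ball_iff_norm.2 ((hyδ l).trans_lt (half_lt_self hr))
  choose hw0 hwδ x hx hxs hxδ using fun l => hloc _ (hball l)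
  let u : State m → ℝ → Control m := fun l t => if t ≤ δ then w (y l (S - δ)) t else v l (S - t)
  have hu : Continuous (Function.uncurry u) := by
    refine Continuous.if_le (f := fun p : State m × ℝ => p.2) (g := fun _ => δ)
      (f' := fun p => w (y p.1 (S - δ)) p.2) (g' := fun p => v p.1 (S - p.2)) ?_ ?_
      continuous_snd continuous_const fun p (hp : p.2 = δ) => by simp only [hp, hwδ, hvδ]
    · exact hw.comp_continuous ((hy.comp (continuous_fst.prodMk continuous_const)).prodMk
        continuous_snd) fun p => ⟨hball p.1, mem_univ _⟩
    · exact hv.comp (by fun_prop : Continuous fun p : State m × ℝ => (p.1, S - p.2))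
  refine ⟨u, fun l t => if t ≤ δ then x l t else y l (S - t), hu, fun l => ?_⟩
  have hu_le (t : ℝ) (ht : t ≤ δ) : u l t = w (y l (S - δ)) t := if_pos ht
  have hu_ge (t : ℝ) (ht : δ ≤ t) : u l t = v l (S - t) := by
    rcases ht.eq_or_lt with rfl | ht
    · rw [hu_le δ le_rfl, hwδ, hvδ]
    · exact if_neg ht.not_ge
  have hH : Continuous (Function.uncurry fun t x => field F t x (u l t)) :=
    h.continuous_uncurry_field (hu.comp (Continuous.prodMk_right l))
  have hyl : SolvesVolterra (fun t x => -field F (S - t) x (u l (S - t))) (S - δ) (fun _ => l)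
      (y l) := (hys l).congr_rhs fun t ht => by
    rw [field_reparam, neg_one_smul, hu_ge (S - t) (by linarith [ht.2]), sub_sub_cancel]
  have hglue := SolvesVolterra.glue (S := S) hH (hx l)
    ((hy.comp (Continuous.prodMk_right l)).comp (continuous_const.sub continuous_id)) hδ.1.le
    ((hxs l).congr_rhs fun t ht => by rw [hu_le t ht.2])
    (fun t ht => hyl.reverse_eq hH (hy.comp (Continuous.prodMk_right l)) ht) (hxδ l)
  refine ⟨(hu_le 0 hδ.1.le).trans (hw0 l), hglue.1, hglue.2, ?_⟩
  simpa [hδ.2.not_ge] using hys l 0 (left_mem_Icc.2 (sub_nonneg.2 hδ.2.le))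

end HasContDeriv

end Steering

/-! ### Change of time -/

section TimeChange

variable {a τ t s : ℝ}

/-- The affine change of time that takes the time `a` to `0` and the time `τ` to `1`, inverse to
`AffineMap.lineMap a τ`. -/
noncomputable def normalizedTime (a τ s : ℝ) : ℝ := (s - a) / (τ - a)

lemma normalizedTime_left (a τ : ℝ) : normalizedTime a τ a = 0 := by simp [normalizedTime]

lemma normalizedTime_right (h : τ ≠ a) : normalizedTime a τ τ = 1 := div_self (sub_ne_zero.2 h)

lemma normalizedTime_lineMap (h : τ ≠ a) (t : ℝ) :
    normalizedTime a τ (AffineMap.lineMap a τ t) = t := by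
  rw [normalizedTime, AffineMap.lineMap_apply_ring', add_sub_cancel_right,
    mul_div_cancel_right₀ _ (sub_ne_zero.2 h)]

lemma lineMap_normalizedTime (h : τ ≠ a) (s : ℝ) :
    AffineMap.lineMap a τ (normalizedTime a τ s) = s := by
  rw [normalizedTime, AffineMap.lineMap_apply_ring', div_mul_cancel₀ _ (sub_ne_zero.2 h),
    sub_add_cancel]

lemma lineMap_mem_uIcc (ht : t ∈ Icc (0 : ℝ) 1) : AffineMap.lineMap a τ t ∈ uIcc a τ := by
  rw [← segment_eq_uIcc, segment_eq_image_lineMap]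
  exact mem_image_of_mem _ ht

lemma normalizedTime_mem_Icc (h : τ ≠ a) (hs : s ∈ uIcc a τ) :
    normalizedTime a τ s ∈ Icc (0 : ℝ) 1 := by
  rw [← segment_eq_uIcc, segment_eq_image_lineMap] at hs
  obtain ⟨t, ht, rfl⟩ := hs
  rwa [normalizedTime_lineMap h]

lemma continuous_normalizedTime (a τ : ℝ) : Continuous (normalizedTime a τ) :=
  (continuous_id.sub continuous_const).div_const _

lemma hasDerivAt_normalizedTime (a τ s : ℝ) :
    HasDerivAt (normalizedTime a τ) (τ - a)⁻¹ s := by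
  rw [← one_div]
  exact ((hasDerivAt_id s).sub_const a).div_const (τ - a)

variable {ν : ℕ} {m : Fin (ν + 1) → ℕ} {f : ℝ → State m → Control m → State m}
  {u : ℝ → Control m} {J : Set ℝ}

lemma isSolution_comp_normalizedTime (h : τ ≠ a) (hJ : J = uIcc a τ) {x : ℝ → State m}
    (hx : ∀ t ∈ Icc (0 : ℝ) 1, HasDerivWithinAt x
      ((τ - a) • f (AffineMap.lineMap a τ t) (x t) (u t)) (Icc 0 1) t) :
    IsSolution f J (fun s => u (normalizedTime a τ s)) a (x 0) (x ∘ normalizedTime a τ) := by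
  subst hJ
  refine ⟨by rw [Function.comp_apply, normalizedTime_left], fun s => ?_⟩
  have hcomp := (hx _ (normalizedTime_mem_Icc h s.2)).scomp (s : ℝ)
    (hasDerivAt_normalizedTime a τ s).hasDerivWithinAt fun s hs => normalizedTime_mem_Icc h hs
  rwa [lineMap_normalizedTime h, inv_smul_smul₀ (sub_ne_zero.2 h)] at hcomp

lemma IsSolution.hasDerivWithinAt_comp_lineMap (h : τ ≠ a) (hJ : J = uIcc a τ) {ξ : State m}
    {y : ℝ → State m} (hy : IsSolution f J (fun s => u (normalizedTime a τ s)) a ξ y)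
    (ht : t ∈ Icc (0 : ℝ) 1) :
    HasDerivWithinAt (fun t => y (AffineMap.lineMap a τ t))
      ((τ - a) • f (AffineMap.lineMap a τ t) (y (AffineMap.lineMap a τ t)) (u t)) (Icc 0 1) t := by
  subst hJ
  have hcomp := (hy.hasDerivWithinAt ⟨_, lineMap_mem_uIcc ht⟩).scomp t
    (AffineMap.hasDerivAt_lineMap (a := a) (b := τ)).hasDerivWithinAt
    fun t ht => lineMap_mem_uIcc ht
  simp only [normalizedTime_lineMap h] at hcomp
  exact hcomp

lemma trajectoryReaches_of_hasDerivWithinAt (h : τ ≠ a) (hJ : J = uIcc a τ)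
    {g : ℝ → State m → State m} (hg : LipschitzOnBalls g 1)
    (hgf : ∀ t ∈ Icc (0 : ℝ) 1, ∀ x, g t x = (τ - a) • f (AffineMap.lineMap a τ t) x (u t))
    {x : ℝ → State m} (hx : ∀ t ∈ Icc (0 : ℝ) 1, HasDerivWithinAt x (g t (x t)) (Icc 0 1) t) :
    TrajectoryReaches f J (fun s => u (normalizedTime a τ s)) a (x 0) τ (x 1) := by
  refine ⟨x ∘ normalizedTime a τ,
    isSolution_comp_normalizedTime h hJ fun t ht => hgf t ht (x t) ▸ hx t ht, fun y hy => ?_,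
    by rw [Function.comp_apply, normalizedTime_right h]⟩
  have hy' (t : ℝ) (ht : t ∈ Icc (0 : ℝ) 1) := hy.hasDerivWithinAt_comp_lineMap h hJ ht
  have hunique : EqOn (fun t => y (AffineMap.lineMap a τ t)) x (Icc 0 1) :=
    hg.eqOn_of_hasDerivWithinAt_sub (fun t ht => (hy' t ht).continuousWithinAt)
      (fun t ht => (hx t ht).continuousWithinAt)
      (fun t ht => (hgf t ht _ ▸ hy' t ht).sub (hx t ht))
      (by simpa only [AffineMap.lineMap_apply_zero] using hy.initial)
  intro s hs
  have hys := hunique (normalizedTime_mem_Icc h (hJ ▸ hs))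
  simp only [lineMap_normalizedTime h] at hys
  exact hys

end TimeChange

section Families

variable {ν : ℕ} {m : Fin (ν + 1) → ℕ} {F : Components m}

lemma ConditionI.exists_hasContDeriv_reparam {t₀ T : ℝ} (hI : ConditionI t₀ T (field F))
    (σ : ℝ) {c : ℝ → ℝ} (hc : Continuous c) (hcI : ∀ t, c t ∈ Icc t₀ T) :
    ∃ D, HasContDeriv (reparam F σ c) D := by
  have hq : Continuous fun p : ℝ × (State m × Control m) => (c p.1, p.2) := by fun_prop
  have hmem (p : ℝ × (State m × Control m)) : (c p.1, p.2) ∈ Icc t₀ T ×ˢ univ :=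
    ⟨hcI p.1, mem_univ _⟩
  have hstate := hI.continuousOn_deriv_state.comp_continuous hq hmem
  have hcontrol := hI.continuousOn_deriv_control.comp_continuous hq hmem
  refine ⟨fun t w => σ • (fderiv ℝ (fun x => field F (c t) x w.2) w.1).coprod
      (fderiv ℝ (fun u => field F (c t) w.1 u) w.2),
    (hI.continuousOn.comp_continuous hq hmem).const_smul σ, ?_, fun t w => ?_⟩
  · simp only [Function.uncurry_def, ← ContinuousLinearMap.comp_fst_add_comp_snd]
    exact ((hstate.clm_comp continuous_const).add (hcontrol.clm_comp continuous_const)).const_smul σ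
  · have ht : Continuous fun w : State m × Control m => (t, w) := Continuous.prodMk_right t
    exact (hasStrictFDerivAt_uncurry_coprod (𝕜 := ℝ) (u := w) (f := field F (c t))
      (f₁ := fun x u => fderiv ℝ (fun x => field F (c t) x u) x)
      (f₂ := fun x u => fderiv ℝ (fun u => field F (c t) x u) u)
      (.of_forall fun v => (hI.differentiable_state _ (hcI t) v.2 v.1).hasFDerivAt)
      (.of_forall fun v => (hI.differentiable_control _ (hcI t) v.1 v.2).hasFDerivAt)
      (hstate.comp ht).continuousAt (hcontrol.comp ht).continuousAt).hasFDerivAt.const_smul σ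

lemma HasFullRanks.surjective {t₁ : ℝ} {xs : State m} {us : Control m}
    (h : HasFullRanks F t₁ xs us) (i : Fin ν) :
    Function.Surjective (fderiv ℝ (F i t₁ (head xs i)) (next xs us i)) :=
  LinearMap.range_eq_top.1 (Submodule.eq_top_of_finrank_eq (by simp [h i]))

lemma HasFullRanks.surjective_reparam {xs : State m} {us : Control m} {σ : ℝ} {c : ℝ → ℝ} {t : ℝ}
    (h : HasFullRanks F (c t) xs us) (hσ : σ ≠ 0) (i : Fin ν) :
    Function.Surjective (fderiv ℝ (reparam F σ c i t (head xs i)) (next xs us i)) := by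
  have hsmul : reparam F σ c i t (head xs i) = σ • F i (c t) (head xs i) := rfl
  rw [hsmul, fderiv_const_smul_field]
  exact (MulAction.surjective₀ hσ).comp (h.surjective i)

theorem exists_steering_family {t₀ T t₁ τ : ℝ} (hI : ConditionI t₀ T (field F))
    (hsurj : ∀ i : Fin ν, ∀ t ∈ Icc t₀ T, ∀ y, Function.Surjective (F i t y))
    {xs : State m} {us : Control m} (hrank : HasFullRanks F t₁ xs us) (hτ : τ ≠ t₁) {J : Set ℝ}
    (hJ : J = uIcc t₁ τ) (hJT : J ⊆ Icc t₀ T) :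
    ∃ U : C(State m, C(J, Control m)), ∀ l, (∀ h : t₁ ∈ J, U l ⟨t₁, h⟩ = us) ∧
      TrajectoryReaches (field F) J (U l) t₁ xs τ l := by
  let c : ℝ → ℝ := fun t => AffineMap.lineMap t₁ τ (projIcc (0 : ℝ) 1 zero_le_one t : ℝ)
  have hc : Continuous c := AffineMap.lineMap_continuous.comp
    (continuous_subtype_val.comp continuous_projIcc)
  have hcT (t : ℝ) : c t ∈ Icc t₀ T := hJT (hJ ▸ lineMap_mem_uIcc (projIcc _ _ _ t).2)
  have hct (t : ℝ) (ht : t ∈ Icc (0 : ℝ) 1) : c t = AffineMap.lineMap t₁ τ t := by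
    simp only [c, projIcc_of_mem zero_le_one ht]
  have hc0 : c 0 = t₁ := by rw [hct 0 unitInterval.zero_mem, AffineMap.lineMap_apply_zero]
  obtain ⟨D, hD⟩ := hI.exists_hasContDeriv_reparam (τ - t₁) hc hcT
  obtain ⟨u, x, hu, hux⟩ := hD.exists_steering
    (fun i t y => surjective_reparam (sub_ne_zero.2 hτ) (hsurj i _ (hcT t) y))
    (HasFullRanks.surjective_reparam (hc0.symm ▸ hrank) (sub_ne_zero.2 hτ)) one_pos
  refine ⟨ContinuousMap.curry ⟨fun p => u p.1 (normalizedTime t₁ τ p.2),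
    hu.comp (continuous_fst.prodMk ((continuous_normalizedTime t₁ τ).comp
      (continuous_subtype_val.comp continuous_snd)))⟩, fun l => ?_⟩
  obtain ⟨hu0, hx, hxs, hx1⟩ := hux l
  have hul : Continuous (u l) := hu.comp (Continuous.prodMk_right l)
  have hx0 : x l 0 = xs := by simpa using hxs 0 unitInterval.zero_mem
  refine ⟨fun _ => ?_, ?_⟩
  · exact (congrArg (u l) (normalizedTime_left t₁ τ)).trans hu0
  · have hreach := trajectoryReaches_of_hasDerivWithinAt (f := field F) hτ hJ
      (hD.lipschitzOnBalls_field hul 1)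
      (fun t ht x => by rw [field_reparam, hct t ht])
      (fun t ht => hxs.hasDerivWithinAt (continuous_comp_graph (hD.continuous_uncurry_field hul) hx)
        ht)
    rwa [hx0, hx1] at hreach

end Families

end TriangularControl

theorem theorem2p1_general {ν : ℕ} (m : Fin (ν + 1) → ℕ) (t₀ T t₁ : ℝ) (ht₁ : t₁ ∈ Set.Ioo t₀ T)
    (F : TriangularControl.Components m)
    (hI : TriangularControl.ConditionI t₀ T (TriangularControl.field F))
    (hsurj : ∀ i : Fin ν, ∀ t ∈ Set.Icc t₀ T, ∀ y : TriangularControl.Head m i,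
      Function.Surjective (F i t y))
    (xs : TriangularControl.State m) (us : TriangularControl.Control m)
    (hrank : TriangularControl.HasFullRanks F t₁ xs us) :
    ∃ (ubar : C(TriangularControl.State m, C(Set.Icc t₁ T, TriangularControl.Control m)))
      (utilde : C(TriangularControl.State m, C(Set.Icc t₀ t₁, TriangularControl.Control m))),
      (∀ x0 xT : TriangularControl.State m,
        utilde x0 ⟨t₁, Set.right_mem_Icc.mpr ht₁.1.le⟩ = us ∧
        ubar xT ⟨t₁, Set.left_mem_Icc.mpr ht₁.2.le⟩ = us) ∧
      (∀ xT : TriangularControl.State m,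
        TriangularControl.TrajectoryReaches (TriangularControl.field F)
          (Set.Icc t₁ T) (ubar xT) t₁ xs T xT) ∧
      (∀ x0 : TriangularControl.State m,
        TriangularControl.TrajectoryReaches (TriangularControl.field F)
          (Set.Icc t₀ t₁) (utilde x0) t₁ xs t₀ x0) := by
  obtain ⟨ubar, hbar⟩ := TriangularControl.exists_steering_family hI hsurj hrank ht₁.2.ne'
    (Set.uIcc_of_le ht₁.2.le).symm (Set.Icc_subset_Icc_left ht₁.1.le)
  obtain ⟨utilde, htilde⟩ := TriangularControl.exists_steering_family hI hsurj hrank ht₁.1.ne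
    (Set.uIcc_of_ge ht₁.1.le).symm (Set.Icc_subset_Icc_right ht₁.2.le)
  exact ⟨ubar, utilde, fun x0 xT => ⟨(htilde x0).1 _, (hbar xT).1 _⟩, fun xT => (hbar xT).2,
    fun x0 => (htilde x0).2⟩

theorem theorem2p1 {ν : ℕ} (m : Fin (ν + 1) → ℕ) (hm : ∀ i : Fin ν, m i.castSucc ≤ m i.succ)
    (t₀ T t₁ : ℝ) (ht₁ : t₁ ∈ Set.Ioo t₀ T)
    (F : TriangularControl.Components m)
    (hI : TriangularControl.ConditionI t₀ T (TriangularControl.field F))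
    (hII : TriangularControl.ConditionII t₀ T F)
    (xs : TriangularControl.State m) (us : TriangularControl.Control m)
    (hrank : TriangularControl.HasFullRanks F t₁ xs us) :
    ∃ (ubar : C(TriangularControl.State m, C(Set.Icc t₁ T, TriangularControl.Control m)))
      (utilde : C(TriangularControl.State m, C(Set.Icc t₀ t₁, TriangularControl.Control m))),
      (∀ x0 xT : TriangularControl.State m,
        utilde x0 ⟨t₁, Set.right_mem_Icc.mpr ht₁.1.le⟩ = us ∧
        ubar xT ⟨t₁, Set.left_mem_Icc.mpr ht₁.2.le⟩ = us) ∧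
      (∀ xT : TriangularControl.State m,
        TriangularControl.TrajectoryReaches (TriangularControl.field F)
          (Set.Icc t₁ T) (ubar xT) t₁ xs T xT) ∧
      (∀ x0 : TriangularControl.State m,
        TriangularControl.TrajectoryReaches (TriangularControl.field F)
          (Set.Icc t₀ t₁) (utilde x0) t₁ xs t₀ x0) :=
  theorem2p1_general m t₀ T t₁ ht₁ F hI hII.surjective xs us hrank
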